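/- Let $F$ and $G$ be continuous distribution functions on $\mathbb R$. Write $a_G=\inf\{x: G(x)>0\}$, $a_F=\inf\{x:F(x)>0\}$ and $b_F=\sup\{x: F(x)<1\}$ (values in $[-\infty,\infty]$), and assume $a_G<b_F$. Let $(Y_1,T_1),(Y_2,T_2),\dots$ be i.i.d. pairs on a probability space $(\Omega,\mathcal T,P)$ whose common law $H^*$ is the conditional law of $(Y,T)$ given $Y\ge T$, where $Y\sim F$ and $T\sim G$ are independent (random left truncation). Let $$F_n(y)=1-\prod_{i\le n:\,Y_i\le y}\frac{nC_n(Y_i)-1}{nC_n(Y_i)},\qquad C_n(y)=\frac1n\sum_{i=1}^n I\{T_i\le y\le Y_i\},$$ be the Lynden-Bell estimator, and let $F_0(x)=P(Y\le x\mid Y\ge a_G)$, for $Y\sim F$, be the identifiable part of $F$. Let $\mathcal F$ be a class of measurable functions $\varphi:\mathbb R\to\mathbb R$ with $\int|\varphi|\,dF<\infty$. Suppose that for every $\varepsilon>0$ the bracketing number $N_{[\,]}(\varepsilon,\mathcal F,L^1(F))$ is finite; this is the least number of brackets $[l,u]=\{\varphi: l\le\varphi\le u\}$ with $l,u\in L^1(F)$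 and $\int|u-l|\,dF<\varepsilon$ whose union contains $\mathcal F$. Then $$\sup_{\varphi\in\mathcal F}\left|\int\varphi\,d(F_n-F_0)\right|\longrightarrow 0\quad\text{a.s. as } n\to\infty .$$ If moreover $a_G\le a_F$ (so that $F_0=F$), then $$\sup_{\varphi\in\mathcal F}\left|\int\varphi\,d(F_n-F)\right|\longrightarrow 0\quad\text{a.s. as } n\to\infty .$$ In both cases the convergence is meant in the outer sense: the measurable cover functions of the suprema (the a.s. smallest measurable majorants) converge to $0$ almost surely. -/

import Mathlib

open MeasureTheory ProbabilityTheory Filter Topology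
open scoped ENNReal

noncomputable section

/-- Lower boundary `inf {x : F x > 0}` of the support of the distribution `μ` on the line, as an
extended real number, where `F` is the distribution function of `μ`. -/
def lowerBdry (μ : Measure ℝ) : EReal :=
  sInf ((fun x : ℝ => (x : EReal)) '' {x : ℝ | 0 < cdf μ x})

/-- Upper boundary `sup {x : F x < 1}` of the support of the distribution `μ` on the line, as an
extended real number. -/
def upperBdry (μ : Measure ℝ) : EReal :=
  sSup ((fun x : ℝ => (x : EReal)) '' {x : ℝ | cdf μ x < 1})

/-- The law `H*` of an observed pair: the conditional law of `(Y, T)` given `Y ≥ T`, where `Y` and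
`T` are independent with laws `μF` and `μG`. -/
def truncLaw (μF μG : Measure ℝ) : Measure (ℝ × ℝ) :=
  ProbabilityTheory.cond (μF.prod μG) {p : ℝ × ℝ | p.2 ≤ p.1}

/-- The identifiable part `F₀` of the lifetime law: the law of `Y` conditioned on `Y ≥ a_G`. -/
def identLaw (μF μG : Measure ℝ) : Measure ℝ :=
  ProbabilityTheory.cond μF {x : ℝ | lowerBdry μG ≤ (x : EReal)}

/-- `C_n(x) = n⁻¹ ∑_{i < n} 1{t i ≤ x ≤ y i}`, computed from the data `(y i, t i)`, `i < n`. -/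
def riskProp (n : ℕ) (y t : ℕ → ℝ) (x : ℝ) : ℝ :=
  (1 / (n : ℝ)) * ∑ i ∈ Finset.range n, if t i ≤ x ∧ x ≤ y i then (1 : ℝ) else 0

/-- The Lynden-Bell estimator
`F_n(x) = 1 - ∏_{i < n, y i ≤ x} (n C_n(y i) - 1) / (n C_n(y i))`. -/
def lyndenBell (n : ℕ) (y t : ℕ → ℝ) (x : ℝ) : ℝ :=
  1 - ∏ i ∈ (Finset.range n).filter (fun i => y i ≤ x),
    ((n : ℝ) * riskProp n y t (y i) - 1) / ((n : ℝ) * riskProp n y t (y i))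

theorem lyndenBell_factor_mem (n : ℕ) (y t : ℕ → ℝ) (i : ℕ) (hi : i ∈ Finset.range n) :
    0 ≤ ((n : ℝ) * riskProp n y t (y i) - 1) / ((n : ℝ) * riskProp n y t (y i)) ∧
      ((n : ℝ) * riskProp n y t (y i) - 1) / ((n : ℝ) * riskProp n y t (y i)) ≤ 1 := by
  have hn : (n : ℝ) ≠ 0 := by
    have := Finset.mem_range.mp hi
    exact_mod_cast (by omega : n ≠ 0)
  obtain ⟨k, hk⟩ : ∃ k : ℕ, (n : ℝ) * riskProp n y t (y i) = k := by
    refine ⟨((Finset.range n).filter (fun j => t j ≤ y i ∧ y i ≤ y j)).card, ?_⟩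
    unfold riskProp
    rw [← mul_assoc, mul_one_div_cancel hn, one_mul, Finset.sum_boole]
  rw [hk]
  rcases Nat.eq_zero_or_pos k with h0 | h0
  · simp [h0]
  · have h1 : (1 : ℝ) ≤ k := by exact_mod_cast h0
    exact ⟨div_nonneg (by linarith) (by linarith), (div_le_one (by linarith)).mpr (by linarith)⟩

theorem lyndenBell_mono (n : ℕ) (y t : ℕ → ℝ) : Monotone (lyndenBell n y t) := by
  intro a b hab
  unfold lyndenBell
  refine sub_le_sub_left ?_ 1
  rw [Finset.prod_filter, Finset.prod_filter]
  refine Finset.prod_le_prod ?_ ?_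
  · intro i hi
    split_ifs
    · exact (lyndenBell_factor_mem n y t i hi).1
    · exact zero_le_one
  · intro i hi
    have h := lyndenBell_factor_mem n y t i hi
    by_cases h1 : y i ≤ a
    · rw [if_pos h1, if_pos (h1.trans hab)]
    · rw [if_neg h1]
      split_ifs
      · exact h.2
      · exact le_rfl

theorem lyndenBell_rightCts (n : ℕ) (y t : ℕ → ℝ) (x : ℝ) :
    ContinuousWithinAt (lyndenBell n y t) (Set.Ici x) x := by
  have key : ∀ᶠ z in 𝓝[Set.Ici x] x, ∀ i ∈ Finset.range n, (y i ≤ z ↔ y i ≤ x) := by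
    rw [Filter.eventually_all_finset]
    intro i _
    by_cases h : y i ≤ x
    · filter_upwards [self_mem_nhdsWithin] with z hz
      exact ⟨fun _ => h, fun _ => h.trans hz⟩
    · filter_upwards [mem_nhdsWithin_of_mem_nhds (Iio_mem_nhds (not_le.mp h))] with z hz
      exact ⟨fun h' => absurd h' (not_le.mpr hz), fun h' => absurd h' h⟩
  have heq : lyndenBell n y t =ᶠ[𝓝[Set.Ici x] x] fun _ => lyndenBell n y t x := by
    filter_upwards [key] with z hz
    unfold lyndenBell
    rw [Finset.filter_congr hz]
  exact continuousWithinAt_const.congr_of_eventuallyEq heq rfl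

/-- The Lebesgue-Stieltjes measure `dF_n` of the Lynden-Bell estimator. -/
def lyndenBellMeasure (n : ℕ) (y t : ℕ → ℝ) : Measure ℝ :=
  StieltjesFunction.measure
    { toFun := lyndenBell n y t
      mono' := lyndenBell_mono n y t
      right_continuous' := lyndenBell_rightCts n y t }

/-- The bracketing number `N_[](ε, 𝓕, ‖·‖_p)`: the least number of brackets `[l, u]`, with `l` and
`u` in `L^p(μ)` and `‖u - l‖_p < ε`, that cover `𝓕`; it is `⊤` if no finite number is enough. -/
def bracketingNumber (ε : ℝ) (𝓕 : Set (ℝ → ℝ)) (p : ℝ≥0∞) (μ : Measure ℝ) : ℕ∞ :=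
  ⨅ (k : ℕ) (_ : ∃ l u : Fin k → ℝ → ℝ,
    (∀ j, MemLp (l j) p μ ∧ MemLp (u j) p μ ∧ eLpNorm (u j - l j) p μ < ENNReal.ofReal ε) ∧
      ∀ φ ∈ 𝓕, ∃ j, ∀ x, l j x ≤ φ x ∧ φ x ≤ u j x), (k : ℕ∞)

/-- `sup_{φ ∈ 𝓕} |∫ φ d(ν - μ)|`, with values in `[0, ∞]`. -/
def supDev (𝓕 : Set (ℝ → ℝ)) (ν μ : Measure ℝ) : ℝ≥0∞ :=
  ⨆ φ ∈ 𝓕, ENNReal.ofReal |(∫ x, φ x ∂ν) - ∫ x, φ x ∂μ|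

/-- `D'` is a measurable cover function of the (possibly non-measurable) `D`: a measurable
majorant of `D` that is almost surely below every measurable almost sure majorant. -/
structure IsMeasurableCover {Ω : Type*} [MeasurableSpace Ω] (P : Measure Ω)
    (D D' : Ω → ℝ≥0∞) : Prop where
  measurable : Measurable D'
  le : ∀ ω, D ω ≤ D' ω
  minimal : ∀ U : Ω → ℝ≥0∞, Measurable U → (∀ᵐ ω ∂P, D ω ≤ U ω) → ∀ᵐ ω ∂P, D' ω ≤ U ω

/-- Outer almost sure convergence to zero of a sequence of (possibly non-measurable) maps: the
measurable cover functions tend to zero almost surely. -/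
def TendstoZeroOuterAS {Ω : Type*} [MeasurableSpace Ω] (P : Measure Ω)
    (D : ℕ → Ω → ℝ≥0∞) : Prop :=
  ∃ D' : ℕ → Ω → ℝ≥0∞, (∀ n, IsMeasurableCover P (D n) (D' n)) ∧
    ∀ᵐ ω ∂P, Tendsto (fun n => D' n ω) atTop (𝓝 0)

end

/-! Bracketing reduces the theorem to a strong law for one integrable φ,
`ae_tendsto_sum_jumpWeight`: an integral of a member of the class is trapped between the integrals
of two bracket ends, and only finitely many ends occur. Hence the supremum has a measurable
majorant, which also settles the outer convergence.

For the strong law, let α = P(Y ≥ T), C = G(1 - F)/α and p₀ = F{G > 0}. Almost surely there are no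
ties, so F_n is discrete with mass S_n(Y_i) / (n C_n(Y_i)) at Y_i, where S_n(x) = 1 - F_n(x-). On
compact intervals inside {G > 0, F < 1}, C_n → C and S_n → (1 - F)/p₀ uniformly. An observed
lifetime has law (G/α) dF, so the classical strong law gives there the limit ∫ φ (1 - F)/(p₀ C)
(G/α) dF = ∫ φ/p₀ dF. The difficulty lies at the two ends, where C vanishes.

Right end: the product limit decreases at least as fast as the risk set, so every weight to the
right of x is at most 1/(n C_n(x)) (`jumpWeight_le_of_le`). The tail is therefore at most a sample
mean of φ 1{Y > b}, up to a constant.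

Left end: the weights are at most 1/(n C_n(Y_i)), so it is enough that the hazard sums H_n = ∑
ψ(Y_i)/(n C_n(Y_i)), with ψ = (φ + 1) 1{x ≤ a}, are small for all n at once. Averaged over the
deleted observation, a hazard sum does not increase (`sum_hazardSum_erase_le`). By exchangeability
H_N, H_{N-1}, ... is then a nonnegative supermartingale in reversed time, and its maximal inequality
bounds λ P(max_{n ≤ N} H_n ≥ λ) by E H_N. Finally E H_N ≤ ∫ ψ/C · (G/α) dF, that is ∫ ψ/(1 - F) dF
over {G > 0}, which tends to 0 as a decreases to the left boundary of G. The summand 1 in φ + 1 lets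
the same bound show that the factors of S_n left of a have product near 1; the remaining factors are
compared with the exponential of the cumulative hazard. -/

noncomputable section

/-! ### The Lynden-Bell estimator of a given sample -/

/-- The number `n C_n(x)` of pairs `(y i, t i)`, `i < n`, that are at risk at `x`. -/
def atRisk (n : ℕ) (y t : ℕ → ℝ) (x : ℝ) : ℝ :=
  ∑ i ∈ Finset.range n, if t i ≤ x ∧ x ≤ y i then (1 : ℝ) else 0

/-- The product limit `1 - F_n(x-)`. -/
def survivalBelow (n : ℕ) (y t : ℕ → ℝ) (x : ℝ) : ℝ :=
  ∏ j ∈ (Finset.range n).filter (fun j => y j < x), (1 - 1 / atRisk n y t (y j))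

/-- The mass which the Lynden-Bell estimator gives to the observation `y i`. -/
def jumpWeight (n : ℕ) (y t : ℕ → ℝ) (i : ℕ) : ℝ :=
  survivalBelow n y t (y i) / atRisk n y t (y i)

/-- A sample without ties in which every lifetime is at least its truncation time. -/
structure IsTruncSample (y t : ℕ → ℝ) : Prop where
  inj : Function.Injective y
  le : ∀ i, t i ≤ y i

theorem mul_riskProp {n : ℕ} (hn : n ≠ 0) (y t : ℕ → ℝ) (x : ℝ) :
    (n : ℝ) * riskProp n y t x = atRisk n y t x := by
  have hn : (n : ℝ) ≠ 0 := by exact_mod_cast hn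
  unfold riskProp atRisk
  rw [← mul_assoc, mul_one_div_cancel hn, one_mul]

theorem atRisk_nonneg (n : ℕ) (y t : ℕ → ℝ) (x : ℝ) : 0 ≤ atRisk n y t x :=
  Finset.sum_nonneg fun i _ => by split_ifs <;> norm_num

theorem one_le_atRisk {n : ℕ} {y t : ℕ → ℝ} {i : ℕ} (hi : i < n) (h : t i ≤ y i) :
    1 ≤ atRisk n y t (y i) := by
  unfold atRisk
  refine le_trans ?_ (Finset.single_le_sum
    (f := fun j => if t j ≤ y i ∧ y i ≤ y j then (1 : ℝ) else 0)
    (fun j _ => by positivity) (Finset.mem_range.mpr hi))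
  simp [h]

theorem one_sub_inv_atRisk_mem {n : ℕ} {y t : ℕ → ℝ} {i : ℕ} (hi : i < n) (h : t i ≤ y i) :
    0 ≤ 1 - 1 / atRisk n y t (y i) ∧ 1 - 1 / atRisk n y t (y i) ≤ 1 := by
  have h1 := one_le_atRisk hi h
  have h2 : 1 / atRisk n y t (y i) ≤ 1 := by
    rw [div_le_one (by linarith)]; exact h1
  have h3 : 0 ≤ 1 / atRisk n y t (y i) := by positivity
  constructor <;> linarith

theorem survivalBelow_nonneg {y t : ℕ → ℝ} (h : ∀ i, t i ≤ y i) (n : ℕ) (x : ℝ) :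
    0 ≤ survivalBelow n y t x :=
  Finset.prod_nonneg fun j hj =>
    (one_sub_inv_atRisk_mem (Finset.mem_range.mp (Finset.mem_filter.mp hj).1) (h j)).1

theorem survivalBelow_le_one {y t : ℕ → ℝ} (h : ∀ i, t i ≤ y i) (n : ℕ) (x : ℝ) :
    survivalBelow n y t x ≤ 1 :=
  Finset.prod_le_one
    (fun j hj =>
      (one_sub_inv_atRisk_mem (Finset.mem_range.mp (Finset.mem_filter.mp hj).1) (h j)).1)
    (fun j hj =>
      (one_sub_inv_atRisk_mem (Finset.mem_range.mp (Finset.mem_filter.mp hj).1) (h j)).2)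

theorem survivalBelow_eq_mul {n : ℕ} {y t : ℕ → ℝ} {x x' : ℝ} (hx : x ≤ x') :
    survivalBelow n y t x' = survivalBelow n y t x *
      ∏ j ∈ (Finset.range n).filter (fun j => x ≤ y j ∧ y j < x'),
        (1 - 1 / atRisk n y t (y j)) := by
  unfold survivalBelow
  rw [← Finset.prod_union]
  · refine Finset.prod_congr ?_ fun _ _ => rfl
    ext j
    simp only [Finset.mem_filter, Finset.mem_union, Finset.mem_range]
    constructor
    · rintro ⟨h1, h2⟩
      rcases lt_or_ge (y j) x with h | h
      · exact Or.inl ⟨h1, h⟩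
      · exact Or.inr ⟨h1, h, h2⟩
    · rintro (⟨h1, h2⟩ | ⟨h1, h2, h3⟩)
      · exact ⟨h1, h2.trans_le hx⟩
      · exact ⟨h1, h3⟩
  · rw [Finset.disjoint_filter]
    intro j _ h1 h2
    exact absurd h1 (not_lt.mpr h2.1)

theorem survivalBelow_antitone {y t : ℕ → ℝ} (h : ∀ i, t i ≤ y i) (n : ℕ) :
    Antitone (survivalBelow n y t) := by
  intro x x' hx
  rw [survivalBelow_eq_mul hx]
  refine mul_le_of_le_one_right (survivalBelow_nonneg h n x) (Finset.prod_le_one ?_ ?_)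
  · intro j hj
    exact (one_sub_inv_atRisk_mem (Finset.mem_range.mp (Finset.mem_filter.mp hj).1) (h j)).1
  · intro j hj
    exact (one_sub_inv_atRisk_mem (Finset.mem_range.mp (Finset.mem_filter.mp hj).1) (h j)).2

theorem jumpWeight_nonneg {y t : ℕ → ℝ} (h : ∀ i, t i ≤ y i) (n i : ℕ) :
    0 ≤ jumpWeight n y t i :=
  div_nonneg (survivalBelow_nonneg h n _) (atRisk_nonneg n y t _)

theorem jumpWeight_le_inv_atRisk {y t : ℕ → ℝ} (h : ∀ i, t i ≤ y i) (n i : ℕ) :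
    jumpWeight n y t i ≤ 1 / atRisk n y t (y i) :=
  div_le_div_of_nonneg_right (survivalBelow_le_one h n _) (atRisk_nonneg n y t _)

/-- Telescoping of the product limit over distinct observations. -/
theorem one_sub_prod_eq_sum {y : ℕ → ℝ} (hy : Function.Injective y) (g : ℕ → ℝ) (s : Finset ℕ) :
    1 - ∏ i ∈ s, (1 - g i) =
      ∑ i ∈ s, g i * ∏ j ∈ s.filter (fun j => y j < y i), (1 - g j) := by
  -- Inserting the largest observation adds one factor and one term; without ties, the observations
  -- strictly below it are exactly the old set.
  induction s using Finset.induction_on_max_value y with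
  | empty => simp
  | insert a s ha hmax ih =>
    rw [Finset.prod_insert ha, Finset.sum_insert ha]
    have h1 : (insert a s).filter (fun j => y j < y a) = s := by
      ext j
      simp only [Finset.mem_filter, Finset.mem_insert]
      constructor
      · rintro ⟨rfl | h, h'⟩
        · exact absurd h' (lt_irrefl _)
        · exact h
      · intro h
        refine ⟨Or.inr h, lt_of_le_of_ne (hmax j h) fun he => ha ?_⟩
        rw [← hy he]; exact h
    have h2 : ∀ i ∈ s, (insert a s).filter (fun j => y j < y i) =
        s.filter (fun j => y j < y i) := by
      intro i hi
      rw [Finset.filter_insert, if_neg (not_lt.mpr (hmax i hi))]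
    rw [h1, Finset.sum_congr rfl fun i hi => by rw [h2 i hi], ← ih]
    ring

/-- Telescoping turns the product limit into a sum of point masses, the form in which boundary
contributions can be estimated term by term. -/
theorem lyndenBell_eq_sum {y t : ℕ → ℝ} (h : IsTruncSample y t) (n : ℕ) (x : ℝ) :
    lyndenBell n y t x =
      ∑ i ∈ (Finset.range n).filter (fun i => y i ≤ x), jumpWeight n y t i := by
  unfold lyndenBell
  have h1 : ∏ i ∈ (Finset.range n).filter (fun i => y i ≤ x),
      ((n : ℝ) * riskProp n y t (y i) - 1) / ((n : ℝ) * riskProp n y t (y i)) =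
      ∏ i ∈ (Finset.range n).filter (fun i => y i ≤ x), (1 - 1 / atRisk n y t (y i)) := by
    refine Finset.prod_congr rfl fun i hi => ?_
    have hi' := Finset.mem_range.mp (Finset.mem_filter.mp hi).1
    rw [mul_riskProp (by omega)]
    have := one_le_atRisk hi' (h.le i)
    field_simp
  rw [h1, one_sub_prod_eq_sum h.inj]
  refine Finset.sum_congr rfl fun i hi => ?_
  have hi' := (Finset.mem_filter.mp hi).2
  unfold jumpWeight
  have hdiv : ∀ a b : ℝ, a / b = 1 / b * a := fun a b => by ring
  rw [hdiv (survivalBelow n y t (y i))]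
  refine congrArg₂ (· * ·) rfl (Finset.prod_congr ?_ fun _ _ => rfl)
  ext j
  simp only [Finset.mem_filter]
  constructor
  · rintro ⟨⟨h1, _⟩, h3⟩; exact ⟨h1, h3⟩
  · rintro ⟨h1, h3⟩; exact ⟨⟨h1, h3.le.trans hi'⟩, h3⟩

theorem lyndenBellMeasure_eq_sum {y t : ℕ → ℝ} (h : IsTruncSample y t) (n : ℕ) :
    lyndenBellMeasure n y t = ∑ i ∈ Finset.range n,
      ENNReal.ofReal (jumpWeight n y t i) • Measure.dirac (y i) := by
  have : IsLocallyFiniteMeasure (lyndenBellMeasure n y t) := by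
    unfold lyndenBellMeasure; infer_instance
  refine Measure.ext_of_Ioc _ _ fun a b hab => ?_
  unfold lyndenBellMeasure
  rw [StieltjesFunction.measure_Ioc]
  change ENNReal.ofReal (lyndenBell n y t b - lyndenBell n y t a) = _
  rw [lyndenBell_eq_sum h, lyndenBell_eq_sum h, Finset.sum_filter, Finset.sum_filter,
    ← Finset.sum_sub_distrib, Measure.finsetSum_apply]
  have hterm : ∀ i ∈ Finset.range n,
      ((if y i ≤ b then jumpWeight n y t i else 0) - if y i ≤ a then jumpWeight n y t i else 0) =
        if y i ∈ Set.Ioc a b then jumpWeight n y t i else 0 := by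
    intro i _
    by_cases h1 : y i ≤ a
    · simp [h1, h1.trans hab.le]
    · by_cases h2 : y i ≤ b
      · simp [h1, h2, not_le.mp h1]
      · simp [h1, h2]
  rw [Finset.sum_congr rfl hterm, ENNReal.ofReal_sum_of_nonneg]
  · refine Finset.sum_congr rfl fun i _ => ?_
    rw [Measure.smul_apply, Measure.dirac_apply' _ measurableSet_Ioc, smul_eq_mul]
    by_cases h1 : y i ∈ Set.Ioc a b
    · simp only [if_pos h1, Set.indicator_of_mem h1, Pi.one_apply, mul_one]
    · simp only [if_neg h1, Set.indicator_of_notMem h1, mul_zero, ENNReal.ofReal_zero]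
  · intro i _
    split_ifs
    · exact jumpWeight_nonneg h.le n i
    · exact le_rfl

/-- The measure is a finite sum of point masses, so no measurability or integrability of `φ` is
needed and the formula applies to every member of the class. -/
theorem integral_lyndenBellMeasure {y t : ℕ → ℝ} (h : IsTruncSample y t) (n : ℕ) (φ : ℝ → ℝ) :
    ∫ x, φ x ∂(lyndenBellMeasure n y t) =
      ∑ i ∈ Finset.range n, jumpWeight n y t i * φ (y i) := by
  rw [lyndenBellMeasure_eq_sum h, integral_finsetSum_measure]
  · refine Finset.sum_congr rfl fun i _ => ?_
    rw [integral_smul_measure, integral_dirac, smul_eq_mul,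
      ENNReal.toReal_ofReal (jumpWeight_nonneg h.le n i)]
  · intro i _
    exact (integrable_dirac (by simp)).smul_measure ENNReal.ofReal_ne_top

/-! ### Domination of the weights to the right of a point -/

/-- The product limit over `[x, x')` is at most the ratio of the risk set sizes. -/
theorem prod_le_atRisk_div {y t : ℕ → ℝ} (h : IsTruncSample y t) {n : ℕ} {x : ℝ}
    (hx : 0 < atRisk n y t x) (k : ℕ) : ∀ x' : ℝ, x ≤ x' →
      ((Finset.range n).filter (fun j => x ≤ y j ∧ y j < x')).card = k →
      ∏ j ∈ (Finset.range n).filter (fun j => x ≤ y j ∧ y j < x'),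
        (1 - 1 / atRisk n y t (y j)) ≤ atRisk n y t x' / atRisk n y t x := by
  -- Induction on the number of observations in `[x, x')`, removing the largest one, `y j`. Its
  -- factor (N - 1)/N, with N the risk count at `y j`, cancels the numerator of the inductive bound.
  induction k with
  | zero =>
    intro x' hxx' hk
    rw [Finset.card_eq_zero] at hk
    rw [hk, Finset.prod_empty, one_le_div hx]
    refine Finset.sum_le_sum fun i hi => ?_
    by_cases h1 : t i ≤ x ∧ x ≤ y i
    · have h2 : ¬ (x ≤ y i ∧ y i < x') := fun h2 => by
        have : i ∈ (Finset.range n).filter (fun j => x ≤ y j ∧ y j < x') :=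
          Finset.mem_filter.mpr ⟨hi, h2⟩
        rw [hk] at this
        exact absurd this (Finset.notMem_empty _)
      have h3 : x' ≤ y i := not_lt.mp fun h3 => h2 ⟨h1.2, h3⟩
      rw [if_pos h1, if_pos ⟨h1.1.trans hxx', h3⟩]
    · rw [if_neg h1]; positivity
  | succ k ih =>
    intro x' hxx' hk
    have hne : ((Finset.range n).filter (fun j => x ≤ y j ∧ y j < x')).Nonempty := by
      rw [← Finset.card_pos]; omega
    obtain ⟨j, hj, hmax⟩ := Finset.exists_max_image _ y hne
    have hj' := Finset.mem_filter.mp hj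
    have hins : (Finset.range n).filter (fun i => x ≤ y i ∧ y i < x') =
        insert j ((Finset.range n).filter (fun i => x ≤ y i ∧ y i < y j)) := by
      ext i
      simp only [Finset.mem_insert, Finset.mem_filter]
      constructor
      · intro hi
        by_cases hij : i = j
        · exact Or.inl hij
        · exact Or.inr ⟨hi.1, hi.2.1, lt_of_le_of_ne (hmax i (Finset.mem_filter.mpr hi))
            fun he => hij (h.inj he)⟩
      · rintro (rfl | hi)
        · exact hj'
        · exact ⟨hi.1, hi.2.1, hi.2.2.trans hj'.2.2⟩
    have hnot : j ∉ (Finset.range n).filter (fun i => x ≤ y i ∧ y i < y j) := by simp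
    have hcard := congrArg Finset.card hins
    rw [hk, Finset.card_insert_of_notMem hnot] at hcard
    have hjn := Finset.mem_range.mp hj'.1
    have hNj := one_le_atRisk hjn (h.le j)
    have hIH := ih (y j) hj'.2.1 (by omega)
    rw [hins, Finset.prod_insert hnot]
    -- As `y j` is the last observation before `x'`, everybody at risk at `y j` except `j` itself is
    -- still at risk at `x'`.
    have hstep : atRisk n y t (y j) - 1 ≤ atRisk n y t x' := by
      have : atRisk n y t (y j) ≤
          ∑ i ∈ Finset.range n, ((if t i ≤ x' ∧ x' ≤ y i then (1 : ℝ) else 0) +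
            if i = j then 1 else 0) := by
        refine Finset.sum_le_sum fun i hi => ?_
        by_cases h1 : t i ≤ y j ∧ y j ≤ y i
        · by_cases hij : i = j
          · rw [if_pos h1, if_pos hij]
            have : (0 : ℝ) ≤ if t i ≤ x' ∧ x' ≤ y i then (1 : ℝ) else 0 := by positivity
            linarith
          · have h3 : x' ≤ y i := by
              by_contra h3
              have := hmax i (Finset.mem_filter.mpr
                ⟨hi, hj'.2.1.trans h1.2, not_le.mp h3⟩)
              exact hij (h.inj (le_antisymm this h1.2))
            rw [if_pos h1, if_pos ⟨h1.1.trans hj'.2.2.le, h3⟩, if_neg hij, add_zero]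
        · rw [if_neg h1]; positivity
      rw [Finset.sum_add_distrib, Finset.sum_ite_eq' (Finset.range n) j, if_pos hj'.1] at this
      unfold atRisk at this ⊢
      linarith
    calc (1 - 1 / atRisk n y t (y j)) * _
        ≤ (1 - 1 / atRisk n y t (y j)) * (atRisk n y t (y j) / atRisk n y t x) :=
          mul_le_mul_of_nonneg_left hIH (one_sub_inv_atRisk_mem hjn (h.le j)).1
      _ = (atRisk n y t (y j) - 1) / atRisk n y t x := by
          field_simp
      _ ≤ atRisk n y t x' / atRisk n y t x := div_le_div_of_nonneg_right hstep hx.le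

/-- The weights of the Lynden-Bell estimator to the right of `x` are at most `1 / (n C_n(x))`. -/
theorem jumpWeight_le_of_le {y t : ℕ → ℝ} (h : IsTruncSample y t) {n i : ℕ} (hi : i < n) {x : ℝ}
    (hx : 0 < atRisk n y t x) (hxi : x ≤ y i) :
    jumpWeight n y t i ≤ 1 / atRisk n y t x := by
  have h1 := prod_le_atRisk_div h hx _ (y i) hxi rfl
  have hN := one_le_atRisk hi (h.le i)
  unfold jumpWeight
  rw [div_le_iff₀ (by linarith), survivalBelow_eq_mul hxi]
  calc _ ≤ 1 * _ := mul_le_mul_of_nonneg_right (survivalBelow_le_one h.le n x)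
        (Finset.prod_nonneg fun j hj =>
          (one_sub_inv_atRisk_mem (Finset.mem_range.mp (Finset.mem_filter.mp hj).1) (h.le j)).1)
    _ ≤ atRisk n y t (y i) / atRisk n y t x := by rw [one_mul]; exact h1
    _ = 1 / atRisk n y t x * atRisk n y t (y i) := by ring

/-! ### Comparison of products with sums and exponentials -/

/-- `1 - ∏ (1 - g i) ≤ ∑ g i` for numbers `g i` in `[0, 1]`. -/
theorem one_sub_sum_le_prod {ι : Type*} (s : Finset ι) (g : ι → ℝ) (h0 : ∀ i ∈ s, 0 ≤ g i)
    (h1 : ∀ i ∈ s, g i ≤ 1) : 1 - ∑ i ∈ s, g i ≤ ∏ i ∈ s, (1 - g i) := by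
  classical
  induction s using Finset.induction_on with
  | empty => simp
  | insert a s ha ih =>
    rw [Finset.sum_insert ha, Finset.prod_insert ha]
    have h2 := ih (fun i hi => h0 i (Finset.mem_insert_of_mem hi))
      fun i hi => h1 i (Finset.mem_insert_of_mem hi)
    have h3 : ∏ i ∈ s, (1 - g i) ≤ 1 := Finset.prod_le_one
      (fun i hi => sub_nonneg.mpr (h1 i (Finset.mem_insert_of_mem hi)))
      (fun i hi => by linarith [h0 i (Finset.mem_insert_of_mem hi)])
    have h4 := h0 a (Finset.mem_insert_self a s)
    nlinarith

/-- Each factor satisfies |1 - g - exp(-g)| ≤ g², and all factors lie in [0, 1], so the errors only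
add up when factors are replaced one at a time. -/
theorem abs_prod_sub_exp_le {ι : Type*} (s : Finset ι) (g : ι → ℝ) (h0 : ∀ i ∈ s, 0 ≤ g i)
    (h1 : ∀ i ∈ s, g i ≤ 1) :
    |∏ i ∈ s, (1 - g i) - Real.exp (-∑ i ∈ s, g i)| ≤ ∑ i ∈ s, g i ^ 2 := by
  classical
  induction s using Finset.induction_on with
  | empty => simp
  | insert a s ha ih =>
    rw [Finset.sum_insert ha, Finset.sum_insert ha, Finset.prod_insert ha, neg_add, Real.exp_add]
    have h0' := fun i hi => h0 i (Finset.mem_insert_of_mem hi)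
    have h1' := fun i hi => h1 i (Finset.mem_insert_of_mem hi)
    have h2 := ih h0' h1'
    have ha0 := h0 a (Finset.mem_insert_self a s)
    have ha1 := h1 a (Finset.mem_insert_self a s)
    have hexp : |(1 - g a) - Real.exp (-g a)| ≤ g a ^ 2 := by
      have h5 := Real.abs_exp_sub_one_sub_id_le (x := -g a) (by rw [abs_neg, abs_of_nonneg ha0]; exact ha1)
      rw [abs_sub_comm]
      have h6 : Real.exp (-g a) - (1 - g a) = Real.exp (-g a) - 1 - -g a := by ring
      rw [h6, ← neg_sq]; exact h5
    have h6 : 0 < Real.exp (-∑ i ∈ s, g i) := Real.exp_pos _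
    have h7 : Real.exp (-∑ i ∈ s, g i) ≤ 1 := by
      rw [Real.exp_le_one_iff, neg_nonpos]; exact Finset.sum_nonneg h0'
    have h8 : (1 - g a) * ∏ i ∈ s, (1 - g i) - Real.exp (-g a) * Real.exp (-∑ i ∈ s, g i) =
        (1 - g a) * (∏ i ∈ s, (1 - g i) - Real.exp (-∑ i ∈ s, g i)) +
        ((1 - g a) - Real.exp (-g a)) * Real.exp (-∑ i ∈ s, g i) := by ring
    rw [h8]
    refine (abs_add_le _ _).trans ?_
    rw [abs_mul, abs_mul, abs_of_nonneg (by linarith : (0 : ℝ) ≤ 1 - g a), abs_of_pos h6]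
    have h9 : (1 - g a) * |∏ i ∈ s, (1 - g i) - Real.exp (-∑ i ∈ s, g i)| ≤ 1 * ∑ i ∈ s, g i ^ 2 :=
      mul_le_mul (by linarith) h2 (abs_nonneg _) zero_le_one
    have h10 : |(1 - g a) - Real.exp (-g a)| * Real.exp (-∑ i ∈ s, g i) ≤ g a ^ 2 * 1 :=
      mul_le_mul hexp h7 h6.le (sq_nonneg _)
    linarith

/-! ### A maximal inequality for cumulative hazard sums of exchangeable data -/

/-- The number of pairs `z j = (y, t)`, `j ∈ s`, at risk at `x`. -/
def riskCount (z : ℕ → ℝ × ℝ) (s : Finset ℕ) (x : ℝ) : ℝ≥0∞ :=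
  ∑ j ∈ s, if (z j).2 ≤ x ∧ x ≤ (z j).1 then 1 else 0

/-- The integral of `ψ` against the estimated cumulative hazard of the subsample `s`. -/
def hazardSum (ψ : ℝ → ℝ≥0∞) (z : ℕ → ℝ × ℝ) (s : Finset ℕ) : ℝ≥0∞ :=
  ∑ i ∈ s, ψ (z i).1 * (riskCount z s (z i).1)⁻¹

/-! ### Permutations and deletions of observations -/

theorem riskCount_comp_perm (z : ℕ → ℝ × ℝ) (σ : Equiv.Perm ℕ) (s : Finset ℕ) (x : ℝ) :
    riskCount (z ∘ σ) s x = riskCount z (s.map σ.toEmbedding) x := by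
  simp only [riskCount, Finset.sum_map, Function.comp_apply, Equiv.coe_toEmbedding]

theorem hazardSum_comp_perm (ψ : ℝ → ℝ≥0∞) (z : ℕ → ℝ × ℝ) (σ : Equiv.Perm ℕ) (s : Finset ℕ) :
    hazardSum ψ (z ∘ σ) s = hazardSum ψ z (s.map σ.toEmbedding) := by
  simp [hazardSum, riskCount_comp_perm]

theorem map_swap_of_mem {s : Finset ℕ} {i j : ℕ} (hi : i ∈ s) (hj : j ∈ s) :
    s.map (Equiv.swap i j).toEmbedding = s := by
  ext k
  rw [Finset.mem_map_equiv, Equiv.symm_swap]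
  rcases eq_or_ne k i with rfl | h1
  · simp [hi, hj]
  rcases eq_or_ne k j with rfl | h2
  · simp [hi, hj]
  rw [Equiv.swap_apply_of_ne_of_ne h1 h2]

theorem map_swap_range {k m : ℕ} (hk : k ≤ m) :
    (Finset.range m).map (Equiv.swap k m).toEmbedding = (Finset.range (m + 1)).erase k := by
  ext j
  rw [Finset.mem_map_equiv, Equiv.symm_swap, Finset.mem_erase, Finset.mem_range, Finset.mem_range]
  rcases eq_or_ne j k with rfl | h1
  · simp
  rcases eq_or_ne j m with rfl | h2
  · rw [Equiv.swap_apply_right]; omega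
  rw [Equiv.swap_apply_of_ne_of_ne h1 h2]; omega

theorem riskCount_eq_card (z : ℕ → ℝ × ℝ) (s : Finset ℕ) (x : ℝ) :
    riskCount z s x = ((s.filter fun j => (z j).2 ≤ x ∧ x ≤ (z j).1).card : ℝ≥0∞) := by
  rw [riskCount, Finset.sum_boole]

/-- Deleting one observation at a time does not increase the hazard sum on average. -/
theorem sum_hazardSum_erase_le (ψ : ℝ → ℝ≥0∞) (z : ℕ → ℝ × ℝ) (s : Finset ℕ)
    (hz : ∀ i ∈ s, (z i).2 ≤ (z i).1) :
    ∑ k ∈ s, hazardSum ψ z (s.erase k) ≤ s.card * hazardSum ψ z s := by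
  have hcomm : ∑ k ∈ s, hazardSum ψ z (s.erase k) =
      ∑ i ∈ s, ψ (z i).1 * ∑ k ∈ s.erase i, (riskCount z (s.erase k) (z i).1)⁻¹ := by
    simp only [hazardSum, Finset.mul_sum]
    refine Finset.sum_comm' fun k i => ?_
    simp only [Finset.mem_erase, ne_eq]
    constructor
    · rintro ⟨h1, h2, h3⟩; exact ⟨⟨fun h => h2 h.symm, h1⟩, h3⟩
    · rintro ⟨⟨h1, h2⟩, h3⟩; exact ⟨h2, fun h => h1 h.symm, h3⟩
  rw [hcomm, hazardSum, Finset.mul_sum]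
  refine Finset.sum_le_sum fun i hi => ?_
  rw [mul_left_comm]
  refine mul_le_mul_right ?_ _
  set p : ℕ → Prop := fun j => (z j).2 ≤ (z i).1 ∧ (z i).1 ≤ (z j).1 with hp
  set R := s.filter p with hR
  have hiR : i ∈ R := Finset.mem_filter.mpr ⟨hi, hz i hi, le_rfl⟩
  have hcnt : riskCount z s (z i).1 = (R.card : ℝ≥0∞) := riskCount_eq_card z s _
  have hcard : R.card ≤ s.card := Finset.card_le_card (Finset.filter_subset _ _)
  have hpos : 1 ≤ R.card := Finset.card_pos.mpr ⟨i, hiR⟩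
  rw [hcnt, ← Finset.sum_filter_add_sum_filter_not (s.erase i) p]
  -- There are `R.card - 1` deletions inside the risk set of `i`, each leaving a count of `R.card -
  -- 1`: their total is 1, or an empty sum if `i` alone is at risk.
  have h1 : ∑ k ∈ (s.erase i).filter p, (riskCount z (s.erase k) (z i).1)⁻¹ ≤ 1 := by
    have hval : ∀ k ∈ (s.erase i).filter p, (riskCount z (s.erase k) (z i).1)⁻¹ =
        (((R.card - 1 : ℕ) : ℝ≥0∞))⁻¹ := by
      intro k hk
      obtain ⟨hk1, hk2⟩ := Finset.mem_filter.mp hk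
      rw [riskCount_eq_card, Finset.filter_erase, Finset.card_erase_of_mem]
      exact Finset.mem_filter.mpr ⟨Finset.mem_of_mem_erase hk1, hk2⟩
    rw [Finset.sum_congr rfl hval, Finset.sum_const, Finset.filter_erase,
      Finset.card_erase_of_mem hiR, nsmul_eq_mul]
    exact ENNReal.mul_inv_le_one _
  -- Deletions outside the risk set leave the count unchanged. Together the two kinds give at most 1
  -- + (|s| - |R|)/|R| = |s|/|R|.
  have h2 : ∑ k ∈ (s.erase i).filter (fun k => ¬ p k), (riskCount z (s.erase k) (z i).1)⁻¹ =
      ((s.card - R.card : ℕ) : ℝ≥0∞) * ((R.card : ℝ≥0∞))⁻¹ := by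
    have hval : ∀ k ∈ (s.erase i).filter (fun k => ¬ p k),
        (riskCount z (s.erase k) (z i).1)⁻¹ = ((R.card : ℝ≥0∞))⁻¹ := by
      intro k hk
      obtain ⟨hk1, hk2⟩ := Finset.mem_filter.mp hk
      rw [riskCount_eq_card, Finset.filter_erase, Finset.erase_eq_of_notMem]
      exact fun h => hk2 (Finset.mem_filter.mp h).2
    rw [Finset.sum_congr rfl hval, Finset.sum_const, nsmul_eq_mul, Finset.filter_erase,
      Finset.erase_eq_of_notMem (s := s.filter fun k => ¬ p k)
        (fun h => (Finset.mem_filter.mp h).2 ⟨hz i hi, le_rfl⟩)]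
    congr 2
    have := Finset.card_filter_add_card_filter_not (s := s) p
    have hRp : R.card = (s.filter p).card := rfl
    rw [hRp]
    omega
  have hR0 : (R.card : ℝ≥0∞) ≠ 0 := by
    rw [Nat.cast_ne_zero]; omega
  calc _ ≤ 1 + ((s.card - R.card : ℕ) : ℝ≥0∞) * ((R.card : ℝ≥0∞))⁻¹ := add_le_add h1 h2.le
    _ = (R.card : ℝ≥0∞) * ((R.card : ℝ≥0∞))⁻¹ +
        ((s.card - R.card : ℕ) : ℝ≥0∞) * ((R.card : ℝ≥0∞))⁻¹ := by
      rw [ENNReal.mul_inv_cancel hR0 (ENNReal.natCast_ne_top _)]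
    _ = (s.card : ℝ≥0∞) * ((R.card : ℝ≥0∞))⁻¹ := by
      rw [← add_mul, ← Nat.cast_add, Nat.add_sub_cancel' hcard]

theorem measurable_riskCount (s : Finset ℕ) {f : (ℕ → ℝ × ℝ) → ℝ} (hf : Measurable f) :
    Measurable fun z : ℕ → ℝ × ℝ => riskCount z s (f z) := by
  unfold riskCount
  refine Finset.measurable_sum _ fun j _ => Measurable.ite ?_ measurable_const measurable_const
  exact (measurableSet_le (by fun_prop) hf).inter (measurableSet_le hf (by fun_prop))

theorem measurable_hazardSum {ψ : ℝ → ℝ≥0∞} (hψ : Measurable ψ) (s : Finset ℕ) :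
    Measurable fun z : ℕ → ℝ × ℝ => hazardSum ψ z s := by
  unfold hazardSum
  exact Finset.measurable_sum _ fun i _ => (hψ.comp (by fun_prop)).mul
    (measurable_riskCount s (by fun_prop)).inv

section Exchangeable

theorem lintegral_comp_perm (κ : Measure (ℝ × ℝ)) [IsProbabilityMeasure κ] (σ : Equiv.Perm ℕ)
    {f : (ℕ → ℝ × ℝ) → ℝ≥0∞} (hf : Measurable f) :
    ∫⁻ z, f (z ∘ σ) ∂(Measure.infinitePi fun _ : ℕ => κ) =
      ∫⁻ z, f z ∂(Measure.infinitePi fun _ : ℕ => κ) := by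
  -- Reindexing along `σ.symm` is the map `z ↦ z ∘ σ`.
  have h := Measure.infinitePi_map_piCongrLeft (fun _ : ℕ => κ) σ.symm
  conv_rhs => rw [← h]
  rw [lintegral_map hf (by fun_prop)]
  refine lintegral_congr fun z => ?_
  congr 1
  ext1 j
  have := MeasurableEquiv.piCongrLeft_apply_apply (σ.symm) (β := fun _ : ℕ => ℝ × ℝ) z (σ j)
  rw [Equiv.symm_apply_apply] at this
  exact this.symm

theorem ae_forall_infinitePi {κ : Measure (ℝ × ℝ)} [IsProbabilityMeasure κ] {p : ℝ × ℝ → Prop}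
    (h : ∀ᵐ x ∂κ, p x) : ∀ᵐ z ∂(Measure.infinitePi fun _ : ℕ => κ), ∀ i, p (z i) := by
  rw [ae_all_iff]
  intro i
  have := (measurePreserving_eval_infinitePi (fun _ : ℕ => κ) i).quasiMeasurePreserving
  exact this.ae h

variable (κ : Measure (ℝ × ℝ)) [IsProbabilityMeasure κ]

/-- The reversed supermartingale property, tested on an event that ignores the order of the first `m
+ 1` observations. Swapping `k` and `m` turns the sum over the first `m` into the sum with `k`
deleted; averaging over `k` and applying `sum_hazardSum_erase_le` gives the claim. -/
theorem setLIntegral_hazardSum_le (hκ : ∀ᵐ p ∂κ, p.2 ≤ p.1) {ψ : ℝ → ℝ≥0∞} (hψ : Measurable ψ)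
    (m : ℕ) {A : Set (ℕ → ℝ × ℝ)} (hA : MeasurableSet A)
    (hinv : ∀ k ≤ m, ∀ z : ℕ → ℝ × ℝ, z ∘ Equiv.swap k m ∈ A ↔ z ∈ A) :
    ∫⁻ z in A, hazardSum ψ z (Finset.range m) ∂(Measure.infinitePi fun _ : ℕ => κ) ≤
      ∫⁻ z in A, hazardSum ψ z (Finset.range (m + 1)) ∂(Measure.infinitePi fun _ : ℕ => κ) := by
  set Q := Measure.infinitePi fun _ : ℕ => κ
  have hm : ((m + 1 : ℕ) : ℝ≥0∞) ≠ 0 := by rw [Nat.cast_ne_zero]; omega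
  -- After multiplication by `m + 1` the left side is a sum of `m + 1` equal integrals, one for each
  -- deleted index.
  rw [← ENNReal.mul_le_mul_iff_right hm (ENNReal.natCast_ne_top _)]
  have hmeas := fun s => measurable_hazardSum hψ s
  rw [← lintegral_indicator hA, ← lintegral_indicator hA]
  have h1 : ∀ k ∈ Finset.range (m + 1),
      ∫⁻ z, A.indicator (fun z => hazardSum ψ z (Finset.range m)) z ∂Q =
      ∫⁻ z, A.indicator (fun z => hazardSum ψ z ((Finset.range (m + 1)).erase k)) z ∂Q := by
    intro k hk
    have hk' : k ≤ m := by have := Finset.mem_range.mp hk; omega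
    rw [← lintegral_comp_perm κ (Equiv.swap k m) ((hmeas _).indicator hA)]
    refine lintegral_congr fun z => ?_
    by_cases hz : z ∈ A
    · rw [Set.indicator_of_mem hz, Set.indicator_of_mem ((hinv k hk' z).mpr hz),
        hazardSum_comp_perm, map_swap_range hk']
    · rw [Set.indicator_of_notMem hz, Set.indicator_of_notMem (fun h => hz ((hinv k hk' z).mp h))]
  have h2 : ((m + 1 : ℕ) : ℝ≥0∞) * ∫⁻ z, A.indicator (fun z => hazardSum ψ z (Finset.range m)) z ∂Q
      = ∑ k ∈ Finset.range (m + 1),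
        ∫⁻ z, A.indicator (fun z => hazardSum ψ z ((Finset.range (m + 1)).erase k)) z ∂Q := by
    rw [← Finset.sum_congr rfl h1, Finset.sum_const, Finset.card_range, nsmul_eq_mul]
  rw [h2, ← lintegral_finsetSum _ (fun k _ => (hmeas _).indicator hA),
    ← lintegral_const_mul _ ((hmeas _).indicator hA)]
  refine lintegral_mono_ae ?_
  filter_upwards [ae_forall_infinitePi hκ] with z hz
  by_cases hzA : z ∈ A
  · simp only [Set.indicator_of_mem hzA]
    have := sum_hazardSum_erase_le ψ z (Finset.range (m + 1)) fun i _ => hz i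
    rwa [Finset.card_range] at this
  · simp [Set.indicator_of_notMem hzA]

/-- Doob's maximal inequality for the supermartingale run backwards from `N`. No conditional
expectations appear: descending induction on `m` keeps the mass λ on the event that the level has
been reached at some time in `[m, N]`, and the current hazard sum off it. -/
theorem mul_measure_exists_hazardSum_le (hκ : ∀ᵐ p ∂κ, p.2 ≤ p.1) {ψ : ℝ → ℝ≥0∞}
    (hψ : Measurable ψ) (N : ℕ) (lam : ℝ≥0∞) :
    lam * (Measure.infinitePi fun _ : ℕ => κ)
        {z | ∃ l ≤ N, lam ≤ hazardSum ψ z (Finset.range l)} ≤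
      ∫⁻ z, hazardSum ψ z (Finset.range N) ∂(Measure.infinitePi fun _ : ℕ => κ) := by
  set Q := Measure.infinitePi fun _ : ℕ => κ
  set S : ℕ → (ℕ → ℝ × ℝ) → ℝ≥0∞ := fun l z => hazardSum ψ z (Finset.range l) with hS
  have hSm : ∀ l, Measurable (S l) := fun l => measurable_hazardSum hψ _
  set E : ℕ → Set (ℕ → ℝ × ℝ) := fun m => {z | ∃ l ≤ N, m ≤ l ∧ lam ≤ S l z} with hE
  have hEm : ∀ m, MeasurableSet (E m) := by
    intro m
    have : E m = ⋃ l ∈ Set.Icc m N, {z | lam ≤ S l z} := by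
      ext z; simp only [hE, Set.mem_ofPred_eq, Set.mem_iUnion, Set.mem_Icc]
      constructor
      · rintro ⟨l, h1, h2, h3⟩; exact ⟨l, ⟨h2, h1⟩, h3⟩
      · rintro ⟨l, ⟨h2, h1⟩, h3⟩; exact ⟨l, h1, h2, h3⟩
    rw [this]
    exact MeasurableSet.biUnion (Set.to_countable _)
      fun l _ => measurableSet_le measurable_const (hSm l)
  have key : ∀ m, m ≤ N → lam * Q (E m) + ∫⁻ z in (E m)ᶜ, S m z ∂Q ≤ ∫⁻ z, S N z ∂Q := by
    intro m hm
    induction hm using Nat.decreasingInduction with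
    | self =>
      have hEN : E N = {z | lam ≤ S N z} := by
        ext z
        constructor
        · rintro ⟨l, h1, h2, h3⟩
          rwa [le_antisymm h1 h2] at h3
        · intro h; exact ⟨N, le_rfl, le_rfl, h⟩
      rw [← lintegral_add_compl (μ := Q) (S N) (hEm N)]
      refine add_le_add ?_ le_rfl
      rw [← setLIntegral_const]
      refine setLIntegral_mono (hSm N) fun z hz => ?_
      rwa [hEN] at hz
    | of_succ m hm ih =>
      refine le_trans ?_ ih
      set B := {z | lam ≤ S m z} with hB
      have hBm : MeasurableSet B := measurableSet_le measurable_const (hSm m)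
      have hEB : E m = E (m + 1) ∪ (B ∩ (E (m + 1))ᶜ) := by
        ext z
        constructor
        · rintro ⟨l, h1, h2, h3⟩
          by_cases hz : z ∈ E (m + 1)
          · exact Or.inl hz
          · refine Or.inr ⟨?_, hz⟩
            rcases Nat.eq_or_lt_of_le h2 with h | h
            · rw [← h] at h3; exact h3
            · exact absurd ⟨l, h1, h, h3⟩ hz
        · rintro (⟨l, h1, h2, h3⟩ | ⟨h1, -⟩)
          · exact ⟨l, h1, by omega, h3⟩
          · exact ⟨m, by omega, le_rfl, h1⟩
      have hEBc : (E m)ᶜ = (E (m + 1))ᶜ ∩ Bᶜ := by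
        rw [hEB]; ext z; simp only [Set.mem_compl_iff, Set.mem_union, Set.mem_inter_iff]; tauto
      have hstep : ∫⁻ z in (E (m + 1))ᶜ, S m z ∂Q ≤ ∫⁻ z in (E (m + 1))ᶜ, S (m + 1) z ∂Q := by
        -- The event involves only hazard sums over ranges containing both `k` and `m`, which a swap
        -- of these indices does not change.
        refine setLIntegral_hazardSum_le κ hκ hψ m (hEm _).compl fun k hk z => ?_
        rw [Set.mem_compl_iff, Set.mem_compl_iff, not_iff_not]
        simp only [hE, hS, Set.mem_ofPred_eq, hazardSum_comp_perm]
        refine exists_congr fun l => and_congr_right fun _ => and_congr_right fun hl => ?_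
        rw [map_swap_of_mem (Finset.mem_range.mpr (by omega)) (Finset.mem_range.mpr (by omega))]
      -- The part of the complement where the level is reached at time `m` is split off and its
      -- integral bounded below by λ.
      have hsplit : lam * Q (B ∩ (E (m + 1))ᶜ) + ∫⁻ z in (E m)ᶜ, S m z ∂Q ≤
          ∫⁻ z in (E (m + 1))ᶜ, S m z ∂Q := by
        rw [← lintegral_inter_add_sdiff (μ := Q) (S m) (E (m + 1))ᶜ hBm, Set.inter_comm B,
          Set.sdiff_eq, hEBc]
        refine add_le_add ?_ le_rfl
        rw [← setLIntegral_const]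
        exact setLIntegral_mono (hSm m) fun z hz => hz.2
      calc lam * Q (E m) + ∫⁻ z in (E m)ᶜ, S m z ∂Q
          ≤ lam * (Q (E (m + 1)) + Q (B ∩ (E (m + 1))ᶜ)) + ∫⁻ z in (E m)ᶜ, S m z ∂Q := by
            gcongr
            rw [hEB]; exact measure_union_le _ _
        _ = lam * Q (E (m + 1)) +
            (lam * Q (B ∩ (E (m + 1))ᶜ) + ∫⁻ z in (E m)ᶜ, S m z ∂Q) := by
            rw [mul_add, add_assoc]
        _ ≤ _ := by
            gcongr
            exact hsplit.trans hstep
  have h0 := key 0 (Nat.zero_le N)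
  refine le_trans ?_ (le_trans (self_le_add_right _ _) h0)
  gcongr
  rintro z ⟨l, h1, h2⟩
  exact ⟨l, h1, by omega, h2⟩

/-- Fubini for one coordinate against finitely many others: by independence, the coordinate can be
frozen while an independent copy supplies the rest. -/
theorem lintegral_coord_finset {i : ℕ} {s : Finset ℕ} (hi : i ∉ s)
    {f : (ℝ × ℝ) × (s → ℝ × ℝ) → ℝ≥0∞} (hf : Measurable f) :
    ∫⁻ z, f (z i, fun j => z j) ∂(Measure.infinitePi fun _ : ℕ => κ) =
      ∫⁻ p, ∫⁻ z, f (p, fun j => z j) ∂(Measure.infinitePi fun _ : ℕ => κ) ∂κ := by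
  set Q := Measure.infinitePi fun _ : ℕ => κ
  have hind : iIndepFun (fun (i : ℕ) (z : ℕ → ℝ × ℝ) => z i) Q :=
    iIndepFun_infinitePi (X := fun _ p => p) fun _ => measurable_id
  have h1 := hind.indepFun_finset {i} s (Finset.disjoint_singleton_left.mpr hi)
    fun i => measurable_pi_apply i
  have h2 : IndepFun (fun z : ℕ → ℝ × ℝ => z i) (fun (z : ℕ → ℝ × ℝ) (j : s) => z j) Q :=
    h1.comp (φ := fun w : ({i} : Finset ℕ) → ℝ × ℝ => w ⟨i, Finset.mem_singleton_self i⟩)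
      (ψ := id) (measurable_pi_apply _) measurable_id
  have hm1 : Measurable fun z : ℕ → ℝ × ℝ => z i := measurable_pi_apply i
  have hm2 : Measurable fun (z : ℕ → ℝ × ℝ) (j : s) => z j := by fun_prop
  have h3 := h2.map_prod_eq_prod_map_map hm1.aemeasurable hm2.aemeasurable
  have h4 : Q.map (fun z : ℕ → ℝ × ℝ => z i) = κ :=
    (measurePreserving_eval_infinitePi (fun _ : ℕ => κ) i).map_eq
  rw [h4] at h3
  have : IsProbabilityMeasure (Q.map fun (z : ℕ → ℝ × ℝ) (j : s) => z j) :=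
    Measure.isProbabilityMeasure_map hm2.aemeasurable
  rw [← lintegral_map (f := f) (g := fun z : ℕ → ℝ × ℝ => (z i, fun j : s => z j)) hf
    (hm1.prodMk hm2), h3, lintegral_prod _ hf.aemeasurable]
  refine lintegral_congr fun p => ?_
  exact lintegral_map (f := fun w => f (p, w)) (hf.comp measurable_prodMk_left) hm2

/-- The expected reciprocal size of a risk set enlarged by one. -/
theorem mul_lintegral_inv_one_add_riskCount_le {N i : ℕ} (hi : i < N) (x : ℝ) :
    (N : ℝ≥0∞) * (κ {p | p.2 ≤ x ∧ x ≤ p.1} *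
      ∫⁻ z, (1 + riskCount z ((Finset.range N).erase i) x)⁻¹
        ∂(Measure.infinitePi fun _ : ℕ => κ)) ≤ 1 := by
  set Q := Measure.infinitePi fun _ : ℕ => κ
  set D : Set (ℝ × ℝ) := {p | p.2 ≤ x ∧ x ≤ p.1} with hD
  have hDm : MeasurableSet D := (measurableSet_le measurable_snd measurable_const).inter
    (measurableSet_le measurable_const measurable_fst)
  have hDi : ∀ p : ℝ × ℝ, D.indicator (1 : ℝ × ℝ → ℝ≥0∞) p =
      if p.2 ≤ x ∧ x ≤ p.1 then 1 else 0 := by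
    intro p
    classical
    rw [Set.indicator_apply]
    rfl
  -- By exchangeability `k` may be replaced by `i`. When observation `i` is at risk the count is one
  -- plus an independent count of the others, so the expectation factorizes.
  have hmem : ∀ k ∈ Finset.range N, ∫⁻ z, D.indicator 1 (z k) * (riskCount z (Finset.range N) x)⁻¹ ∂Q =
      κ D * ∫⁻ z, (1 + riskCount z ((Finset.range N).erase i) x)⁻¹ ∂Q := by
    intro k hk
    have hm : Measurable fun z : ℕ → ℝ × ℝ =>
        D.indicator (1 : ℝ × ℝ → ℝ≥0∞) (z i) * (riskCount z (Finset.range N) x)⁻¹ :=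
      ((measurable_one.indicator hDm).comp (measurable_pi_apply i)).mul
        (measurable_riskCount _ measurable_const).inv
    have hswap := lintegral_comp_perm κ (Equiv.swap i k) hm
    simp only [Function.comp_apply, Equiv.swap_apply_left, riskCount_comp_perm,
      map_swap_of_mem (Finset.mem_range.mpr hi) hk] at hswap
    rw [hswap]
    set s := (Finset.range N).erase i with hs
    have his : i ∉ s := Finset.notMem_erase i _
    set f : (ℝ × ℝ) × (s → ℝ × ℝ) → ℝ≥0∞ := fun q =>
      D.indicator 1 q.1 * (1 + ∑ j, D.indicator 1 (q.2 j))⁻¹ with hf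
    have hfm : Measurable f := by
      have h1 : Measurable (D.indicator (1 : ℝ × ℝ → ℝ≥0∞)) := measurable_one.indicator hDm
      refine (h1.comp measurable_fst).mul (Measurable.inv (Measurable.const_add ?_ 1))
      exact Finset.measurable_sum _ fun j _ => h1.comp ((measurable_pi_apply j).comp measurable_snd)
    have hrisk : ∀ z : ℕ → ℝ × ℝ, ∑ j : s, D.indicator (1 : ℝ × ℝ → ℝ≥0∞) (z j) = riskCount z s x := by
      intro z
      rw [Finset.sum_coe_sort s fun j => D.indicator (1 : ℝ × ℝ → ℝ≥0∞) (z j)]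
      exact Finset.sum_congr rfl fun j _ => hDi (z j)
    have h1 := lintegral_coord_finset κ his hfm
    simp only [hf, hrisk] at h1
    have h2 : ∀ z : ℕ → ℝ × ℝ, D.indicator 1 (z i) * (riskCount z (Finset.range N) x)⁻¹ =
        D.indicator (1 : ℝ × ℝ → ℝ≥0∞) (z i) * (1 + riskCount z s x)⁻¹ := by
      intro z
      by_cases hz : z i ∈ D
      · congr 2
        rw [riskCount, ← Finset.add_sum_erase _ _ (Finset.mem_range.mpr hi)]
        congr 1
        exact if_pos (show (z i).2 ≤ x ∧ x ≤ (z i).1 from hz)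
      · simp [Set.indicator_of_notMem hz]
    rw [lintegral_congr h2, h1]
    have h3 : Measurable fun z : ℕ → ℝ × ℝ => (1 + riskCount z s x)⁻¹ :=
      (measurable_const.add (measurable_riskCount s measurable_const)).inv
    simp_rw [lintegral_const_mul _ h3]
    rw [lintegral_mul_const _ (measurable_one.indicator hDm), lintegral_indicator_one hDm]
  have hsum : (N : ℝ≥0∞) * (κ D * ∫⁻ z, (1 + riskCount z ((Finset.range N).erase i) x)⁻¹ ∂Q) =
      ∫⁻ z, ∑ k ∈ Finset.range N, D.indicator 1 (z k) * (riskCount z (Finset.range N) x)⁻¹ ∂Q := by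
    have hm : ∀ k, Measurable fun z : ℕ → ℝ × ℝ =>
        D.indicator (1 : ℝ × ℝ → ℝ≥0∞) (z k) * (riskCount z (Finset.range N) x)⁻¹ := fun k =>
      ((measurable_one.indicator hDm).comp (measurable_pi_apply k)).mul
        (measurable_riskCount _ measurable_const).inv
    rw [lintegral_finsetSum _ fun k _ => hm k,
      Finset.sum_congr rfl hmem, Finset.sum_const, Finset.card_range, nsmul_eq_mul]
  rw [hsum]
  calc _ ≤ ∫⁻ _, 1 ∂Q := by
        refine lintegral_mono fun z => ?_
        rw [← Finset.sum_mul]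
        have : ∑ k ∈ Finset.range N, D.indicator (1 : ℝ × ℝ → ℝ≥0∞) (z k) =
            riskCount z (Finset.range N) x := Finset.sum_congr rfl fun j _ => hDi (z j)
        rw [this]
        exact ENNReal.mul_inv_le_one _
    _ = 1 := by simp

/-- Given the `i`-th pair, its risk count is one plus an independent count of the others at risk, so
its mean reciprocal is at most 1/(N C). Summing the `N` terms removes the factor 1/N and gives a
bound independent of `N`. -/
theorem lintegral_hazardSum_le (hκ : ∀ᵐ p ∂κ, p.2 ≤ p.1) {ψ : ℝ → ℝ≥0∞} (hψ : Measurable ψ)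
    (N : ℕ) :
    ∫⁻ z, hazardSum ψ z (Finset.range N) ∂(Measure.infinitePi fun _ : ℕ => κ) ≤
      ∫⁻ p, ψ p.1 * (κ {q | q.2 ≤ p.1 ∧ p.1 ≤ q.1})⁻¹ ∂κ := by
  set Q := Measure.infinitePi fun _ : ℕ => κ
  rcases Nat.eq_zero_or_pos N with rfl | hN
  · simp [hazardSum]
  have hN0 : (N : ℝ≥0∞) ≠ 0 := by rw [Nat.cast_ne_zero]; omega
  set I := ∫⁻ p, ψ p.1 * (κ {q | q.2 ≤ p.1 ∧ p.1 ≤ q.1})⁻¹ ∂κ with hI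
  have hterm : ∀ i ∈ Finset.range N,
      ∫⁻ z, ψ (z i).1 * (riskCount z (Finset.range N) (z i).1)⁻¹ ∂Q ≤ (N : ℝ≥0∞)⁻¹ * I := by
    intro i hi
    set s := (Finset.range N).erase i with hs
    have his : i ∉ s := Finset.notMem_erase i _
    set f : (ℝ × ℝ) × (s → ℝ × ℝ) → ℝ≥0∞ := fun q =>
      ψ q.1.1 * (1 + ∑ j, if (q.2 j).2 ≤ q.1.1 ∧ q.1.1 ≤ (q.2 j).1 then 1 else 0)⁻¹ with hf
    have hfm : Measurable f := by
      refine (hψ.comp (by fun_prop)).mul (Measurable.inv (Measurable.const_add ?_ 1))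
      refine Finset.measurable_sum _ fun j _ => Measurable.ite ?_ measurable_const measurable_const
      have h1 : Measurable fun q : (ℝ × ℝ) × (s → ℝ × ℝ) => (q.2 j).1 := by fun_prop
      have h2 : Measurable fun q : (ℝ × ℝ) × (s → ℝ × ℝ) => (q.2 j).2 := by fun_prop
      have h3 : Measurable fun q : (ℝ × ℝ) × (s → ℝ × ℝ) => q.1.1 := by fun_prop
      exact (measurableSet_le h2 h3).inter (measurableSet_le h3 h1)
    have hrisk : ∀ (z : ℕ → ℝ × ℝ) (x : ℝ),
        ∑ j : s, (if (z j).2 ≤ x ∧ x ≤ (z j).1 then (1 : ℝ≥0∞) else 0) = riskCount z s x := by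
      intro z x
      exact Finset.sum_coe_sort s fun j => if (z j).2 ≤ x ∧ x ≤ (z j).1 then (1 : ℝ≥0∞) else 0
    have h1 := lintegral_coord_finset κ his hfm
    simp only [hf, hrisk] at h1
    have h2 : ∀ᵐ z ∂Q, ψ (z i).1 * (riskCount z (Finset.range N) (z i).1)⁻¹ =
        ψ (z i).1 * (1 + riskCount z s (z i).1)⁻¹ := by
      filter_upwards [ae_forall_infinitePi hκ] with z hz
      congr 2
      rw [riskCount, ← Finset.add_sum_erase _ _ hi]
      congr 1
      exact if_pos ⟨hz i, le_rfl⟩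
    rw [lintegral_congr_ae h2, h1, hI, ← lintegral_const_mul' _ _ (ENNReal.inv_ne_top.mpr hN0)]
    refine lintegral_mono fun p => ?_
    have h3 : Measurable fun z : ℕ → ℝ × ℝ => (1 + riskCount z s p.1)⁻¹ :=
      (measurable_const.add (measurable_riskCount s measurable_const)).inv
    rw [lintegral_const_mul _ h3, mul_left_comm]
    refine mul_le_mul_right ?_ _
    have h4 := mul_lintegral_inv_one_add_riskCount_le κ (Finset.mem_range.mp hi) p.1
    rw [← ENNReal.mul_inv (Or.inl hN0) (Or.inl (ENNReal.natCast_ne_top _)),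
      ENNReal.le_inv_iff_mul_le, mul_comm, mul_assoc]
    exact h4
  calc ∫⁻ z, hazardSum ψ z (Finset.range N) ∂Q
      = ∑ i ∈ Finset.range N, ∫⁻ z, ψ (z i).1 * (riskCount z (Finset.range N) (z i).1)⁻¹ ∂Q := by
        unfold hazardSum
        exact lintegral_finsetSum _ fun i _ => (hψ.comp (by fun_prop)).mul
          (measurable_riskCount _ (by fun_prop)).inv
    _ ≤ ∑ i ∈ Finset.range N, (N : ℝ≥0∞)⁻¹ * I := Finset.sum_le_sum hterm
    _ = I := by
        rw [Finset.sum_const, Finset.card_range, nsmul_eq_mul, ← mul_assoc,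
          ENNReal.mul_inv_cancel hN0 (ENNReal.natCast_ne_top _), one_mul]

/-- If the expected hazard integrals of `ψ k` tend to zero, then almost surely the hazard sums of
some `ψ k` are small for all sample sizes at once. -/
theorem ae_exists_forall_hazardSum_lt (hκ : ∀ᵐ p ∂κ, p.2 ≤ p.1) {ψ : ℕ → ℝ → ℝ≥0∞}
    (hψ : ∀ k, Measurable (ψ k))
    (hlim : Tendsto (fun k => ∫⁻ p, ψ k p.1 * (κ {q | q.2 ≤ p.1 ∧ p.1 ≤ q.1})⁻¹ ∂κ) atTop (𝓝 0)) :
    ∀ᵐ z ∂(Measure.infinitePi fun _ : ℕ => κ), ∀ ε : ℝ, 0 < ε →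
      ∃ k, ∀ n, hazardSum (ψ k) z (Finset.range n) < ENNReal.ofReal ε := by
  set Q := Measure.infinitePi fun _ : ℕ => κ
  have hmax : ∀ (k : ℕ) (lam : ℝ≥0∞),
      lam * Q {z | ∃ l, lam ≤ hazardSum (ψ k) z (Finset.range l)} ≤
        ∫⁻ p, ψ k p.1 * (κ {q | q.2 ≤ p.1 ∧ p.1 ≤ q.1})⁻¹ ∂κ := by
    intro k lam
    have hU : {z | ∃ l, lam ≤ hazardSum (ψ k) z (Finset.range l)} =
        ⋃ N : ℕ, {z | ∃ l ≤ N, lam ≤ hazardSum (ψ k) z (Finset.range l)} := by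
      ext z
      simp only [Set.mem_ofPred_eq, Set.mem_iUnion]
      constructor
      · rintro ⟨l, hl⟩; exact ⟨l, l, le_rfl, hl⟩
      · rintro ⟨_, l, _, hl⟩; exact ⟨l, hl⟩
    have hmono : Monotone fun N : ℕ => {z | ∃ l ≤ N, lam ≤ hazardSum (ψ k) z (Finset.range l)} := by
      rintro N M hNM z ⟨l, h1, h2⟩
      exact ⟨l, h1.trans hNM, h2⟩
    rw [hU, hmono.measure_iUnion, ENNReal.mul_iSup]
    exact iSup_le fun N => (mul_measure_exists_hazardSum_le κ hκ (hψ k) N lam).trans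
      (lintegral_hazardSum_le κ hκ (hψ k) N)
  have hj : ∀ᵐ z ∂Q, ∀ j : ℕ, ∃ k, ∀ n,
      hazardSum (ψ k) z (Finset.range n) < ENNReal.ofReal (1 / ((j : ℝ) + 1)) := by
    rw [ae_all_iff]
    intro j
    set lam := ENNReal.ofReal (1 / ((j : ℝ) + 1)) with hlam
    have hlam0 : lam ≠ 0 := by
      rw [hlam, ne_eq, ENNReal.ofReal_eq_zero, not_le]; positivity
    rw [ae_iff]
    set b := Q {z | ¬∃ k, ∀ n, hazardSum (ψ k) z (Finset.range n) < lam} with hb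
    -- The bad event is contained in the exceedance event of every `k`, so the maximal inequality
    -- applies with each `k` and the bounds tend to zero.
    have hbk : ∀ k, lam * b ≤ ∫⁻ p, ψ k p.1 * (κ {q | q.2 ≤ p.1 ∧ p.1 ≤ q.1})⁻¹ ∂κ := by
      intro k
      refine le_trans ?_ (hmax k lam)
      refine mul_le_mul_right (measure_mono fun z h1 => ?_) _
      rw [Set.mem_ofPred_eq] at h1
      push Not at h1
      exact h1 k
    have h0 : lam * b ≤ 0 := ge_of_tendsto' hlim hbk
    rcases mul_eq_zero.mp (le_antisymm h0 bot_le) with h | h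
    · exact absurd h hlam0
    · exact h
  filter_upwards [hj] with z hz ε hε
  obtain ⟨j, hj⟩ := exists_nat_one_div_lt hε
  obtain ⟨k, hk⟩ := hz j
  exact ⟨k, fun n => (hk n).trans_le (ENNReal.ofReal_le_ofReal hj.le)⟩

end Exchangeable

/-! ### The truncation model -/

/-! ### Continuous distribution functions and cumulative hazard -/

theorem measure_Ioi_eq_cdf (μ : Measure ℝ) [IsProbabilityMeasure μ] (x : ℝ) :
    μ (Set.Ioi x) = ENNReal.ofReal (1 - cdf μ x) := by
  rw [← Set.compl_Iic, prob_compl_eq_one_sub measurableSet_Iic, ← ofReal_cdf,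
    ← ENNReal.ofReal_one, ENNReal.ofReal_sub _ (cdf_nonneg μ x)]

theorem nullSingleton_of_continuous_cdf (μ : Measure ℝ) [IsProbabilityMeasure μ]
    (h : Continuous (cdf μ)) : NullSingletonClass μ := by
  refine ⟨fun x => ?_⟩
  rw [← measure_cdf μ, StieltjesFunction.measure_singleton,
    (h.continuousAt.continuousWithinAt).leftLim_eq, sub_self, ENNReal.ofReal_zero]

/-- The probability integral transform. -/
theorem map_cdf_eq_uniform (μ : Measure ℝ) [IsProbabilityMeasure μ] (h : Continuous (cdf μ)) :
    μ.map (cdf μ) = volume.restrict (Set.Icc (0 : ℝ) 1) := by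
  have hm : Measurable (cdf μ) := h.measurable
  have : IsProbabilityMeasure (μ.map (cdf μ)) := Measure.isProbabilityMeasure_map hm.aemeasurable
  have : IsFiniteMeasure (volume.restrict (Set.Icc (0 : ℝ) 1)) := by infer_instance
  refine Measure.ext_of_Iic _ _ fun u => ?_
  rw [Measure.map_apply hm measurableSet_Iic, Measure.restrict_apply measurableSet_Iic]
  rcases lt_or_ge u 0 with hu | hu
  · have h1 : cdf μ ⁻¹' Set.Iic u = ∅ := by
      ext x; simp only [Set.mem_preimage, Set.mem_Iic, Set.mem_empty_iff_false, iff_false, not_le]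
      exact hu.trans_le (cdf_nonneg μ x)
    have h2 : Set.Iic u ∩ Set.Icc (0 : ℝ) 1 = ∅ := by
      ext x; simp only [Set.mem_inter_iff, Set.mem_Iic, Set.mem_Icc, Set.mem_empty_iff_false,
        iff_false]
      rintro ⟨h1, h2, -⟩; linarith
    rw [h1, h2]; simp
  rcases le_or_gt 1 u with hu1 | hu1
  · have h1 : cdf μ ⁻¹' Set.Iic u = Set.univ := by
      ext x; simpa using (cdf_le_one μ x).trans hu1
    have h2 : Set.Iic u ∩ Set.Icc (0 : ℝ) 1 = Set.Icc 0 1 :=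
      Set.inter_eq_right.mpr fun x hx => hx.2.trans hu1
    rw [h1, h2]; simp
  have h2 : Set.Iic u ∩ Set.Icc (0 : ℝ) 1 = Set.Icc 0 u := by
    ext x; simp only [Set.mem_inter_iff, Set.mem_Iic, Set.mem_Icc]
    constructor
    · rintro ⟨h1, h2, -⟩; exact ⟨h2, h1⟩
    · rintro ⟨h1, h2⟩; exact ⟨h2, h1, by linarith⟩
  rw [h2, Real.volume_Icc, sub_zero]
  rcases (cdf μ ⁻¹' Set.Iic u).eq_empty_or_nonempty with he | hne
  -- If the distribution function exceeds `u` everywhere, its limit 0 at -∞ forces `u ≤ 0`.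
  · have hu0 : u = 0 := by
      refine le_antisymm ?_ hu
      refine ge_of_tendsto' (tendsto_cdf_atBot μ) fun x => ?_
      by_contra hx
      have : x ∈ cdf μ ⁻¹' Set.Iic u := (not_le.mp hx).le
      rw [he] at this
      exact this
    rw [he, hu0]; simp
  · obtain ⟨B, hB⟩ := ((tendsto_cdf_atTop μ).eventually (lt_mem_nhds hu1)).exists
    have hbdd : BddAbove (cdf μ ⁻¹' Set.Iic u) := by
      refine ⟨B, fun x hx => ?_⟩
      by_contra hxB
      have h3 : cdf μ x ≤ u := hx
      have h4 := monotone_cdf μ (not_le.mp hxB).le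
      linarith
    have hclosed : IsClosed (cdf μ ⁻¹' Set.Iic u) := isClosed_Iic.preimage h
    set x := sSup (cdf μ ⁻¹' Set.Iic u) with hx
    have hxmem : cdf μ x ≤ u := hclosed.csSup_mem hne hbdd
    have hset : cdf μ ⁻¹' Set.Iic u = Set.Iic x := by
      ext y
      constructor
      · intro hy; exact le_csSup hbdd hy
      · intro hy; exact (monotone_cdf μ hy).trans hxmem
    have hxge : u ≤ cdf μ x := by
      have ht : Tendsto (cdf μ) (𝓝[>] x) (𝓝 (cdf μ x)) :=
        h.continuousAt.tendsto.mono_left nhdsWithin_le_nhds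
      refine ge_of_tendsto ht ?_
      filter_upwards [self_mem_nhdsWithin] with y hy
      by_contra hlt
      have : y ∈ cdf μ ⁻¹' Set.Iic u := (not_le.mp hlt).le
      rw [hset] at this
      exact absurd (show x < y from hy) (not_lt.mpr this)
    rw [hset, ← ofReal_cdf, le_antisymm hxmem hxge]

/-- A level set can be a whole interval where the distribution function is flat; it is null because
the uniform law has no atoms. -/
theorem measure_preimage_cdf_singleton (μ : Measure ℝ) [IsProbabilityMeasure μ]
    (h : Continuous (cdf μ)) (c : ℝ) : μ (cdf μ ⁻¹' {c}) = 0 := by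
  rw [← Measure.map_apply h.measurable (measurableSet_singleton c), map_cdf_eq_uniform μ h]
  simp

/-- The cumulative hazard of a continuous distribution. -/
theorem integral_hazard (μ : Measure ℝ) [IsProbabilityMeasure μ] (h : Continuous (cdf μ))
    {a b : ℝ} (hab : a ≤ b) (hb : cdf μ b < 1) :
    ∫ y in Set.Ioc a b, 1 / (1 - cdf μ y) ∂μ = Real.log ((1 - cdf μ a) / (1 - cdf μ b)) := by
  have hmono := monotone_cdf μ hab
  -- Flat pieces at the levels of `a` and `b` prevent equality of these sets, but they carry no
  -- mass.
  have hset : Set.Ioc a b =ᵐ[μ] cdf μ ⁻¹' Set.Ioc (cdf μ a) (cdf μ b) := by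
    have hnull : ∀ᵐ y ∂μ, cdf μ y ≠ cdf μ a ∧ cdf μ y ≠ cdf μ b := by
      have h1 := measure_eq_zero_iff_ae_notMem.mp (measure_preimage_cdf_singleton μ h (cdf μ a))
      have h2 := measure_eq_zero_iff_ae_notMem.mp (measure_preimage_cdf_singleton μ h (cdf μ b))
      filter_upwards [h1, h2] with y h1 h2
      exact ⟨h1, h2⟩
    rw [eventuallyEq_set]
    filter_upwards [hnull] with y hy
    constructor
    · rintro ⟨h1, h2⟩
      exact ⟨lt_of_le_of_ne (monotone_cdf μ h1.le) hy.1.symm, monotone_cdf μ h2⟩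
    · rintro ⟨h1, h2⟩
      refine ⟨?_, ?_⟩
      · by_contra h3
        exact absurd (monotone_cdf μ (not_lt.mp h3)) (not_le.mpr h1)
      · by_contra h3
        exact hy.2 (le_antisymm h2 (monotone_cdf μ (not_le.mp h3).le))
  rw [setIntegral_congr_set hset]
  have hg : AEStronglyMeasurable (fun u : ℝ => 1 / (1 - u)) (μ.map (cdf μ)) := by
    exact (Measurable.aestronglyMeasurable (by fun_prop))
  rw [← setIntegral_map (f := fun u : ℝ => 1 / (1 - u)) measurableSet_Ioc hg
    h.measurable.aemeasurable, map_cdf_eq_uniform μ h, Measure.restrict_restrict measurableSet_Ioc]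
  have hinter : Set.Ioc (cdf μ a) (cdf μ b) ∩ Set.Icc (0 : ℝ) 1 = Set.Ioc (cdf μ a) (cdf μ b) :=
    Set.inter_eq_left.mpr fun u hu =>
      ⟨(cdf_nonneg μ a).trans hu.1.le, hu.2.trans (cdf_le_one μ b)⟩
  rw [hinter, ← intervalIntegral.integral_of_le hmono,
    intervalIntegral.integral_comp_sub_left (fun u : ℝ => 1 / u) 1,
    integral_one_div_of_pos (by linarith) (by linarith)]

/-! ### Exhaustion of the observable range -/

/-- An open upper set of reals is exhausted from the left by an antitone sequence. -/
theorem exists_antitone_seq_of_isUpperSet {V : Set ℝ} (hV : IsOpen V) (hup : IsUpperSet V)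
    (hne : V.Nonempty) :
    ∃ u : ℕ → ℝ, Antitone u ∧ (∀ k, u k ∈ V) ∧ ∀ x ∈ V, ∃ k, u k < x := by
  by_cases hb : BddBelow V
  · refine ⟨fun k => sInf V + 1 / ((k : ℝ) + 1), ?_, ?_, ?_⟩
    · intro k l hkl
      have := one_div_le_one_div_of_le (by positivity : (0 : ℝ) < (k : ℝ) + 1)
        (by have : (k : ℝ) ≤ l := by exact_mod_cast hkl
            linarith : (k : ℝ) + 1 ≤ l + 1)
      simpa using this
    · intro k
      have hpos : (0 : ℝ) < 1 / ((k : ℝ) + 1) := by positivity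
      obtain ⟨v, hv, hvlt⟩ := (csInf_lt_iff hb hne).mp (lt_add_of_pos_right (sInf V) hpos)
      exact hup hvlt.le hv
    · intro x hx
      -- Openness provides a point of `V` strictly left of `x`, so `sInf V < x`.
      obtain ⟨l, hl, hlV⟩ := exists_Ioc_subset_of_mem_nhds (hV.mem_nhds hx) ⟨x - 1, by simp⟩
      have hmid : (l + x) / 2 ∈ V := hlV ⟨by linarith, by linarith⟩
      have h1 := csInf_le hb hmid
      obtain ⟨k, hk⟩ := exists_nat_one_div_lt (show (0 : ℝ) < x - sInf V by linarith)
      exact ⟨k, by linarith⟩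
  · refine ⟨fun k => -(k : ℝ), ?_, ?_, ?_⟩
    · intro k l hkl
      simpa using hkl
    · intro k
      obtain ⟨v, hv, hvlt⟩ := not_bddBelow_iff.mp hb (-(k : ℝ))
      exact hup hvlt.le hv
    · intro x _
      obtain ⟨k, hk⟩ := exists_nat_gt (-x)
      exact ⟨k, by linarith⟩

/-- The interval on which the truncated lifetimes are observed. -/
def obsRange (μF μG : Measure ℝ) : Set ℝ := {x | 0 < cdf μG x ∧ cdf μF x < 1}

theorem isOpen_obsRange {μF μG : Measure ℝ} (hF : Continuous (cdf μF)) (hG : Continuous (cdf μG)) :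
    IsOpen (obsRange μF μG) :=
  (isOpen_lt continuous_const hG).inter (isOpen_lt hF continuous_const)

theorem obsRange_nonempty {μF μG : Measure ℝ} (hab : lowerBdry μG < upperBdry μF) :
    (obsRange μF μG).Nonempty := by
  unfold lowerBdry upperBdry at hab
  obtain ⟨_, ⟨y, hy, rfl⟩, hy2⟩ := lt_sSup_iff.mp hab
  obtain ⟨_, ⟨x, hx, rfl⟩, hx2⟩ := sInf_lt_iff.mp hy2
  exact ⟨y, lt_of_lt_of_le hx (monotone_cdf μG (EReal.coe_lt_coe_iff.mp hx2).le), hy⟩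

/-- The right sequence is the reflection of a left one. Clamping both at a common point `c` of the
range puts all terms in the range and every `a k` to the left of every `b l`. -/
theorem exists_seq_obsRange {μF μG : Measure ℝ} (hF : Continuous (cdf μF))
    (hG : Continuous (cdf μG)) (hne : (obsRange μF μG).Nonempty) :
    ∃ a b : ℕ → ℝ, Antitone a ∧ Monotone b ∧ (∀ k, a k ∈ obsRange μF μG) ∧
      (∀ k, b k ∈ obsRange μF μG) ∧ (∀ k l, a k ≤ b l) ∧ (∀ x, 0 < cdf μG x → ∃ k, a k < x) ∧
      ∀ x, cdf μF x < 1 → ∃ k, x < b k := by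
  obtain ⟨c, hc⟩ := hne
  obtain ⟨u, hu1, hu2, hu3⟩ := exists_antitone_seq_of_isUpperSet
    (V := {x | 0 < cdf μG x}) (isOpen_lt continuous_const hG)
    (fun x y hxy hx => lt_of_lt_of_le hx (monotone_cdf μG hxy)) ⟨c, hc.1⟩
  obtain ⟨v, hv1, hv2, hv3⟩ := exists_antitone_seq_of_isUpperSet
    (V := {x | cdf μF (-x) < 1}) (isOpen_lt (hF.comp continuous_neg) continuous_const)
    (fun x y hxy hx => lt_of_le_of_lt (monotone_cdf μF (neg_le_neg hxy)) hx)
    ⟨-c, by simpa using hc.2⟩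
  refine ⟨fun k => min (u k) c, fun k => max (-v k) c, ?_, ?_, ?_, ?_, ?_, ?_, ?_⟩
  · exact fun k l hkl => min_le_min_right _ (hu1 hkl)
  · exact fun k l hkl => max_le_max_right _ (neg_le_neg (hv1 hkl))
  · intro k
    refine ⟨?_, lt_of_le_of_lt (monotone_cdf μF (min_le_right _ _)) hc.2⟩
    rcases min_choice (u k) c with h | h <;> simp only [h]
    · exact hu2 k
    · exact hc.1
  · intro k
    refine ⟨lt_of_lt_of_le hc.1 (monotone_cdf μG (le_max_right _ _)), ?_⟩
    rcases max_choice (-v k) c with h | h <;> simp only [h]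
    · exact hv2 k
    · exact hc.2
  · exact fun k l => (min_le_right _ _).trans (le_max_right _ _)
  · intro x hx
    obtain ⟨k, hk⟩ := hu3 x hx
    exact ⟨k, (min_le_left _ _).trans_lt hk⟩
  · intro x hx
    obtain ⟨k, hk⟩ := hv3 (-x) (by simpa using hx)
    exact ⟨k, lt_of_lt_of_le (by linarith) (le_max_left _ _)⟩

/-- The probability that a pair is observed. -/
def truncProb (μF μG : Measure ℝ) : ℝ≥0∞ := (μF.prod μG) {p : ℝ × ℝ | p.2 ≤ p.1}

/-- The law of an observed lifetime. -/
def obsLaw (μF μG : Measure ℝ) : Measure ℝ := (truncLaw μF μG).map Prod.fst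

theorem measurableSet_trunc : MeasurableSet {p : ℝ × ℝ | p.2 ≤ p.1} :=
  measurableSet_le measurable_snd measurable_fst

/-- The probability `C(x)` that an observed pair is at risk at `x`. -/
def riskProb (μF μG : Measure ℝ) (x : ℝ) : ℝ :=
  cdf μG x * (1 - cdf μF x) / (truncProb μF μG).toReal

/-! ### The law of an observed pair -/

section Model

variable (μF μG : Measure ℝ) [IsProbabilityMeasure μF] [IsProbabilityMeasure μG]

theorem measure_Ici_eq_cdf (hF : Continuous (cdf μF)) (x : ℝ) :
    μF (Set.Ici x) = ENNReal.ofReal (1 - cdf μF x) := by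
  have := nullSingleton_of_continuous_cdf μF hF
  rw [← measure_Ioi_eq_cdf]
  exact measure_congr Ioi_ae_eq_Ici.symm

/-- Being at risk at `x` already implies being observed, so the event is a rectangle and its
probability factorizes: this is where C = G(1 - F)/α comes from. -/
theorem riskSet_inter_trunc (x : ℝ) :
    {p : ℝ × ℝ | p.2 ≤ p.1} ∩ {p : ℝ × ℝ | p.2 ≤ x ∧ x ≤ p.1} = Set.Ici x ×ˢ Set.Iic x := by
  ext p
  simp only [Set.mem_inter_iff, Set.mem_ofPred_eq, Set.mem_prod, Set.mem_Ici, Set.mem_Iic]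
  constructor
  · rintro ⟨_, h1, h2⟩; exact ⟨h2, h1⟩
  · rintro ⟨h1, h2⟩; exact ⟨h2.trans h1, h2, h1⟩

theorem prod_riskSet (hF : Continuous (cdf μF)) (x : ℝ) :
    (μF.prod μG) ({p : ℝ × ℝ | p.2 ≤ p.1} ∩ {p : ℝ × ℝ | p.2 ≤ x ∧ x ≤ p.1}) =
      ENNReal.ofReal (cdf μG x * (1 - cdf μF x)) := by
  rw [riskSet_inter_trunc, Measure.prod_prod, measure_Ici_eq_cdf μF hF, ← ofReal_cdf,
    mul_comm, ENNReal.ofReal_mul (cdf_nonneg μG x)]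

theorem truncProb_ne_zero (hF : Continuous (cdf μF)) (hne : (obsRange μF μG).Nonempty) :
    truncProb μF μG ≠ 0 := by
  obtain ⟨x, hx1, hx2⟩ := hne
  have h1 := prod_riskSet μF μG hF x
  have h2 : 0 < ENNReal.ofReal (cdf μG x * (1 - cdf μF x)) :=
    ENNReal.ofReal_pos.mpr (mul_pos hx1 (by linarith))
  rw [← h1] at h2
  exact (h2.trans_le (measure_mono Set.inter_subset_left)).ne'

theorem truncProb_ne_top : truncProb μF μG ≠ ⊤ := measure_ne_top _ _

theorem truncProb_toReal_pos (hα : truncProb μF μG ≠ 0) : 0 < (truncProb μF μG).toReal :=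
  ENNReal.toReal_pos hα (truncProb_ne_top μF μG)

theorem isProbabilityMeasure_truncLaw (hα : truncProb μF μG ≠ 0) :
    IsProbabilityMeasure (truncLaw μF μG) :=
  cond_isProbabilityMeasure hα

omit [IsProbabilityMeasure μF] [IsProbabilityMeasure μG] in
theorem ae_truncLaw_le : ∀ᵐ p ∂(truncLaw μF μG), p.2 ≤ p.1 := by
  unfold truncLaw ProbabilityTheory.cond
  exact Measure.ae_smul_measure (ae_restrict_mem measurableSet_trunc) _

theorem truncLaw_riskSet (hF : Continuous (cdf μF)) (x : ℝ) :
    truncLaw μF μG {p | p.2 ≤ x ∧ x ≤ p.1} =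
      (truncProb μF μG)⁻¹ * ENNReal.ofReal (cdf μG x * (1 - cdf μF x)) := by
  rw [truncLaw, cond_apply measurableSet_trunc, prod_riskSet μF μG hF]
  rfl

theorem truncLaw_real_riskSet (hF : Continuous (cdf μF)) (x : ℝ) :
    (truncLaw μF μG).real {p | p.2 ≤ x ∧ x ≤ p.1} = riskProb μF μG x := by
  rw [Measure.real, truncLaw_riskSet μF μG hF, ENNReal.toReal_mul, ENNReal.toReal_inv,
    ENNReal.toReal_ofReal (mul_nonneg (cdf_nonneg μG x) (sub_nonneg.mpr (cdf_le_one μF x))),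
    riskProb]
  ring

omit [IsProbabilityMeasure μF] in
-- Integrating out the truncation time at fixed `y` leaves the chance G(y) of `T ≤ y`. Truncation
-- biases the lifetime law by the bounded density G/α.
theorem obsLaw_eq_withDensity :
    obsLaw μF μG = μF.withDensity fun y => (truncProb μF μG)⁻¹ * ENNReal.ofReal (cdf μG y) := by
  ext s hs
  have hmeas : Measurable fun y => ENNReal.ofReal (cdf μG y) :=
    (monotone_cdf μG).measurable.ennreal_ofReal
  rw [obsLaw, Measure.map_apply measurable_fst hs, truncLaw, cond_apply measurableSet_trunc,
    withDensity_apply _ hs, lintegral_const_mul _ hmeas]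
  congr 1
  rw [Measure.prod_apply (measurableSet_trunc.inter (measurable_fst hs)), ← lintegral_indicator hs]
  refine lintegral_congr fun y => ?_
  by_cases hy : y ∈ s
  · rw [Set.indicator_of_mem hy, ofReal_cdf]
    congr 1
    ext t
    simp [hy]
  · rw [Set.indicator_of_notMem hy, ← measure_empty (μ := μG)]
    congr 1
    ext t
    simp [hy]

omit [IsProbabilityMeasure μF] in
theorem obsLaw_absolutelyContinuous : obsLaw μF μG ≪ μF := by
  rw [obsLaw_eq_withDensity]
  exact withDensity_absolutelyContinuous _ _

omit [IsProbabilityMeasure μF] in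
theorem lintegral_truncLaw {h : ℝ → ℝ≥0∞} (hh : Measurable h) :
    ∫⁻ p, h p.1 ∂(truncLaw μF μG) =
      ∫⁻ y, (truncProb μF μG)⁻¹ * ENNReal.ofReal (cdf μG y) * h y ∂μF := by
  have hmeas : Measurable fun y => ENNReal.ofReal (cdf μG y) :=
    (monotone_cdf μG).measurable.ennreal_ofReal
  rw [← lintegral_map (f := h) hh measurable_fst, ← obsLaw, obsLaw_eq_withDensity,
    lintegral_withDensity_eq_lintegral_mul _ (hmeas.const_mul _) hh]
  rfl

omit [IsProbabilityMeasure μF] in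
theorem integral_truncLaw (hα : truncProb μF μG ≠ 0) {h : ℝ → ℝ} (hh : Measurable h) :
    ∫ p, h p.1 ∂(truncLaw μF μG) =
      ∫ y, cdf μG y / (truncProb μF μG).toReal * h y ∂μF := by
  have hmeas : Measurable fun y => ENNReal.ofReal (cdf μG y) :=
    (monotone_cdf μG).measurable.ennreal_ofReal
  rw [← integral_map (f := h) measurable_fst.aemeasurable hh.aestronglyMeasurable, ← obsLaw,
    obsLaw_eq_withDensity, integral_withDensity_eq_integral_toReal_smul (hmeas.const_mul _)]
  · refine integral_congr_ae (Eventually.of_forall fun y => ?_)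
    simp only [smul_eq_mul, ENNReal.toReal_mul, ENNReal.toReal_inv,
      ENNReal.toReal_ofReal (cdf_nonneg μG y)]
    ring
  · exact Eventually.of_forall fun y =>
      ENNReal.mul_lt_top (ENNReal.inv_lt_top.mpr (pos_iff_ne_zero.mpr hα)) ENNReal.ofReal_lt_top

omit [IsProbabilityMeasure μF] in
theorem integrable_truncLaw (hα : truncProb μF μG ≠ 0) {h : ℝ → ℝ} (hh : Measurable h)
    (hint : Integrable h μF) : Integrable (fun p : ℝ × ℝ => h p.1) (truncLaw μF μG) := by
  refine ⟨(hh.comp measurable_fst).aestronglyMeasurable, ?_⟩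
  have h1 := hint.2
  unfold HasFiniteIntegral at h1 ⊢
  rw [lintegral_truncLaw μF μG (h := fun y => ‖h y‖ₑ) hh.enorm]
  have hαi : (truncProb μF μG)⁻¹ ≠ ⊤ := ENNReal.inv_ne_top.mpr hα
  calc ∫⁻ y, (truncProb μF μG)⁻¹ * ENNReal.ofReal (cdf μG y) * ‖h y‖ₑ ∂μF
      ≤ ∫⁻ y, (truncProb μF μG)⁻¹ * ‖h y‖ₑ ∂μF := by
        refine lintegral_mono fun y => ?_
        have : ENNReal.ofReal (cdf μG y) ≤ 1 := by
          rw [← ENNReal.ofReal_one]; exact ENNReal.ofReal_le_ofReal (cdf_le_one μG y)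
        calc _ ≤ (truncProb μF μG)⁻¹ * 1 * ‖h y‖ₑ := by gcongr
          _ = _ := by rw [mul_one]
    _ < ⊤ := by
        rw [lintegral_const_mul' _ _ hαi]
        exact ENNReal.mul_lt_top hαi.lt_top h1

/-- Almost surely the sample has no ties and every lifetime is at least its truncation time. -/
theorem ae_isTruncSample (hF : Continuous (cdf μF)) (hα : truncProb μF μG ≠ 0) :
    ∀ᵐ z ∂(Measure.infinitePi fun _ : ℕ => truncLaw μF μG),
      IsTruncSample (fun i => (z i).1) (fun i => (z i).2) := by
  have := isProbabilityMeasure_truncLaw μF μG hα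
  have hna := nullSingleton_of_continuous_cdf μF hF
  set κ := truncLaw μF μG with hκ
  set Q := Measure.infinitePi fun _ : ℕ => κ
  have hne : ∀ᵐ z ∂Q, ∀ i j : ℕ, i ≠ j → (z i).1 ≠ (z j).1 := by
    rw [ae_all_iff]; intro i
    rw [ae_all_iff]; intro j
    by_cases hij : i = j
    · exact Eventually.of_forall fun z h => absurd hij h
    have hi : i ∉ ({j} : Finset ℕ) := by simpa using hij
    set j' : ({j} : Finset ℕ) := ⟨j, Finset.mem_singleton_self j⟩
    set D : Set ((ℝ × ℝ) × (({j} : Finset ℕ) → ℝ × ℝ)) := {q | q.1.1 = (q.2 j').1} with hD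
    have hDm : MeasurableSet D := by
      have h1 : Measurable fun q : (ℝ × ℝ) × (({j} : Finset ℕ) → ℝ × ℝ) => (q.2 j').1 := by fun_prop
      have h2 : Measurable fun q : (ℝ × ℝ) × (({j} : Finset ℕ) → ℝ × ℝ) => q.1.1 := by fun_prop
      exact measurableSet_eq_fun h2 h1
    have h1 := lintegral_coord_finset κ hi (measurable_one.indicator hDm)
    have hzero : ∀ p : ℝ × ℝ, ∫⁻ z, D.indicator 1 (p, fun k : ({j} : Finset ℕ) => z k) ∂Q = 0 := by
      intro p
      -- With the `i`-th pair frozen, a tie means that another lifetime hits a fixed point, and the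
      -- observed law has no atoms.
      have hq : ∀ᵐ q ∂κ, q.1 ≠ p.1 := by
        have h3 : ∀ᵐ y ∂(obsLaw μF μG), y ≠ p.1 := by
          refine (obsLaw_absolutelyContinuous μF μG).ae_le ?_
          exact measure_eq_zero_iff_ae_notMem.mp (measure_singleton p.1)
        exact ae_of_ae_map measurable_fst.aemeasurable h3
      have hm : Measurable fun z : ℕ → ℝ × ℝ =>
          D.indicator (1 : (ℝ × ℝ) × (({j} : Finset ℕ) → ℝ × ℝ) → ℝ≥0∞) (p, fun k : ({j} : Finset ℕ) => z k) :=
        (measurable_one.indicator hDm).comp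
          (measurable_const.prodMk (measurable_pi_lambda _ fun k => measurable_pi_apply _))
      refine (lintegral_eq_zero_iff hm).mpr ?_
      filter_upwards [ae_forall_infinitePi hq] with z hz
      refine Set.indicator_of_notMem ?_ _
      intro h
      exact hz j h.symm
    have hm : Measurable fun z : ℕ → ℝ × ℝ =>
        D.indicator (1 : (ℝ × ℝ) × (({j} : Finset ℕ) → ℝ × ℝ) → ℝ≥0∞) (z i, fun k : ({j} : Finset ℕ) => z k) :=
      (measurable_one.indicator hDm).comp
        ((measurable_pi_apply i).prodMk (measurable_pi_lambda _ fun k => measurable_pi_apply _))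
    rw [lintegral_congr hzero, lintegral_zero] at h1
    filter_upwards [(lintegral_eq_zero_iff hm).mp h1] with z hz _ he
    have : ((z i, fun k : ({j} : Finset ℕ) => z k) : (ℝ × ℝ) × (({j} : Finset ℕ) → ℝ × ℝ)) ∈ D := he
    rw [Set.indicator_of_mem this] at hz
    simp at hz
  filter_upwards [hne, ae_forall_infinitePi (ae_truncLaw_le μF μG)] with z h1 h2
  exact ⟨fun i j hij => by_contra fun h => h1 i j h hij, h2⟩

/-- The strong law of large numbers for the empirical measure of an i.i.d. sequence. -/
theorem strong_law_infinitePi (κ : Measure (ℝ × ℝ)) [IsProbabilityMeasure κ] {h : ℝ × ℝ → ℝ}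
    (hh : Measurable h) (hint : Integrable h κ) :
    ∀ᵐ z ∂(Measure.infinitePi fun _ : ℕ => κ),
      Tendsto (fun n : ℕ => (∑ i ∈ Finset.range n, h (z i)) / n) atTop (𝓝 (∫ p, h p ∂κ)) := by
  set Q := Measure.infinitePi fun _ : ℕ => κ
  have hmp : ∀ i : ℕ, MeasurePreserving (Function.eval i) Q κ :=
    fun i => measurePreserving_eval_infinitePi (fun _ : ℕ => κ) i
  have hind : iIndepFun (fun (i : ℕ) (z : ℕ → ℝ × ℝ) => h (z i)) Q :=
    iIndepFun_infinitePi (X := fun _ => h) fun _ => hh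
  have hmeas : ∀ i, Measurable fun z : ℕ → ℝ × ℝ => h (z i) :=
    fun i => hh.comp (measurable_pi_apply i)
  have hmap : ∀ i, Q.map (fun z : ℕ → ℝ × ℝ => h (z i)) = κ.map h := by
    intro i
    rw [← (hmp i).map_eq, Measure.map_map hh (hmp i).measurable]
    rfl
  have hid : ∀ i, IdentDistrib (fun z : ℕ → ℝ × ℝ => h (z i)) (fun z => h (z 0)) Q Q :=
    fun i => ⟨(hmeas i).aemeasurable, (hmeas 0).aemeasurable, by rw [hmap, hmap]⟩
  have hint0 : Integrable (fun z : ℕ → ℝ × ℝ => h (z 0)) Q :=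
    (hmp 0).integrable_comp_of_integrable hint
  have hE : ∫ z, h (z 0) ∂Q = ∫ p, h p ∂κ := by
    rw [← (hmp 0).map_eq, integral_map (hmp 0).measurable.aemeasurable hh.aestronglyMeasurable]
  have := strong_law_ae_real (fun (i : ℕ) (z : ℕ → ℝ × ℝ) => h (z i)) hint0
    (fun i j hij => hind.indepFun hij) hid
  rw [hE] at this
  exact this

/-- The hazard sums near the left boundary are small, uniformly in the sample size. -/
theorem ae_exists_hazardSum_lt (hF : Continuous (cdf μF)) (hα : truncProb μF μG ≠ 0)
    {ψ : ℝ → ℝ≥0∞} (hψ : Measurable ψ) (hint : ∫⁻ y, ψ y ∂μF ≠ ⊤) {a : ℕ → ℝ} (ha : Antitone a)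
    (ha1 : cdf μF (a 0) < 1) (hex : ∀ x, 0 < cdf μG x → ∃ k, a k < x) :
    ∀ᵐ z ∂(Measure.infinitePi fun _ : ℕ => truncLaw μF μG), ∀ ε : ℝ, 0 < ε →
      ∃ k, ∀ n, hazardSum ((Set.Iic (a k)).indicator ψ) z (Finset.range n) < ENNReal.ofReal ε := by
  have := isProbabilityMeasure_truncLaw μF μG hα
  have hψk : ∀ k, Measurable ((Set.Iic (a k)).indicator ψ) := fun k => hψ.indicator measurableSet_Iic
  refine ae_exists_forall_hazardSum_lt _ (ae_truncLaw_le μF μG) hψk ?_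
  have hαt := truncProb_ne_top μF μG
  set α := truncProb μF μG with hαdef
  set R : ℝ → ℝ≥0∞ := fun x => (α⁻¹ * ENNReal.ofReal (cdf μG x * (1 - cdf μF x)))⁻¹ with hR
  have hRm : Measurable R := by
    refine Measurable.inv (Measurable.const_mul (Measurable.ennreal_ofReal ?_) _)
    exact (monotone_cdf μG).measurable.mul (measurable_const.sub hF.measurable)
  have hrw : ∀ (f : ℝ → ℝ≥0∞), Measurable f →
      ∫⁻ p, f p.1 * (truncLaw μF μG {q | q.2 ≤ p.1 ∧ p.1 ≤ q.1})⁻¹ ∂(truncLaw μF μG) =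
      ∫⁻ y, α⁻¹ * ENNReal.ofReal (cdf μG y) * (f y * R y) ∂μF := by
    intro f hf
    rw [← lintegral_truncLaw μF μG (h := fun y => f y * R y) (hf.mul hRm)]
    refine lintegral_congr fun p => ?_
    rw [truncLaw_riskSet μF μG hF]
  have hlim : Tendsto (fun k => ∫⁻ y, α⁻¹ * ENNReal.ofReal (cdf μG y) *
      ((Set.Iic (a k)).indicator ψ y * R y) ∂μF) atTop (𝓝 (∫⁻ _, 0 ∂μF)) := by
    set δ := 1 - cdf μF (a 0) with hδ
    have hδ0 : 0 < δ := by linarith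
    -- Where G > 0 the factor G/α cancels against 1/C and leaves ψ/(1 - F), which is at most ψ/δ
    -- left of `a 0`. Where G = 0 the reciprocal is `⊤`, but the zero factor in front wins.
    refine tendsto_lintegral_of_dominated_convergence
      (fun y => (ENNReal.ofReal δ)⁻¹ * ψ y) ?_ ?_ ?_ ?_
    · intro k
      exact ((monotone_cdf μG).measurable.ennreal_ofReal.const_mul _).mul ((hψk k).mul hRm)
    · intro k
      refine Eventually.of_forall fun y => ?_
      by_cases hy : y ∈ Set.Iic (a k)
      · simp only [Set.indicator_of_mem hy]
        have hyδ : δ ≤ 1 - cdf μF y := by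
          have := monotone_cdf μF ((show y ≤ a k from hy).trans (ha (Nat.zero_le k)))
          linarith
        have hG0 := cdf_nonneg μG y
        rcases hG0.eq_or_lt with h0 | hpos
        · rw [← h0]; simp
        have hRle : R y = α * (ENNReal.ofReal (cdf μG y))⁻¹ * (ENNReal.ofReal (1 - cdf μF y))⁻¹ := by
          have hne1 : ENNReal.ofReal (cdf μG y) ≠ 0 := (ENNReal.ofReal_pos.mpr hpos).ne'
          rw [hR]
          simp only
          rw [ENNReal.ofReal_mul hG0, ENNReal.mul_inv (Or.inl (ENNReal.inv_ne_zero.mpr hαt))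
            (Or.inl (ENNReal.inv_ne_top.mpr hα)), inv_inv,
            ENNReal.mul_inv (Or.inl hne1) (Or.inl ENNReal.ofReal_ne_top), mul_assoc]
        have hne1 : ENNReal.ofReal (cdf μG y) ≠ 0 := (ENNReal.ofReal_pos.mpr hpos).ne'
        rw [hRle]
        calc α⁻¹ * ENNReal.ofReal (cdf μG y) * (ψ y * (α * (ENNReal.ofReal (cdf μG y))⁻¹ *
              (ENNReal.ofReal (1 - cdf μF y))⁻¹))
            = (α⁻¹ * α) * (ENNReal.ofReal (cdf μG y) * (ENNReal.ofReal (cdf μG y))⁻¹) *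
              ((ENNReal.ofReal (1 - cdf μF y))⁻¹ * ψ y) := by ring
          _ = (ENNReal.ofReal (1 - cdf μF y))⁻¹ * ψ y := by
              rw [ENNReal.inv_mul_cancel hα hαt, ENNReal.mul_inv_cancel hne1 ENNReal.ofReal_ne_top,
                one_mul, one_mul]
          _ ≤ (ENNReal.ofReal δ)⁻¹ * ψ y := by
              gcongr
      · simp [Set.indicator_of_notMem hy]
    · rw [lintegral_const_mul _ hψ]
      exact ENNReal.mul_ne_top (ENNReal.inv_ne_top.mpr (ENNReal.ofReal_pos.mpr hδ0).ne') hint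
    -- Pointwise, either G(y) = 0 and the integrand vanishes, or `y` eventually lies to the right of
    -- `a k`.
    · refine Eventually.of_forall fun y => ?_
      rcases (cdf_nonneg μG y).eq_or_lt with h0 | hpos
      · rw [← h0]; simp
      · obtain ⟨k, hk⟩ := hex y hpos
        refine tendsto_const_nhds.congr' ?_
        filter_upwards [eventually_ge_atTop k] with l hl
        have : y ∉ Set.Iic (a l) := not_le.mpr ((ha hl).trans_lt hk)
        rw [Set.indicator_of_notMem this, zero_mul, mul_zero]
  rw [lintegral_zero] at hlim
  exact hlim.congr fun k => (hrw _ (hψk k)).symm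

end Model


/-! ### Continuous convergence -/

theorem tendsto_of_forall_approx {a : ℕ → ℝ} {α : ℝ}
    (h : ∀ ε > 0, ∃ (b : ℕ → ℝ) (β : ℝ), Tendsto b atTop (𝓝 β) ∧
      (∀ᶠ n in atTop, |a n - b n| ≤ ε) ∧ |β - α| ≤ ε) : Tendsto a atTop (𝓝 α) := by
  rw [Metric.tendsto_atTop']
  intro ε hε
  obtain ⟨b, β, h1, h2, h3⟩ := h (ε / 4) (by linarith)
  have h4 := (Metric.tendsto_nhds.mp h1) (ε / 4) (by linarith)
  obtain ⟨N, hN⟩ := eventually_atTop.mp (h2.and h4)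
  refine ⟨N, fun n hn => ?_⟩
  obtain ⟨h5, h6⟩ := hN n hn.le
  rw [Real.dist_eq] at h6 ⊢
  have h7 : a n - α = (a n - b n) + (b n - β) + (β - α) := by ring
  rw [h7]
  have := abs_add_le ((a n - b n) + (b n - β)) (β - α)
  have := abs_add_le (a n - b n) (b n - β)
  linarith

/-- `f n z → g x` as `n → ∞` and `z → x`. -/
def ContConv (f : ℕ → ℝ → ℝ) (g : ℝ → ℝ) (x : ℝ) : Prop :=
  Tendsto (fun p : ℕ × ℝ => f p.1 p.2) (atTop ×ˢ 𝓝 x) (𝓝 (g x))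

theorem ContConv.tendsto {f : ℕ → ℝ → ℝ} {g : ℝ → ℝ} {x : ℝ} (h : ContConv f g x) :
    Tendsto (fun n => f n x) atTop (𝓝 (g x)) :=
  Tendsto.comp (f := fun n : ℕ => (n, x)) h (tendsto_id.prodMk (tendsto_const_pure.mono_right (pure_le_nhds x)))

/-- Monotonicity squeezes `f n z`, for `z` near `x`, between the values at rationals on either side
of `x`. Only countably many pointwise limits are needed, so they can hold almost surely together. -/
theorem contConv_of_monotone {f : ℕ → ℝ → ℝ} {g : ℝ → ℝ} {x : ℝ} {s : Set ℝ}
    (hf : ∀ n, Monotone (f n)) (hg : ContinuousAt g x) (hs : s ∈ 𝓝 x)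
    (hq : ∀ q : ℚ, (q : ℝ) ∈ s → Tendsto (fun n => f n q) atTop (𝓝 (g q))) : ContConv f g x := by
  refine tendsto_order.mpr ⟨fun c hc => ?_, fun c hc => ?_⟩
  · have h1 : {z | c < g z} ∩ s ∈ 𝓝 x := inter_mem (hg.eventually (lt_mem_nhds hc)) hs
    obtain ⟨l, hl, hls⟩ := exists_Ioc_subset_of_mem_nhds h1 ⟨x - 1, by simp⟩
    obtain ⟨q, hq1, hq2⟩ := exists_rat_btwn hl
    obtain ⟨h2, h3⟩ := hls ⟨hq1, hq2.le⟩
    have h4 := (hq q h3).eventually (lt_mem_nhds h2)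
    refine (h4.prod_mk (lt_mem_nhds hq2)).mono fun p hp => ?_
    exact lt_of_lt_of_le hp.1 (hf p.1 (le_of_lt hp.2))
  · have h1 : {z | g z < c} ∩ s ∈ 𝓝 x := inter_mem (hg.eventually (gt_mem_nhds hc)) hs
    obtain ⟨l, hl, hls⟩ := exists_Ico_subset_of_mem_nhds h1 ⟨x + 1, by simp⟩
    obtain ⟨q, hq1, hq2⟩ := exists_rat_btwn hl
    obtain ⟨h2, h3⟩ := hls ⟨hq1.le, hq2⟩
    have h4 := (hq q h3).eventually (gt_mem_nhds h2)
    refine (h4.prod_mk (gt_mem_nhds hq1)).mono fun p hp => ?_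
    exact lt_of_le_of_lt (hf p.1 (le_of_lt hp.2)) hp.1

/-- Continuous convergence at `x` with a continuous limit is uniform on a neighbourhood of `x`;
finitely many neighbourhoods cover `K`. -/
theorem ContConv.uniform_on_compact {f : ℕ → ℝ → ℝ} {g : ℝ → ℝ} {K : Set ℝ} (hK : IsCompact K)
    (h : ∀ x ∈ K, ContConv f g x) (hg : ∀ x ∈ K, ContinuousAt g x) {ε : ℝ} (hε : 0 < ε) :
    ∀ᶠ n in atTop, ∀ z ∈ K, |f n z - g z| < ε := by
  refine hK.induction_on (p := fun s => ∀ᶠ n in atTop, ∀ z ∈ s, |f n z - g z| < ε) ?_ ?_ ?_ ?_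
  · simp
  · intro s t hst ht
    filter_upwards [ht] with n hn z hz using hn z (hst hz)
  · intro s t hs ht
    filter_upwards [hs, ht] with n h1 h2 z hz
    rcases hz with hz | hz
    · exact h1 z hz
    · exact h2 z hz
  · intro x hx
    have h1 : Tendsto (fun p : ℕ × ℝ => f p.1 p.2 - g p.2) (atTop ×ˢ 𝓝 x) (𝓝 (g x - g x)) :=
      Tendsto.sub (h x hx) ((hg x hx).tendsto.comp tendsto_snd)
    rw [sub_self] at h1
    have h2 := (Metric.tendsto_nhds.mp h1) ε hε
    obtain ⟨pa, hpa, pb, hpb, hp⟩ := eventually_prod_iff.mp h2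
    refine ⟨{z | pb z}, mem_nhdsWithin_of_mem_nhds hpb, ?_⟩
    filter_upwards [hpa] with n hn z hz
    have := hp hn hz
    rwa [Real.dist_eq, sub_zero] at this

/-- Means with uniformly convergent weights. -/
theorem tendsto_mean_mul {y : ℕ → ℝ} {h : ℝ → ℝ} {w : ℕ → ℝ → ℝ} {v : ℝ → ℝ} {K : Set ℝ} {M ℓ : ℝ}
    (hh : ∀ x, 0 ≤ h x) (h0 : ∀ x, x ∉ K → h x = 0)
    (hu : ∀ ε : ℝ, 0 < ε → ∀ᶠ n in atTop, ∀ z ∈ K, |w n z - v z| < ε)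
    (hM : ∀ᶠ n : ℕ in atTop, (∑ i ∈ Finset.range n, h (y i)) / n ≤ M)
    (hl : Tendsto (fun n : ℕ => (∑ i ∈ Finset.range n, h (y i) * v (y i)) / n) atTop (𝓝 ℓ)) :
    Tendsto (fun n : ℕ => (∑ i ∈ Finset.range n, h (y i) * w n (y i)) / n) atTop (𝓝 ℓ) := by
  refine tendsto_of_forall_approx fun ε hε => ⟨_, ℓ, hl, ?_, by simpa using hε.le⟩
  have hM0 : 0 < |M| + 1 := by positivity
  filter_upwards [hu (ε / (|M| + 1)) (by positivity), hM] with n hn hMn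
  rw [← sub_div, ← Finset.sum_sub_distrib, abs_div, Nat.abs_cast]
  have h1 : |∑ i ∈ Finset.range n, (h (y i) * w n (y i) - h (y i) * v (y i))| ≤
      ε / (|M| + 1) * ∑ i ∈ Finset.range n, h (y i) := by
    rw [Finset.mul_sum]
    refine (Finset.abs_sum_le_sum_abs _ _).trans (Finset.sum_le_sum fun i _ => ?_)
    rw [← mul_sub, abs_mul, abs_of_nonneg (hh _)]
    by_cases hy : y i ∈ K
    · rw [mul_comm]
      exact mul_le_mul_of_nonneg_right (hn _ hy).le (hh _)
    · simp [h0 _ hy]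
  calc _ ≤ ε / (|M| + 1) * (∑ i ∈ Finset.range n, h (y i)) / n :=
        div_le_div_of_nonneg_right h1 (Nat.cast_nonneg n)
    _ = ε / (|M| + 1) * ((∑ i ∈ Finset.range n, h (y i)) / n) := by ring
    _ ≤ ε / (|M| + 1) * (|M| + 1) := by
        refine mul_le_mul_of_nonneg_left ?_ (by positivity)
        linarith [le_abs_self M]
    _ = ε := by field_simp

theorem continuous_cdf_of_nullSingleton (μ : Measure ℝ) [IsProbabilityMeasure μ]
    [NullSingletonClass μ] : Continuous (cdf μ) := by
  rw [continuous_iff_continuousAt]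
  intro x
  rw [(monotone_cdf μ).continuousAt_iff_leftLim_eq_rightLim, (cdf μ).rightLim_eq]
  have h1 : (cdf μ).measure {x} = 0 := by rw [measure_cdf]; exact measure_singleton x
  rw [StieltjesFunction.measure_singleton, ENNReal.ofReal_eq_zero] at h1
  exact le_antisymm ((monotone_cdf μ).leftLim_le le_rfl) (by linarith)

/-! ### Convergence along a path -/

/-- The conditions on a sample path under which the Lynden-Bell integral of `φ ≥ 0` converges. -/
structure IsGoodPath (μF μG : Measure ℝ) (φ : ℝ → ℝ) (p₀ : ℝ) (a b : ℕ → ℝ) (y t : ℕ → ℝ) :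
    Prop where
  sample : IsTruncSample y t
  trunc_mean : ∀ q : ℚ, Tendsto (fun n : ℕ => (∑ i ∈ Finset.range n,
    (Set.Iic (q : ℝ)).indicator (fun _ => (1 : ℝ)) (t i)) / n) atTop
      (𝓝 ((truncLaw μF μG).real {p | p.2 ≤ q}))
  obs_mean : ∀ q : ℚ, Tendsto (fun n : ℕ => (∑ i ∈ Finset.range n,
    (Set.Iio (q : ℝ)).indicator (fun _ => (1 : ℝ)) (y i)) / n) atTop
      (𝓝 ((truncLaw μF μG).real {p | p.1 < q}))
  hazard_mean : ∀ (k : ℕ) (q : ℚ), cdf μF q < 1 → Tendsto (fun n : ℕ => (∑ i ∈ Finset.range n,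
    (Set.Ioo (a k) q).indicator (fun _ => (1 : ℝ)) (y i) * (1 / riskProb μF μG (y i))) / n) atTop
      (𝓝 (∫ x in Set.Ioo (a k) q, 1 / (1 - cdf μF x) ∂μF))
  -- With φ + 1 in place of φ, one bound controls both the integral of φ near the left boundary and
  -- the survival factors there.
  left_small : ∀ ε : ℝ, 0 < ε → ∃ k, ∀ n,
    ∑ i ∈ Finset.range n, (Set.Iic (a k)).indicator (fun x => φ x + 1) (y i) *
      (1 / atRisk n y t (y i)) < ε
  mid_mean : ∀ k l : ℕ, ∃ m : ℝ, Tendsto (fun n : ℕ => (∑ i ∈ Finset.range n,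
    (Set.Ioc (a k) (b l)).indicator φ (y i)) / n) atTop (𝓝 m)
  mid_weighted_mean : ∀ k l : ℕ, Tendsto (fun n : ℕ => (∑ i ∈ Finset.range n,
    (Set.Ioc (a k) (b l)).indicator φ (y i) *
      ((1 - cdf μF (y i)) / p₀ / riskProb μF μG (y i))) / n) atTop
      (𝓝 (∫ x in Set.Ioc (a k) (b l), φ x / p₀ ∂μF))
  right_small : ∀ ε : ℝ, 0 < ε → ∃ l, ∀ᶠ n : ℕ in atTop,
    (∑ i ∈ Finset.range n, (Set.Ioi (b l)).indicator φ (y i)) / n < ε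

/-- Since `t i ≤ y i`, those at risk are those already entered minus those already gone. This writes
the risk count through two monotone functions. -/
theorem atRisk_eq_sub {y t : ℕ → ℝ} (h : ∀ i, t i ≤ y i) (n : ℕ) (x : ℝ) :
    atRisk n y t x = ∑ i ∈ Finset.range n, (Set.Iic x).indicator (fun _ => (1 : ℝ)) (t i) -
      ∑ i ∈ Finset.range n, (Set.Iio x).indicator (fun _ => (1 : ℝ)) (y i) := by
  rw [← Finset.sum_sub_distrib]
  refine Finset.sum_congr rfl fun i _ => ?_
  by_cases h1 : t i ≤ x
  · by_cases h2 : x ≤ y i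
    · simp [Set.indicator, h1, h2, not_lt.mpr h2]
    · simp [Set.indicator, h1, h2, not_le.mp h2]
  · have h2 := (not_le.mp h1).trans_le (h i)
    simp [Set.indicator, h1, not_lt.mpr h2.le]

/-- C_n is not monotone, but it is a difference of two empirical distribution functions, each
monotone with a continuous limit. -/
theorem contConv_atRisk {μF μG : Measure ℝ} [IsProbabilityMeasure μF] [IsProbabilityMeasure μG]
    (hF : Continuous (cdf μF)) (hG : Continuous (cdf μG)) (hα : truncProb μF μG ≠ 0)
    {φ : ℝ → ℝ} {p₀ : ℝ} {a b y t : ℕ → ℝ} (h : IsGoodPath μF μG φ p₀ a b y t) (x : ℝ) :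
    ContConv (fun n x => atRisk n y t x / n) (riskProb μF μG) x := by
  have := isProbabilityMeasure_truncLaw μF μG hα
  have hnF := nullSingleton_of_continuous_cdf μF hF
  have hnG := nullSingleton_of_continuous_cdf μG hG
  set κ := truncLaw μF μG with hκ
  have hT : NullSingletonClass (κ.map Prod.snd) := by
    refine ⟨fun x => ?_⟩
    rw [Measure.map_apply measurable_snd (measurableSet_singleton x)]
    have h1 : κ ≪ μF.prod μG := cond_absolutelyContinuous
    refine h1 ?_
    have h2 : Prod.snd ⁻¹' {x} = (Set.univ : Set ℝ) ×ˢ ({x} : Set ℝ) := by ext; simp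
    rw [h2, Measure.prod_prod, measure_singleton, mul_zero]
  have hY : NullSingletonClass (obsLaw μF μG) :=
    ⟨fun x => obsLaw_absolutelyContinuous μF μG (measure_singleton x)⟩
  have : IsProbabilityMeasure (κ.map Prod.snd) :=
    Measure.isProbabilityMeasure_map measurable_snd.aemeasurable
  have : IsProbabilityMeasure (obsLaw μF μG) :=
    Measure.isProbabilityMeasure_map measurable_fst.aemeasurable
  have hTc := continuous_cdf_of_nullSingleton (κ.map Prod.snd)
  have hYc := continuous_cdf_of_nullSingleton (obsLaw μF μG)
  have hTe : ∀ x, κ.real {p | p.2 ≤ x} = cdf (κ.map Prod.snd) x := by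
    intro x
    rw [cdf_eq_real, Measure.real, Measure.real, Measure.map_apply measurable_snd measurableSet_Iic]
    rfl
  have hYe : ∀ x, κ.real {p | p.1 < x} = cdf (obsLaw μF μG) x := by
    intro x
    rw [cdf_eq_real, Measure.real, Measure.real, ← measure_congr Iio_ae_eq_Iic, obsLaw,
      Measure.map_apply measurable_fst measurableSet_Iio]
    rfl
  have hmono1 : ∀ n : ℕ, Monotone fun x => (∑ i ∈ Finset.range n,
      (Set.Iic x).indicator (fun _ => (1 : ℝ)) (t i)) / n := by
    intro n x x' hx
    refine div_le_div_of_nonneg_right (Finset.sum_le_sum fun i _ => ?_) (Nat.cast_nonneg n)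
    exact Set.indicator_le_indicator_of_subset (Set.Iic_subset_Iic.mpr hx) (fun _ => zero_le_one) _
  have hmono2 : ∀ n : ℕ, Monotone fun x => (∑ i ∈ Finset.range n,
      (Set.Iio x).indicator (fun _ => (1 : ℝ)) (y i)) / n := by
    intro n x x' hx
    refine div_le_div_of_nonneg_right (Finset.sum_le_sum fun i _ => ?_) (Nat.cast_nonneg n)
    exact Set.indicator_le_indicator_of_subset (Set.Iio_subset_Iio hx) (fun _ => zero_le_one) _
  have c1 := contConv_of_monotone (x := x) hmono1 hTc.continuousAt univ_mem
    fun q _ => by rw [← hTe]; exact h.trunc_mean q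
  have c2 := contConv_of_monotone (x := x) hmono2 hYc.continuousAt univ_mem
    fun q _ => by rw [← hYe]; exact h.obs_mean q
  have hlim : cdf (κ.map Prod.snd) x - cdf (obsLaw μF μG) x = riskProb μF μG x := by
    rw [← hTe, ← hYe, ← truncLaw_real_riskSet μF μG hF, ← hκ]
    have hd : {p : ℝ × ℝ | p.2 ≤ x} =ᵐ[κ] ({p | p.1 < x} ∪ {p | p.2 ≤ x ∧ x ≤ p.1} : Set (ℝ × ℝ)) := by
      rw [eventuallyEq_set]
      filter_upwards [ae_truncLaw_le μF μG] with p hp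
      simp only [Set.mem_ofPred_eq, Set.mem_union]
      constructor
      · intro h1
        rcases lt_or_ge p.1 x with h2 | h2
        · exact Or.inl h2
        · exact Or.inr ⟨h1, h2⟩
      · rintro (h1 | h1)
        · linarith
        · exact h1.1
    rw [measureReal_congr hd, measureReal_union]
    · ring
    · rw [Set.disjoint_left]
      rintro p h1 ⟨_, h2⟩
      exact absurd (show p.1 < x from h1) (not_lt.mpr h2)
    · exact (measurableSet_le measurable_snd measurable_const).inter
        (measurableSet_le measurable_const measurable_fst)
  unfold ContConv at c1 c2 ⊢
  rw [← hlim]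
  refine (c1.sub c2).congr fun p => ?_
  rw [← sub_div, ← atRisk_eq_sub h.sample.le]

theorem riskProb_pos {μF μG : Measure ℝ} [IsProbabilityMeasure μF] [IsProbabilityMeasure μG]
    (hα : truncProb μF μG ≠ 0) {x : ℝ} (hx : x ∈ obsRange μF μG) : 0 < riskProb μF μG x :=
  div_pos (mul_pos hx.1 (by linarith [hx.2])) (truncProb_toReal_pos μF μG hα)

theorem continuous_riskProb {μF μG : Measure ℝ} (hF : Continuous (cdf μF))
    (hG : Continuous (cdf μG)) : Continuous (riskProb μF μG) :=
  (hG.mul (continuous_const.sub hF)).div_const _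

theorem Icc_subset_obsRange {μF μG : Measure ℝ} {x x' : ℝ} (hx : x ∈ obsRange μF μG)
    (hx' : x' ∈ obsRange μF μG) : Set.Icc x x' ⊆ obsRange μF μG := fun _ hz =>
  ⟨hx.1.trans_le (monotone_cdf μG hz.1), (monotone_cdf μF hz.2).trans_lt hx'.2⟩

theorem contConv_inv_atRisk {μF μG : Measure ℝ} [IsProbabilityMeasure μF] [IsProbabilityMeasure μG]
    (hF : Continuous (cdf μF)) (hG : Continuous (cdf μG)) (hα : truncProb μF μG ≠ 0)
    {φ : ℝ → ℝ} {p₀ : ℝ} {a b y t : ℕ → ℝ} (h : IsGoodPath μF μG φ p₀ a b y t) {x : ℝ}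
    (hx : x ∈ obsRange μF μG) :
    ContConv (fun n x => 1 / (atRisk n y t x / n)) (fun x => 1 / riskProb μF μG x) x :=
  Tendsto.div tendsto_const_nhds (contConv_atRisk hF hG hα h x) (riskProb_pos hα hx).ne'

/-- Convergence of the product limit over an interval inside the observable range. -/
theorem tendsto_prod_Ioo {μF μG : Measure ℝ} [IsProbabilityMeasure μF] [IsProbabilityMeasure μG]
    (hF : Continuous (cdf μF)) (hG : Continuous (cdf μG)) (hα : truncProb μF μG ≠ 0)
    {φ : ℝ → ℝ} {p₀ : ℝ} {a b y t : ℕ → ℝ} (h : IsGoodPath μF μG φ p₀ a b y t) {k : ℕ}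
    (ha : a k ∈ obsRange μF μG) {q : ℚ} (hq : (q : ℝ) ∈ obsRange μF μG) (hkq : a k < q) :
    Tendsto (fun n => ∏ j ∈ (Finset.range n).filter (fun j => a k < y j ∧ y j < q),
      (1 - 1 / atRisk n y t (y j))) atTop (𝓝 ((1 - cdf μF q) / (1 - cdf μF (a k)))) := by
  have hnF := nullSingleton_of_continuous_cdf μF hF
  have hsub := Icc_subset_obsRange ha hq
  have hcc : ∀ x ∈ Set.Icc (a k) q,
      ContConv (fun n x => 1 / (atRisk n y t x / n)) (fun x => 1 / riskProb μF μG x) x :=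
    fun x hx => contConv_inv_atRisk hF hG hα h (hsub hx)
  have hcont : ∀ x ∈ Set.Icc (a k) (q : ℝ), ContinuousAt (fun x => 1 / riskProb μF μG x) x :=
    fun x hx => continuousAt_const.div (continuous_riskProb hF hG).continuousAt
      (riskProb_pos hα (hsub hx)).ne'
  have hunif := fun (ε : ℝ) (hε : 0 < ε) =>
    ContConv.uniform_on_compact isCompact_Icc hcc hcont hε
  -- The empirical cumulative hazard: C_n is replaced by C uniformly on the compact interval, then
  -- the strong law applies to 1/C.
  have hsum : Tendsto (fun n : ℕ => ∑ j ∈ (Finset.range n).filter (fun j => a k < y j ∧ y j < q),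
      1 / atRisk n y t (y j)) atTop
      (𝓝 (∫ x in Set.Ioo (a k) (q : ℝ), 1 / (1 - cdf μF x) ∂μF)) := by
    refine (tendsto_mean_mul (y := y) (M := 1)
      (h := (Set.Ioo (a k) (q : ℝ)).indicator fun _ => (1 : ℝ))
      (w := fun n x => 1 / (atRisk n y t x / n)) (v := fun x => 1 / riskProb μF μG x)
      (K := Set.Icc (a k) q) ?_ ?_ hunif ?_ (h.hazard_mean k q hq.2)).congr' ?_
    · exact fun x => Set.indicator_nonneg (fun _ _ => zero_le_one) x
    · exact fun x hx => Set.indicator_of_notMem (fun hx' => hx (Set.Ioo_subset_Icc_self hx')) _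
    · filter_upwards [eventually_gt_atTop 0] with n hn
      rw [div_le_one (by exact_mod_cast hn)]
      calc _ ≤ ∑ i ∈ Finset.range n, (1 : ℝ) :=
            Finset.sum_le_sum fun i _ => Set.indicator_le_self' (fun _ _ => zero_le_one) _
        _ = n := by simp
    · filter_upwards [eventually_gt_atTop 0] with n hn
      have hn' : (n : ℝ) ≠ 0 := by exact_mod_cast hn.ne'
      rw [Finset.sum_div, Finset.sum_filter]
      refine Finset.sum_congr rfl fun i _ => ?_
      by_cases hi : a k < y i ∧ y i < q
      · rw [if_pos hi, Set.indicator_of_mem (show y i ∈ Set.Ioo (a k) (q : ℝ) from hi), one_mul,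
          one_div_div, div_div_cancel_left' hn', one_div]
      · rw [if_neg hi, Set.indicator_of_notMem (show y i ∉ Set.Ioo (a k) (q : ℝ) from hi)]
        simp
  have hint : ∫ x in Set.Ioo (a k) (q : ℝ), 1 / (1 - cdf μF x) ∂μF =
      Real.log ((1 - cdf μF (a k)) / (1 - cdf μF q)) := by
    rw [← integral_hazard μF hF hkq.le hq.2]
    exact setIntegral_congr_set Ioo_ae_eq_Ioc
  have hpa : 0 < 1 - cdf μF (a k) := by linarith [ha.2]
  have hpq : 0 < 1 - cdf μF q := by linarith [hq.2]
  have hexp : Tendsto (fun n : ℕ => Real.exp (-∑ j ∈ (Finset.range n).filter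
      (fun j => a k < y j ∧ y j < q), 1 / atRisk n y t (y j))) atTop
      (𝓝 ((1 - cdf μF q) / (1 - cdf μF (a k)))) := by
    have h1 := (Real.continuous_exp.tendsto _).comp hsum.neg
    rw [hint, Real.exp_neg, Real.exp_log (by positivity), inv_div] at h1
    exact h1
  obtain ⟨M, hM⟩ := (isCompact_Icc (a := a k) (b := (q : ℝ))).exists_bound_of_continuousOn
    (fun x hx => (hcont x hx).continuousWithinAt)
  -- The sum of squares is at most the largest term times the sum. As C_n is uniformly close to C
  -- and 1/C ≤ M, the terms are at most (M + 1)/n.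
  have hsq : Tendsto (fun n : ℕ => (M + 1) / n * ∑ j ∈ (Finset.range n).filter
      (fun j => a k < y j ∧ y j < q), 1 / atRisk n y t (y j)) atTop (𝓝 0) := by
    have h1 := (tendsto_const_div_atTop_nhds_zero_nat (M + 1)).mul hsum
    rwa [zero_mul] at h1
  have hdiff : Tendsto (fun n : ℕ => ∏ j ∈ (Finset.range n).filter (fun j => a k < y j ∧ y j < q),
      (1 - 1 / atRisk n y t (y j)) - Real.exp (-∑ j ∈ (Finset.range n).filter
      (fun j => a k < y j ∧ y j < q), 1 / atRisk n y t (y j))) atTop (𝓝 0) := by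
    refine squeeze_zero_norm' ?_ hsq
    filter_upwards [hunif 1 one_pos, eventually_gt_atTop 0] with n hn hn0
    have hn' : (0 : ℝ) < n := by exact_mod_cast hn0
    rw [Real.norm_eq_abs]
    refine (abs_prod_sub_exp_le _ _ ?_ ?_).trans ?_
    · exact fun j _ => one_div_nonneg.mpr (atRisk_nonneg _ _ _ _)
    · intro j hj
      have := one_sub_inv_atRisk_mem (Finset.mem_range.mp (Finset.mem_filter.mp hj).1) (h.sample.le j)
      linarith [this.1]
    · rw [Finset.mul_sum]
      refine Finset.sum_le_sum fun j hj => ?_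
      have hj' := (Finset.mem_filter.mp hj).2
      have hmem : y j ∈ Set.Icc (a k) (q : ℝ) := ⟨hj'.1.le, hj'.2.le⟩
      have h1 := (abs_lt.mp (hn _ hmem)).2
      have h2 := (abs_le.mp (hM _ hmem)).2
      rw [sq]
      refine mul_le_mul_of_nonneg_right ?_ (one_div_nonneg.mpr (atRisk_nonneg _ _ _ _))
      have h3 : 1 / atRisk n y t (y j) = 1 / (atRisk n y t (y j) / n) / n := by
        rw [one_div_div, div_div_cancel_left' hn'.ne', one_div]
      rw [h3]
      exact div_le_div_of_nonneg_right (by linarith) hn'.le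
  have := hdiff.add hexp
  rw [zero_add] at this
  exact this.congr fun n => by ring

/-- The assumptions on the sequences which exhaust the observable range. -/
structure IsExhaustion (μF μG : Measure ℝ) (a b : ℕ → ℝ) : Prop where
  anti : Antitone a
  mono : Monotone b
  left_mem : ∀ k, a k ∈ obsRange μF μG
  right_mem : ∀ k, b k ∈ obsRange μF μG
  le : ∀ k l, a k ≤ b l
  left_lt : ∀ x, 0 < cdf μG x → ∃ k, a k < x
  lt_right : ∀ x, cdf μF x < 1 → ∃ k, x < b k

section Path

variable {μF μG : Measure ℝ} [IsProbabilityMeasure μF] [IsProbabilityMeasure μG]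

omit [IsProbabilityMeasure μF] [IsProbabilityMeasure μG] in
theorem IsExhaustion.iUnion_Ioi {a b : ℕ → ℝ} (h : IsExhaustion μF μG a b) :
    ⋃ k, Set.Ioi (a k) = {x | 0 < cdf μG x} := by
  ext x
  simp only [Set.mem_iUnion, Set.mem_Ioi, Set.mem_ofPred_eq]
  exact ⟨fun ⟨k, hk⟩ => (h.left_mem k).1.trans_le (monotone_cdf μG hk.le), h.left_lt x⟩

omit [IsProbabilityMeasure μF] [IsProbabilityMeasure μG] in
theorem IsExhaustion.iUnion_Ioc {a b : ℕ → ℝ} (h : IsExhaustion μF μG a b) :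
    ⋃ k, Set.Ioc (a k) (b k) = obsRange μF μG := by
  ext x
  simp only [Set.mem_iUnion, Set.mem_Ioc]
  constructor
  · rintro ⟨k, h1, h2⟩
    exact Icc_subset_obsRange (h.left_mem k) (h.right_mem k) ⟨h1.le, h2⟩
  · intro hx
    obtain ⟨k, hk⟩ := h.left_lt x hx.1
    obtain ⟨l, hl⟩ := h.lt_right x hx.2
    exact ⟨max k l, (h.anti (le_max_left k l)).trans_lt hk,
      hl.le.trans (h.mono (le_max_right k l))⟩

omit [IsProbabilityMeasure μG] in
theorem obsRange_ae_eq (hF : Continuous (cdf μF)) :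
    obsRange μF μG =ᵐ[μF] {x | 0 < cdf μG x} := by
  rw [eventuallyEq_set]
  filter_upwards [measure_eq_zero_iff_ae_notMem.mp (measure_preimage_cdf_singleton μF hF 1)]
    with x hx
  exact ⟨fun h => h.1, fun h => ⟨h, lt_of_le_of_ne (cdf_le_one μF x) hx⟩⟩

omit [IsProbabilityMeasure μG] in
-- Source of the normalization: the product limit over (a k, q) tends to (1 - F(q))/(1 - F(a k)),
-- and letting `k → ∞` turns the denominator into the identifiable mass p₀.
theorem tendsto_one_sub_cdf {a b : ℕ → ℝ} (h : IsExhaustion μF μG a b) :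
    Tendsto (fun k => 1 - cdf μF (a k)) atTop (𝓝 (μF.real {x | 0 < cdf μG x})) := by
  have h1 : Tendsto (fun k => μF (Set.Ioi (a k))) atTop (𝓝 (μF (⋃ k, Set.Ioi (a k)))) :=
    tendsto_measure_iUnion_atTop fun k l hkl => Set.Ioi_subset_Ioi (h.anti hkl)
  rw [h.iUnion_Ioi] at h1
  have h2 := (ENNReal.tendsto_toReal (measure_ne_top μF _)).comp h1
  refine h2.congr fun k => ?_
  rw [Function.comp_apply, measure_Ioi_eq_cdf,
    ENNReal.toReal_ofReal (sub_nonneg.mpr (cdf_le_one μF _))]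

omit [IsProbabilityMeasure μG] in
theorem measureReal_cdf_pos {x : ℝ} (hx : x ∈ obsRange μF μG) :
    0 < μF.real {x | 0 < cdf μG x} := by
  have h1 : Set.Ioi x ⊆ {x | 0 < cdf μG x} := fun y hy =>
    hx.1.trans_le (monotone_cdf μG (le_of_lt hy))
  refine lt_of_lt_of_le ?_ (measureReal_mono h1)
  rw [Measure.real, measure_Ioi_eq_cdf, ENNReal.toReal_ofReal (sub_nonneg.mpr (cdf_le_one μF _))]
  linarith [hx.2]

theorem survivalBelow_eq_mul_prod_Ioo (n : ℕ) (y t : ℕ → ℝ) {x x' : ℝ} (hx : x < x') :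
    survivalBelow n y t x' =
      (∏ j ∈ (Finset.range n).filter (fun j => y j ≤ x), (1 - 1 / atRisk n y t (y j))) *
      ∏ j ∈ (Finset.range n).filter (fun j => x < y j ∧ y j < x'),
        (1 - 1 / atRisk n y t (y j)) := by
  unfold survivalBelow
  rw [← Finset.prod_union]
  · refine Finset.prod_congr ?_ fun _ _ => rfl
    ext j
    simp only [Finset.mem_filter, Finset.mem_union, Finset.mem_range]
    constructor
    · rintro ⟨h1, h2⟩
      rcases le_or_gt (y j) x with h | h
      · exact Or.inl ⟨h1, h⟩
      · exact Or.inr ⟨h1, h, h2⟩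
    · rintro (⟨h1, h2⟩ | ⟨h1, h2, h3⟩)
      · exact ⟨h1, h2.trans_lt hx⟩
      · exact ⟨h1, h3⟩
  · rw [Finset.disjoint_filter]
    intro j _ h1 h2
    exact absurd h2.1 (not_lt.mpr h1)

variable {φ : ℝ → ℝ} {p₀ : ℝ} {a b y t : ℕ → ℝ}

omit [IsProbabilityMeasure μF] [IsProbabilityMeasure μG] in
-- Monotonicity in `k` upgrades one good index to all large ones, so that this condition can be
-- combined with others at a common `k`.
theorem IsGoodPath.eventually_left_small (h : IsGoodPath μF μG φ p₀ a b y t)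
    (he : IsExhaustion μF μG a b) (hφ : ∀ x, 0 ≤ φ x) {ε : ℝ} (hε : 0 < ε) :
    ∀ᶠ k in atTop, ∀ n,
      ∑ i ∈ Finset.range n, (Set.Iic (a k)).indicator (fun x => φ x + 1) (y i) *
        (1 / atRisk n y t (y i)) < ε := by
  obtain ⟨k, hk⟩ := h.left_small ε hε
  filter_upwards [eventually_ge_atTop k] with l hl n
  refine lt_of_le_of_lt (Finset.sum_le_sum fun i _ => ?_) (hk n)
  refine mul_le_mul_of_nonneg_right ?_ (one_div_nonneg.mpr (atRisk_nonneg _ _ _ _))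
  exact Set.indicator_le_indicator_of_subset (Set.Iic_subset_Iic.mpr (he.anti hl))
    (fun x => add_nonneg (hφ x) zero_le_one) _

omit [IsProbabilityMeasure μF] [IsProbabilityMeasure μG] in
theorem IsGoodPath.eventually_right_small (h : IsGoodPath μF μG φ p₀ a b y t)
    (he : IsExhaustion μF μG a b) (hφ : ∀ x, 0 ≤ φ x) {ε : ℝ} (hε : 0 < ε) :
    ∀ᶠ l in atTop, ∀ᶠ n : ℕ in atTop,
      (∑ i ∈ Finset.range n, (Set.Ioi (b l)).indicator φ (y i)) / n < ε := by
  obtain ⟨k, hk⟩ := h.right_small ε hε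
  filter_upwards [eventually_ge_atTop k] with l hl
  filter_upwards [hk] with n hn
  refine lt_of_le_of_lt (div_le_div_of_nonneg_right (Finset.sum_le_sum fun i _ => ?_)
    (Nat.cast_nonneg n)) hn
  exact Set.indicator_le_indicator_of_subset (Set.Ioi_subset_Ioi (he.mono hl)) hφ _

/-- Pointwise consistency of the product limit inside the observable range. -/
theorem IsGoodPath.tendsto_survivalBelow (hF : Continuous (cdf μF)) (hG : Continuous (cdf μG))
    (hα : truncProb μF μG ≠ 0) (hφ : ∀ x, 0 ≤ φ x)
    (h : IsGoodPath μF μG φ (μF.real {x | 0 < cdf μG x}) a b y t)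
    (he : IsExhaustion μF μG a b) {q : ℚ} (hq : (q : ℝ) ∈ obsRange μF μG) :
    Tendsto (fun n => survivalBelow n y t q) atTop
      (𝓝 ((1 - cdf μF q) / μF.real {x | 0 < cdf μG x})) := by
  refine tendsto_of_forall_approx fun ε hε => ?_
  have hp := measureReal_cdf_pos hq
  have h1 : Tendsto (fun k => (1 - cdf μF q) / (1 - cdf μF (a k))) atTop
      (𝓝 ((1 - cdf μF q) / μF.real {x | 0 < cdf μG x})) :=
    tendsto_const_nhds.div (tendsto_one_sub_cdf he) hp.ne'
  have h2 := (Metric.tendsto_nhds.mp h1) ε hε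
  obtain ⟨k₀, hk₀⟩ := he.left_lt q hq.1
  -- One `k` makes the factors left of `a k` negligible for all `n`, brings the limit of the other
  -- factors within ε of the target, and puts `a k` left of `q`.
  obtain ⟨k, hk1, hk2, hk3⟩ := ((h.eventually_left_small he hφ hε).and
    (h2.and (eventually_ge_atTop k₀))).exists
  have hkq : a k < q := (he.anti hk3).trans_lt hk₀
  refine ⟨_, _, tendsto_prod_Ioo hF hG hα h (he.left_mem k) hq hkq, ?_, ?_⟩
  · refine Eventually.of_forall fun n => ?_
    have hfac : ∀ j ∈ Finset.range n,
        0 ≤ 1 - 1 / atRisk n y t (y j) ∧ 1 - 1 / atRisk n y t (y j) ≤ 1 := fun j hj =>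
      one_sub_inv_atRisk_mem (Finset.mem_range.mp hj) (h.sample.le j)
    rw [survivalBelow_eq_mul_prod_Ioo n y t hkq]
    set B := ∏ j ∈ (Finset.range n).filter (fun j => a k < y j ∧ y j < q),
      (1 - 1 / atRisk n y t (y j))
    set A := ∏ j ∈ (Finset.range n).filter (fun j => y j ≤ a k), (1 - 1 / atRisk n y t (y j))
    have hB0 : 0 ≤ B := Finset.prod_nonneg fun j hj => (hfac j (Finset.mem_filter.mp hj).1).1
    have hB1 : B ≤ 1 := Finset.prod_le_one
      (fun j hj => (hfac j (Finset.mem_filter.mp hj).1).1)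
      (fun j hj => (hfac j (Finset.mem_filter.mp hj).1).2)
    have hA1 : A ≤ 1 := Finset.prod_le_one
      (fun j hj => (hfac j (Finset.mem_filter.mp hj).1).1)
      (fun j hj => (hfac j (Finset.mem_filter.mp hj).1).2)
    -- The left factors differ from 1 in product by at most the sum of the reciprocals, which the
    -- summand 1 in φ + 1 controls.
    have hA0 : 1 - ε ≤ A := by
      have h3 := one_sub_sum_le_prod ((Finset.range n).filter (fun j => y j ≤ a k))
        (fun j => 1 / atRisk n y t (y j)) (fun j _ => one_div_nonneg.mpr (atRisk_nonneg _ _ _ _))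
        (fun j hj => by linarith [(hfac j (Finset.mem_filter.mp hj).1).1])
      have h4 : ∑ j ∈ (Finset.range n).filter (fun j => y j ≤ a k), 1 / atRisk n y t (y j) ≤
          ∑ i ∈ Finset.range n, (Set.Iic (a k)).indicator (fun x => φ x + 1) (y i) *
            (1 / atRisk n y t (y i)) := by
        rw [Finset.sum_filter]
        refine Finset.sum_le_sum fun i _ => ?_
        by_cases hi : y i ≤ a k
        · rw [if_pos hi, Set.indicator_of_mem (show y i ∈ Set.Iic (a k) from hi)]
          exact le_mul_of_one_le_left (one_div_nonneg.mpr (atRisk_nonneg _ _ _ _))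
            (by linarith [hφ (y i)])
        · rw [if_neg hi, Set.indicator_of_notMem (show y i ∉ Set.Iic (a k) from hi), zero_mul]
      linarith [hk1 n]
    rw [abs_le]
    constructor <;> nlinarith
  · rw [Real.dist_eq] at hk2
    exact hk2.le

/-- Convergence of the Lynden-Bell integral of a nonnegative function along a good path. -/
theorem IsGoodPath.tendsto_sum_jumpWeight (hF : Continuous (cdf μF)) (hG : Continuous (cdf μG))
    (hα : truncProb μF μG ≠ 0) (hφ : ∀ x, 0 ≤ φ x) (hint : Integrable φ μF)
    (h : IsGoodPath μF μG φ (μF.real {x | 0 < cdf μG x}) a b y t)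
    (he : IsExhaustion μF μG a b) :
    Tendsto (fun n => ∑ i ∈ Finset.range n, jumpWeight n y t i * φ (y i)) atTop
      (𝓝 (∫ x in {x | 0 < cdf μG x}, φ x / μF.real {x | 0 < cdf μG x} ∂μF)) := by
  set p₀ := μF.real {x | 0 < cdf μG x} with hp₀
  have hp : 0 < p₀ := measureReal_cdf_pos (he.left_mem 0)
  have hopen := isOpen_obsRange hF hG
  have hSc : Continuous fun x => (1 - cdf μF x) / p₀ := (continuous_const.sub hF).div_const _
  have hS : ∀ x ∈ obsRange μF μG,
      ContConv (fun n => survivalBelow n y t) (fun x => (1 - cdf μF x) / p₀) x := by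
    intro x hx
    -- The survival product is antitone, hence the sign change.
    have h1 := contConv_of_monotone (f := fun n x => -survivalBelow n y t x)
      (g := fun x => -((1 - cdf μF x) / p₀)) (x := x)
      (fun n x x' hxx => neg_le_neg (survivalBelow_antitone h.sample.le n hxx))
      hSc.neg.continuousAt (hopen.mem_nhds hx)
      (fun q hq => (h.tendsto_survivalBelow hF hG hα hφ he hq).neg)
    unfold ContConv at h1 ⊢
    simpa using h1.neg
  have hW : ∀ x ∈ obsRange μF μG, ContConv (fun n x => survivalBelow n y t x / (atRisk n y t x / n))
      (fun x => (1 - cdf μF x) / p₀ / riskProb μF μG x) x := fun x hx =>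
    Tendsto.div (hS x hx) (contConv_atRisk hF hG hα h x) (riskProb_pos hα hx).ne'
  have hmid : ∀ k, Tendsto (fun n => ∑ i ∈ Finset.range n,
      (Set.Ioc (a k) (b k)).indicator φ (y i) * jumpWeight n y t i) atTop
      (𝓝 (∫ x in Set.Ioc (a k) (b k), φ x / p₀ ∂μF)) := by
    intro k
    have hsub := Icc_subset_obsRange (he.left_mem k) (he.right_mem k)
    obtain ⟨m, hm⟩ := h.mid_mean k k
    refine (tendsto_mean_mul (y := y) (M := m + 1) (h := (Set.Ioc (a k) (b k)).indicator φ)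
      (w := fun n x => survivalBelow n y t x / (atRisk n y t x / n))
      (v := fun x => (1 - cdf μF x) / p₀ / riskProb μF μG x) (K := Set.Icc (a k) (b k)) ?_ ?_ ?_ ?_
      (h.mid_weighted_mean k k)).congr' ?_
    · exact fun x => Set.indicator_nonneg (fun _ _ => hφ _) x
    · exact fun x hx => Set.indicator_of_notMem (fun hx' => hx (Set.Ioc_subset_Icc_self hx')) _
    · intro ε hε
      exact ContConv.uniform_on_compact isCompact_Icc (fun x hx => hW x (hsub hx))
        (fun x hx => hSc.continuousAt.div (continuous_riskProb hF hG).continuousAt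
          (riskProb_pos hα (hsub hx)).ne') hε
    · exact (hm.eventually (gt_mem_nhds (lt_add_one m))).mono fun n hn => hn.le
    · filter_upwards [eventually_gt_atTop 0] with n hn
      have hn' : (n : ℝ) ≠ 0 := by exact_mod_cast hn.ne'
      rw [Finset.sum_div]
      refine Finset.sum_congr rfl fun i _ => ?_
      unfold jumpWeight
      field_simp
  have hlim : Tendsto (fun k => ∫ x in Set.Ioc (a k) (b k), φ x / p₀ ∂μF) atTop
      (𝓝 (∫ x in {x | 0 < cdf μG x}, φ x / p₀ ∂μF)) := by
    have h1 := tendsto_setIntegral_of_monotone (μ := μF) (f := fun x => φ x / p₀)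
      (s := fun k => Set.Ioc (a k) (b k)) (fun k => measurableSet_Ioc)
      (fun k l hkl => Set.Ioc_subset_Ioc (he.anti hkl) (he.mono hkl))
      (hint.div_const p₀).integrableOn
    rwa [he.iUnion_Ioc, setIntegral_congr_set (obsRange_ae_eq hF)] at h1
  refine tendsto_of_forall_approx fun ε hε => ?_
  -- The point `a 0` lies left of every `b k`, so weights beyond `b k` are at most 1/(n C_n(a 0)).
  -- Eventually C_n(a 0) > c/2, so a tail mean below cε/4 contributes at most ε/2.
  have hc := riskProb_pos (μF := μF) hα (he.left_mem 0)
  set c := riskProb μF μG (a 0) with hcdef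
  obtain ⟨k, hk1, hk2, hk3⟩ := ((h.eventually_left_small he hφ (half_pos hε)).and
    ((h.eventually_right_small he hφ (show 0 < c * ε / 4 by positivity)).and
      ((Metric.tendsto_nhds.mp hlim) ε hε))).exists
  refine ⟨_, _, hmid k, ?_, ?_⟩
  · filter_upwards [hk2, (contConv_atRisk hF hG hα h (a 0)).tendsto.eventually
      (lt_mem_nhds (half_lt_self hc)), eventually_gt_atTop 0] with n hn1 hn2 hn0
    have hn' : (0 : ℝ) < n := by exact_mod_cast hn0
    have hrisk : 0 < atRisk n y t (a 0) := by
      by_contra hle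
      have : atRisk n y t (a 0) / n ≤ 0 := div_nonpos_of_nonpos_of_nonneg (not_lt.mp hle) hn'.le
      linarith
    have hsplit : ∑ i ∈ Finset.range n, jumpWeight n y t i * φ (y i) -
        ∑ i ∈ Finset.range n, (Set.Ioc (a k) (b k)).indicator φ (y i) * jumpWeight n y t i =
        ∑ i ∈ Finset.range n, (Set.Iic (a k)).indicator φ (y i) * jumpWeight n y t i +
        ∑ i ∈ Finset.range n, (Set.Ioi (b k)).indicator φ (y i) * jumpWeight n y t i := by
      rw [← Finset.sum_sub_distrib, ← Finset.sum_add_distrib]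
      refine Finset.sum_congr rfl fun i _ => ?_
      have hab := he.le k k
      rcases le_or_gt (y i) (a k) with h1 | h1
      · simp [Set.indicator, h1, not_lt.mpr h1, not_lt.mpr (h1.trans hab), mul_comm]
      · rcases le_or_gt (y i) (b k) with h2 | h2
        · simp [Set.indicator, h1, h2, not_le.mpr h1, not_lt.mpr h2, mul_comm]
        · simp [Set.indicator, h2, not_le.mpr h1, not_le.mpr h2, mul_comm]
    have hL0 : 0 ≤ ∑ i ∈ Finset.range n, (Set.Iic (a k)).indicator φ (y i) * jumpWeight n y t i :=
      Finset.sum_nonneg fun i _ => mul_nonneg (Set.indicator_nonneg (fun _ _ => hφ _) _)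
        (jumpWeight_nonneg h.sample.le n i)
    have hR0 : 0 ≤ ∑ i ∈ Finset.range n, (Set.Ioi (b k)).indicator φ (y i) * jumpWeight n y t i :=
      Finset.sum_nonneg fun i _ => mul_nonneg (Set.indicator_nonneg (fun _ _ => hφ _) _)
        (jumpWeight_nonneg h.sample.le n i)
    have hL : ∑ i ∈ Finset.range n, (Set.Iic (a k)).indicator φ (y i) * jumpWeight n y t i ≤
        ε / 2 := by
      refine le_trans (Finset.sum_le_sum fun i _ => ?_) (hk1 n).le
      refine mul_le_mul ?_ (jumpWeight_le_inv_atRisk h.sample.le n i)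
        (jumpWeight_nonneg h.sample.le n i) ?_
      · exact Set.indicator_le_indicator (by linarith)
      · exact Set.indicator_nonneg (fun x _ => by linarith [hφ x]) _
    have hR : ∑ i ∈ Finset.range n, (Set.Ioi (b k)).indicator φ (y i) * jumpWeight n y t i ≤
        ε / 2 := by
      have h1 : ∑ i ∈ Finset.range n, (Set.Ioi (b k)).indicator φ (y i) * jumpWeight n y t i ≤
          (∑ i ∈ Finset.range n, (Set.Ioi (b k)).indicator φ (y i)) *
            (1 / atRisk n y t (a 0)) := by
        rw [Finset.sum_mul]
        refine Finset.sum_le_sum fun i hi => ?_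
        by_cases hyi : y i ∈ Set.Ioi (b k)
        · rw [Set.indicator_of_mem hyi]
          exact mul_le_mul_of_nonneg_left (jumpWeight_le_of_le h.sample (Finset.mem_range.mp hi)
            hrisk ((he.le 0 k).trans (le_of_lt hyi))) (hφ _)
        · rw [Set.indicator_of_notMem hyi, zero_mul, zero_mul]
      have hm0 : 0 ≤ (∑ i ∈ Finset.range n, (Set.Ioi (b k)).indicator φ (y i)) / n :=
        div_nonneg (Finset.sum_nonneg fun i _ => Set.indicator_nonneg (fun _ _ => hφ _) _) hn'.le
      calc _ ≤ _ := h1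
        _ = ((∑ i ∈ Finset.range n, (Set.Ioi (b k)).indicator φ (y i)) / n) *
            (1 / (atRisk n y t (a 0) / n)) := by field_simp
        _ ≤ (c * ε / 4) * (1 / (c / 2)) :=
            mul_le_mul hn1.le (one_div_le_one_div_of_le (by positivity) hn2.le)
              (one_div_nonneg.mpr (by linarith)) (by positivity)
        _ = ε / 2 := by field_simp; ring
    rw [hsplit, abs_of_nonneg (add_nonneg hL0 hR0)]
    linarith
  · rw [Real.dist_eq] at hk3
    exact hk3.le

end Path

/-! ### The strong law for Lynden-Bell integrals -/

section StrongLaw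

variable {μF μG : Measure ℝ} [IsProbabilityMeasure μF] [IsProbabilityMeasure μG]

/-- Every count involved is at least one, so extended and real reciprocals agree. -/
theorem hazardSum_eq_ofReal {ψ : ℝ → ℝ} (hψ : ∀ x, 0 ≤ ψ x) {z : ℕ → ℝ × ℝ}
    (hz : ∀ i, (z i).2 ≤ (z i).1) (n : ℕ) :
    hazardSum (fun x => ENNReal.ofReal (ψ x)) z (Finset.range n) =
      ENNReal.ofReal (∑ i ∈ Finset.range n, ψ (z i).1 *
        (1 / atRisk n (fun i => (z i).1) (fun i => (z i).2) (z i).1)) := by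
  rw [ENNReal.ofReal_sum_of_nonneg fun i _ =>
    mul_nonneg (hψ _) (one_div_nonneg.mpr (atRisk_nonneg _ _ _ _)), hazardSum]
  refine Finset.sum_congr rfl fun i hi => ?_
  have h1 := one_le_atRisk (y := fun i => (z i).1) (t := fun i => (z i).2)
    (Finset.mem_range.mp hi) (hz i)
  have h2 : riskCount z (Finset.range n) (z i).1 =
      ENNReal.ofReal (atRisk n (fun i => (z i).1) (fun i => (z i).2) (z i).1) := by
    rw [atRisk, ENNReal.ofReal_sum_of_nonneg fun i _ => by positivity, riskCount]
    refine Finset.sum_congr rfl fun j _ => ?_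
    split_ifs <;> simp
  rw [h2, ENNReal.ofReal_mul (hψ _), one_div, ENNReal.ofReal_inv_of_pos (by linarith)]

/-- All conditions except the left one and the absence of ties reduce to countably many strong laws;
the left one is the maximal inequality. -/
theorem ae_isGoodPath (hF : Continuous (cdf μF)) (hG : Continuous (cdf μG))
    (hα : truncProb μF μG ≠ 0) {φ : ℝ → ℝ} (hφm : Measurable φ) (hφ : ∀ x, 0 ≤ φ x)
    (hint : Integrable φ μF) {a b : ℕ → ℝ} (he : IsExhaustion μF μG a b) {p₀ : ℝ} (hp : 0 < p₀) :
    ∀ᵐ z ∂(Measure.infinitePi fun _ : ℕ => truncLaw μF μG),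
      IsGoodPath μF μG φ p₀ a b (fun i => (z i).1) (fun i => (z i).2) := by
  have := isProbabilityMeasure_truncLaw μF μG hα
  have hα' := truncProb_toReal_pos μF μG hα
  have hFm : Measurable (cdf μF) := hF.measurable
  have hGm : Measurable (cdf μG) := hG.measurable
  have hCm : Measurable (riskProb μF μG) := (continuous_riskProb hF hG).measurable
  set Q := Measure.infinitePi fun _ : ℕ => truncLaw μF μG
  have h_slln : ∀ {g : ℝ → ℝ}, Measurable g → Integrable g μF →
      ∀ᵐ z ∂Q, Tendsto (fun n : ℕ => (∑ i ∈ Finset.range n, g (z i).1) / n) atTop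
        (𝓝 (∫ y, cdf μG y / (truncProb μF μG).toReal * g y ∂μF)) := by
    intro g hg hgi
    rw [← integral_truncLaw μF μG hα hg]
    exact strong_law_infinitePi _ (h := fun p => g p.1) (hg.comp measurable_fst)
      (integrable_truncLaw μF μG hα hg hgi)
  have h_trunc : ∀ᵐ z ∂Q, ∀ q : ℚ, Tendsto (fun n : ℕ => (∑ i ∈ Finset.range n,
      (Set.Iic (q : ℝ)).indicator (fun _ => (1 : ℝ)) (z i).2) / n) atTop
      (𝓝 ((truncLaw μF μG).real {p | p.2 ≤ q})) := by
    rw [ae_all_iff]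
    intro q
    have hs : MeasurableSet {p : ℝ × ℝ | p.2 ≤ q} := measurableSet_le measurable_snd measurable_const
    have h1 := strong_law_infinitePi (truncLaw μF μG)
      (h := {p : ℝ × ℝ | p.2 ≤ q}.indicator fun _ => (1 : ℝ)) (measurable_const.indicator hs)
      ((integrable_const 1).indicator hs)
    rw [integral_indicator_const _ hs, smul_eq_mul, mul_one] at h1
    exact h1
  have h_obs : ∀ᵐ z ∂Q, ∀ q : ℚ, Tendsto (fun n : ℕ => (∑ i ∈ Finset.range n,
      (Set.Iio (q : ℝ)).indicator (fun _ => (1 : ℝ)) (z i).1) / n) atTop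
      (𝓝 ((truncLaw μF μG).real {p | p.1 < q})) := by
    rw [ae_all_iff]
    intro q
    have hs : MeasurableSet {p : ℝ × ℝ | p.1 < q} := measurableSet_lt measurable_fst measurable_const
    have h1 := strong_law_infinitePi (truncLaw μF μG)
      (h := {p : ℝ × ℝ | p.1 < q}.indicator fun _ => (1 : ℝ)) (measurable_const.indicator hs)
      ((integrable_const 1).indicator hs)
    rw [integral_indicator_const _ hs, smul_eq_mul, mul_one] at h1
    exact h1
  have h_haz : ∀ᵐ z ∂Q, ∀ (k : ℕ) (q : ℚ), cdf μF q < 1 →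
      Tendsto (fun n : ℕ => (∑ i ∈ Finset.range n,
        (Set.Ioo (a k) q).indicator (fun _ => (1 : ℝ)) (z i).1 * (1 / riskProb μF μG (z i).1)) / n)
        atTop (𝓝 (∫ x in Set.Ioo (a k) q, 1 / (1 - cdf μF x) ∂μF)) := by
    rw [ae_all_iff]; intro k
    rw [ae_all_iff]; intro q
    by_cases hq : cdf μF q < 1
    swap
    · exact Eventually.of_forall fun z h => absurd h hq
    have hgm : Measurable fun y => (Set.Ioo (a k) (q : ℝ)).indicator (fun _ => (1 : ℝ)) y *
        (1 / riskProb μF μG y) :=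
      (measurable_const.indicator measurableSet_Ioo).mul (measurable_const.div hCm)
    have hGa := (he.left_mem k).1
    have hgi : Integrable (fun y => (Set.Ioo (a k) (q : ℝ)).indicator (fun _ => (1 : ℝ)) y *
        (1 / riskProb μF μG y)) μF := by
      refine Integrable.of_bound hgm.aestronglyMeasurable
        (1 / (cdf μG (a k) * (1 - cdf μF q) / (truncProb μF μG).toReal)) (ae_of_all _ fun y => ?_)
      have hpos : 0 < cdf μG (a k) * (1 - cdf μF q) / (truncProb μF μG).toReal :=
        div_pos (mul_pos hGa (by linarith)) hα'
      by_cases hy : y ∈ Set.Ioo (a k) (q : ℝ)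
      · have h1 : cdf μG (a k) * (1 - cdf μF q) / (truncProb μF μG).toReal ≤ riskProb μF μG y := by
          refine div_le_div_of_nonneg_right (mul_le_mul (monotone_cdf μG hy.1.le) ?_ (by linarith)
            (cdf_nonneg μG y)) hα'.le
          linarith [monotone_cdf μF hy.2.le]
        rw [Set.indicator_of_mem hy, one_mul, Real.norm_eq_abs,
          abs_of_nonneg (one_div_nonneg.mpr (hpos.le.trans h1))]
        exact one_div_le_one_div_of_le hpos h1
      · rw [Set.indicator_of_notMem hy, zero_mul, norm_zero]
        exact one_div_nonneg.mpr hpos.le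
    -- The density G/α times 1/C is the hazard density 1/(1 - F).
    have hval : ∫ y, cdf μG y / (truncProb μF μG).toReal *
        ((Set.Ioo (a k) (q : ℝ)).indicator (fun _ => (1 : ℝ)) y * (1 / riskProb μF μG y)) ∂μF =
        ∫ x in Set.Ioo (a k) (q : ℝ), 1 / (1 - cdf μF x) ∂μF := by
      rw [← integral_indicator measurableSet_Ioo]
      refine integral_congr_ae (ae_of_all _ fun y => ?_)
      by_cases hy : y ∈ Set.Ioo (a k) (q : ℝ)
      · have h1 : 0 < cdf μG y := hGa.trans_le (monotone_cdf μG hy.1.le)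
        have h2 : 0 < 1 - cdf μF y := by linarith [monotone_cdf μF hy.2.le]
        simp only [Set.indicator_of_mem hy, riskProb]
        field_simp
      · simp [Set.indicator_of_notMem hy]
    have h1 := h_slln hgm hgi
    rw [hval] at h1
    filter_upwards [h1] with z hz _ using hz
  have h_left : ∀ᵐ z ∂Q, ∀ ε : ℝ, 0 < ε → ∃ k, ∀ n,
      ∑ i ∈ Finset.range n, (Set.Iic (a k)).indicator (fun x => φ x + 1) (z i).1 *
        (1 / atRisk n (fun i => (z i).1) (fun i => (z i).2) (z i).1) < ε := by
    have hψ : Measurable fun x => ENNReal.ofReal (φ x + 1) := (hφm.add_const 1).ennreal_ofReal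
    have hψi : ∫⁻ y, ENNReal.ofReal (φ y + 1) ∂μF ≠ ⊤ :=
      (hint.add (integrable_const 1)).lintegral_lt_top.ne
    filter_upwards [ae_exists_hazardSum_lt μF μG hF hα hψ hψi he.anti (he.left_mem 0).2 he.left_lt,
      ae_forall_infinitePi (ae_truncLaw_le μF μG)] with z hz hz2 ε hε
    obtain ⟨k, hk⟩ := hz ε hε
    refine ⟨k, fun n => ?_⟩
    have h1 := hk n
    have h2 : (Set.Iic (a k)).indicator (fun x => ENNReal.ofReal (φ x + 1)) =
        fun x => ENNReal.ofReal ((Set.Iic (a k)).indicator (fun x => φ x + 1) x) := by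
      ext x
      by_cases hx : x ∈ Set.Iic (a k)
      · simp only [Set.indicator_of_mem hx]
      · simp only [Set.indicator_of_notMem hx, ENNReal.ofReal_zero]
    rw [h2, hazardSum_eq_ofReal (fun x => Set.indicator_nonneg
      (fun x _ => add_nonneg (hφ x) zero_le_one) x) hz2, ENNReal.ofReal_lt_ofReal_iff hε] at h1
    exact h1
  have h_mid : ∀ᵐ z ∂Q, ∀ k l : ℕ, ∃ m : ℝ, Tendsto (fun n : ℕ => (∑ i ∈ Finset.range n,
      (Set.Ioc (a k) (b l)).indicator φ (z i).1) / n) atTop (𝓝 m) := by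
    rw [ae_all_iff]; intro k
    rw [ae_all_iff]; intro l
    filter_upwards [h_slln (hφm.indicator measurableSet_Ioc)
      (hint.indicator (measurableSet_Ioc (a := a k) (b := b l)))] with z hz using ⟨_, hz⟩
  have h_midw : ∀ᵐ z ∂Q, ∀ k l : ℕ, Tendsto (fun n : ℕ => (∑ i ∈ Finset.range n,
      (Set.Ioc (a k) (b l)).indicator φ (z i).1 *
        ((1 - cdf μF (z i).1) / p₀ / riskProb μF μG (z i).1)) / n) atTop
      (𝓝 (∫ x in Set.Ioc (a k) (b l), φ x / p₀ ∂μF)) := by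
    rw [ae_all_iff]; intro k
    rw [ae_all_iff]; intro l
    have hgm : Measurable fun y => (Set.Ioc (a k) (b l)).indicator φ y *
        ((1 - cdf μF y) / p₀ / riskProb μF μG y) :=
      (hφm.indicator measurableSet_Ioc).mul (((measurable_const.sub hFm).div_const _).div hCm)
    have hGa := (he.left_mem k).1
    -- The factor 1 - F cancels. What remains besides φ is α/(p₀ G), bounded to the right of `a k`.
    have hform : ∀ y, (Set.Ioc (a k) (b l)).indicator φ y *
        ((1 - cdf μF y) / p₀ / riskProb μF μG y) = (Set.Ioc (a k) (b l)).indicator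
          (fun y => φ y * ((truncProb μF μG).toReal / (p₀ * cdf μG y))) y := by
      intro y
      by_cases hy : y ∈ Set.Ioc (a k) (b l)
      · have h1 : 0 < cdf μG y := hGa.trans_le (monotone_cdf μG hy.1.le)
        have h2 : 0 < 1 - cdf μF y := by
          linarith [monotone_cdf μF hy.2, (he.right_mem l).2]
        simp only [Set.indicator_of_mem hy, riskProb]
        field_simp
      · simp [Set.indicator_of_notMem hy]
    have hgi : Integrable (fun y => (Set.Ioc (a k) (b l)).indicator φ y *
        ((1 - cdf μF y) / p₀ / riskProb μF μG y)) μF := by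
      refine Integrable.mono' (hint.mul_const ((truncProb μF μG).toReal / (p₀ * cdf μG (a k))))
        hgm.aestronglyMeasurable (ae_of_all _ fun y => ?_)
      have hb0 : 0 ≤ (truncProb μF μG).toReal / (p₀ * cdf μG (a k)) := by positivity
      rw [hform y]
      by_cases hy : y ∈ Set.Ioc (a k) (b l)
      · have h1 : cdf μG (a k) ≤ cdf μG y := monotone_cdf μG hy.1.le
        have h2 : 0 < cdf μG y := hGa.trans_le h1
        rw [Set.indicator_of_mem hy, Real.norm_eq_abs, abs_of_nonneg (mul_nonneg (hφ y) (by positivity))]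
        refine mul_le_mul_of_nonneg_left ?_ (hφ y)
        exact div_le_div_of_nonneg_left hα'.le (by positivity) (mul_le_mul_of_nonneg_left h1 hp.le)
      · rw [Set.indicator_of_notMem hy, norm_zero]
        exact mul_nonneg (hφ y) hb0
    have hval : ∫ y, cdf μG y / (truncProb μF μG).toReal * ((Set.Ioc (a k) (b l)).indicator φ y *
        ((1 - cdf μF y) / p₀ / riskProb μF μG y)) ∂μF =
        ∫ x in Set.Ioc (a k) (b l), φ x / p₀ ∂μF := by
      rw [← integral_indicator measurableSet_Ioc]
      refine integral_congr_ae (ae_of_all _ fun y => ?_)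
      simp only [hform y]
      by_cases hy : y ∈ Set.Ioc (a k) (b l)
      · have h1 : 0 < cdf μG y := hGa.trans_le (monotone_cdf μG hy.1.le)
        simp only [Set.indicator_of_mem hy]
        field_simp
      · simp [Set.indicator_of_notMem hy]
    have h1 := h_slln hgm hgi
    rwa [hval] at h1
  have h_right : ∀ᵐ z ∂Q, ∀ ε : ℝ, 0 < ε → ∃ l, ∀ᶠ n : ℕ in atTop,
      (∑ i ∈ Finset.range n, (Set.Ioi (b l)).indicator φ (z i).1) / n < ε := by
    have hall : ∀ᵐ z ∂Q, ∀ l, Tendsto (fun n : ℕ => (∑ i ∈ Finset.range n,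
        (Set.Ioi (b l)).indicator φ (z i).1) / n) atTop
        (𝓝 (∫ y, cdf μG y / (truncProb μF μG).toReal * (Set.Ioi (b l)).indicator φ y ∂μF)) := by
      rw [ae_all_iff]; intro l
      exact h_slln (hφm.indicator measurableSet_Ioi) (hint.indicator measurableSet_Ioi)
    have hzero : Tendsto (fun l => ∫ y, cdf μG y / (truncProb μF μG).toReal *
        (Set.Ioi (b l)).indicator φ y ∂μF) atTop (𝓝 0) := by
      have hfi : Integrable (fun y => cdf μG y / (truncProb μF μG).toReal * φ y) μF := by
        refine Integrable.mono' (hint.const_mul (1 / (truncProb μF μG).toReal))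
          ((hGm.div_const _).mul hφm).aestronglyMeasurable (ae_of_all _ fun y => ?_)
        rw [Real.norm_eq_abs, abs_of_nonneg (mul_nonneg
          (div_nonneg (cdf_nonneg μG y) hα'.le) (hφ y))]
        exact mul_le_mul_of_nonneg_right
          (div_le_div_of_nonneg_right (cdf_le_one μG y) hα'.le) (hφ y)
      have h1 := tendsto_setIntegral_of_antitone (μ := μF)
        (f := fun y => cdf μG y / (truncProb μF μG).toReal * φ y) (s := fun l => Set.Ioi (b l))
        (fun l => measurableSet_Ioi) (fun l m hlm => Set.Ioi_subset_Ioi (he.mono hlm))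
        ⟨0, hfi.integrableOn⟩
      -- A point beyond every `b l` has F = 1, and this level set is null.
      have hnull : μF (⋂ l, Set.Ioi (b l)) = 0 := by
        refine measure_mono_null (fun x hx => ?_) (measure_preimage_cdf_singleton μF hF 1)
        by_contra hne
        obtain ⟨l, hl⟩ := he.lt_right x (lt_of_le_of_ne (cdf_le_one μF x) hne)
        exact absurd (Set.mem_iInter.mp hx l) (not_lt.mpr hl.le)
      rw [setIntegral_measure_zero _ hnull] at h1
      refine h1.congr fun l => ?_
      rw [← integral_indicator measurableSet_Ioi]
      refine integral_congr_ae (ae_of_all _ fun y => ?_)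
      by_cases hy : y ∈ Set.Ioi (b l)
      · simp only [Set.indicator_of_mem hy]
      · simp only [Set.indicator_of_notMem hy, mul_zero]
    filter_upwards [hall] with z hz ε hε
    obtain ⟨l, hl⟩ := (hzero.eventually (gt_mem_nhds hε)).exists
    exact ⟨l, (hz l).eventually (gt_mem_nhds hl)⟩
  filter_upwards [ae_isTruncSample μF μG hF hα, h_trunc, h_obs, h_haz, h_left, h_mid, h_midw,
    h_right] with z g1 g2 g3 g4 g5 g6 g7 g8
  exact ⟨g1, g2, g3, g4, g5, g6, g7, g8⟩

omit [IsProbabilityMeasure μG] in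
-- The identifiable part and the strong law for one function
/-- The identifiable part of the lifetime law lives on the set where `G` is positive. -/
theorem identSet_ae_eq (hF : Continuous (cdf μF)) :
    {x : ℝ | lowerBdry μG ≤ (x : EReal)} =ᵐ[μF] {x | 0 < cdf μG x} := by
  have hnF := nullSingleton_of_continuous_cdf μF hF
  -- The two sets can differ only at the boundary point, which has no mass since F is continuous.
  have hnull : μF {x : ℝ | (x : EReal) = lowerBdry μG} = 0 := by
    refine Set.Subsingleton.measure_zero (fun x hx x' hx' => ?_) _
    exact EReal.coe_injective ((show (x : EReal) = _ from hx).trans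
      (show (x' : EReal) = _ from hx').symm)
  rw [eventuallyEq_set]
  filter_upwards [measure_eq_zero_iff_ae_notMem.mp hnull] with x hx
  constructor
  · intro h
    by_contra hle
    refine hx (le_antisymm ?_ h)
    refine le_sInf ?_
    rintro _ ⟨x', hx', rfl⟩
    refine EReal.coe_le_coe_iff.mpr ?_
    by_contra hlt
    exact hle (lt_of_lt_of_le (show 0 < cdf μG x' from hx') (monotone_cdf μG (not_le.mp hlt).le))
  · intro h
    exact sInf_le ⟨x, h, rfl⟩

omit [IsProbabilityMeasure μG] in
theorem integral_identLaw (hF : Continuous (cdf μF)) (f : ℝ → ℝ) :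
    ∫ x, f x ∂(identLaw μF μG) =
      (μF.real {x | 0 < cdf μG x})⁻¹ * ∫ x in {x | 0 < cdf μG x}, f x ∂μF := by
  rw [identLaw, ProbabilityTheory.cond, integral_smul_measure,
    setIntegral_congr_set (identSet_ae_eq hF), measure_congr (identSet_ae_eq hF), smul_eq_mul,
    ENNReal.toReal_inv]
  rfl

omit [IsProbabilityMeasure μF] [IsProbabilityMeasure μG] in
theorem identLaw_absolutelyContinuous : identLaw μF μG ≪ μF := cond_absolutelyContinuous

omit [IsProbabilityMeasure μG] in
-- F-almost every `x` has F(x) > 0, hence lies above the lower boundary of F and so above that of G: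
-- the conditioning event has full measure.
theorem identLaw_eq_self (hF : Continuous (cdf μF)) (h : lowerBdry μG ≤ lowerBdry μF) :
    identLaw μF μG = μF := by
  have hae : ∀ᵐ x ∂μF, x ∈ {x : ℝ | lowerBdry μG ≤ (x : EReal)} := by
    filter_upwards [measure_eq_zero_iff_ae_notMem.mp (measure_preimage_cdf_singleton μF hF 0)]
      with x hx
    exact h.trans (sInf_le ⟨x, lt_of_le_of_ne (cdf_nonneg μF x) (Ne.symm hx), rfl⟩)
  rw [identLaw, ProbabilityTheory.cond, Measure.restrict_eq_self_of_ae_mem hae,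
    (mem_ae_iff_prob_eq_one₀ (measurableSet_le measurable_const
      measurable_coe_real_ereal).nullMeasurableSet).mp hae, inv_one, one_smul]

omit [IsProbabilityMeasure μG] in
theorem integrable_identLaw (hp : 0 < μF.real {x | 0 < cdf μG x}) (hF : Continuous (cdf μF))
    {f : ℝ → ℝ} (hf : Integrable f μF) : Integrable f (identLaw μF μG) := by
  rw [identLaw, ProbabilityTheory.cond]
  refine hf.restrict.smul_measure (ENNReal.inv_ne_top.mpr ?_)
  rw [measure_congr (identSet_ae_eq hF)]
  exact fun h0 => hp.ne' (by rw [Measure.real, h0, ENNReal.toReal_zero])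

/-- The strong law under random truncation. -/
theorem ae_tendsto_sum_jumpWeight (hF : Continuous (cdf μF)) (hG : Continuous (cdf μG))
    (hne : (obsRange μF μG).Nonempty) {φ : ℝ → ℝ} (hφm : Measurable φ) (hint : Integrable φ μF) :
    ∀ᵐ z ∂(Measure.infinitePi fun _ : ℕ => truncLaw μF μG),
      Tendsto (fun n => ∑ i ∈ Finset.range n,
        jumpWeight n (fun i => (z i).1) (fun i => (z i).2) i * φ (z i).1) atTop
        (𝓝 (∫ x, φ x ∂(identLaw μF μG))) := by
  have hα := truncProb_ne_zero μF μG hF hne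
  obtain ⟨a, b, h1, h2, h3, h4, h5, h6, h7⟩ := exists_seq_obsRange hF hG hne
  have he : IsExhaustion μF μG a b := ⟨h1, h2, h3, h4, h5, h6, h7⟩
  have hp := measureReal_cdf_pos (h3 0)
  have key : ∀ {g : ℝ → ℝ}, Measurable g → (∀ x, 0 ≤ g x) → Integrable g μF →
      ∀ᵐ z ∂(Measure.infinitePi fun _ : ℕ => truncLaw μF μG),
      Tendsto (fun n => ∑ i ∈ Finset.range n,
        jumpWeight n (fun i => (z i).1) (fun i => (z i).2) i * g (z i).1) atTop
        (𝓝 (∫ x, g x ∂(identLaw μF μG))) := by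
    intro g hgm hg hgi
    filter_upwards [ae_isGoodPath hF hG hα hgm hg hgi he hp] with z hz
    have h8 := hz.tendsto_sum_jumpWeight hF hG hα hg hgi he
    rwa [integral_div, div_eq_inv_mul, ← integral_identLaw hF] at h8
  have hpos : Measurable fun x => max (φ x) 0 := hφm.max measurable_const
  have hneg : Measurable fun x => max (-φ x) 0 := hφm.neg.max measurable_const
  filter_upwards [key hpos (fun x => le_max_right _ _) hint.pos_part,
    key hneg (fun x => le_max_right _ _) hint.neg_part] with z hz1 hz2
  have h8 := hz1.sub hz2
  have hsplit : ∀ r : ℝ, max r 0 - max (-r) 0 = r := fun r => by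
    rcases le_total r 0 with h | h
    · rw [max_eq_right h, max_eq_left (by linarith)]; ring
    · rw [max_eq_left h, max_eq_right (by linarith)]; ring
  rw [← integral_sub (integrable_identLaw hp hF hint.pos_part)
    (integrable_identLaw hp hF hint.neg_part)] at h8
  simp only [← Finset.sum_sub_distrib, ← mul_sub, hsplit] at h8
  exact h8

end StrongLaw

/-! ### Measurable covers and outer almost sure convergence -/

/-- Every map into `[0, ∞]` has a measurable cover function. -/
theorem exists_isMeasurableCover {Ω : Type*} [MeasurableSpace Ω] (P : Measure Ω) [IsFiniteMeasure P]
    (D : Ω → ℝ≥0∞) : ∃ D', IsMeasurableCover P D D' := by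
  -- The cover is the supremum over rationals `q` of `q` on a measurable hull of {D > q}.
  set A : ℚ → Set Ω := fun q => toMeasurable P {ω | ENNReal.ofReal q < D ω} with hA
  have hAm : ∀ q, MeasurableSet (A q) := fun q => measurableSet_toMeasurable _ _
  refine ⟨fun ω => ⨆ q : ℚ, (A q).indicator (fun _ => ENNReal.ofReal q) ω, ?_, ?_, ?_⟩
  · exact Measurable.iSup fun q => measurable_const.indicator (hAm q)
  · intro ω
    refine le_of_forall_lt fun c hc => ?_
    obtain ⟨q, hq0, hq1, hq2⟩ := ENNReal.lt_iff_exists_rat_btwn.mp hc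
    refine lt_of_lt_of_le hq1 (le_trans ?_ (le_iSup _ q))
    rw [Set.indicator_of_mem (subset_toMeasurable P _ hq2)]
    exact le_rfl
  · intro U hU hDU
    have hq : ∀ q : ℚ, ∀ᵐ ω ∂P, ω ∈ A q → ENNReal.ofReal q < U ω := by
      intro q
      have hs : MeasurableSet {ω | U ω ≤ ENNReal.ofReal q} := measurableSet_le hU measurable_const
      -- A hull has the same measure as its set inside every measurable set, so it meets {U ≤ q} in
      -- a null set, as {D > q} does.
      have h1 := Measure.measure_toMeasurable_inter hs
        (measure_ne_top P {ω | ENNReal.ofReal q < D ω})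
      have h2 : P ({ω | ENNReal.ofReal q < D ω} ∩ {ω | U ω ≤ ENNReal.ofReal q}) = 0 := by
        refine measure_mono_null ?_ (ae_iff.mp hDU)
        rintro ω ⟨h3, h4⟩ h5
        exact absurd (lt_of_lt_of_le h3 (h5.trans h4)) (lt_irrefl _)
      rw [h2] at h1
      filter_upwards [measure_eq_zero_iff_ae_notMem.mp h1] with ω hω hωA
      by_contra hlt
      exact hω ⟨hωA, not_lt.mp hlt⟩
    filter_upwards [ae_all_iff.mpr hq] with ω hω
    refine iSup_le fun q => ?_
    by_cases h : ω ∈ A q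
    · rw [Set.indicator_of_mem h]; exact (hω q h).le
    · rw [Set.indicator_of_notMem h]; exact bot_le

/-- By minimality a cover is almost surely below any measurable majorant. The majorants may depend
on ε, since countably many ε suffice. -/
theorem tendstoZeroOuterAS_of_majorants {Ω : Type*} [MeasurableSpace Ω] (P : Measure Ω)
    [IsFiniteMeasure P] {D : ℕ → Ω → ℝ≥0∞}
    (h : ∀ ε : ℝ, 0 < ε → ∃ V : ℕ → Ω → ℝ≥0∞, (∀ n, Measurable (V n)) ∧
      (∀ n, ∀ᵐ ω ∂P, D n ω ≤ V n ω) ∧ ∀ᵐ ω ∂P, ∀ᶠ n in atTop, V n ω ≤ ENNReal.ofReal ε) :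
    TendstoZeroOuterAS P D := by
  choose D' hD' using fun n => exists_isMeasurableCover P (D n)
  refine ⟨D', hD', ?_⟩
  have hm : ∀ m : ℕ, ∀ᵐ ω ∂P, ∀ᶠ n in atTop, D' n ω ≤ ENNReal.ofReal (1 / ((m : ℝ) + 1)) := by
    intro m
    obtain ⟨V, hV1, hV2, hV3⟩ := h (1 / ((m : ℝ) + 1)) (by positivity)
    filter_upwards [ae_all_iff.mpr fun n => (hD' n).minimal (V n) (hV1 n) (hV2 n), hV3]
      with ω h1 h2
    filter_upwards [h2] with n hn using (h1 n).trans hn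
  filter_upwards [ae_all_iff.mpr hm] with ω hω
  refine ENNReal.tendsto_nhds_zero.mpr fun ε hε => ?_
  have hlim : Tendsto (fun m : ℕ => ENNReal.ofReal (1 / ((m : ℝ) + 1))) atTop (𝓝 0) := by
    rw [← ENNReal.ofReal_zero]
    exact ENNReal.tendsto_ofReal tendsto_one_div_add_atTop_nhds_zero_nat
  obtain ⟨m, hm⟩ := (hlim.eventually (gt_mem_nhds hε)).exists
  filter_upwards [hω m] with n hn using hn.trans hm.le

/-! ### The uniform strong law -/

theorem measurable_atRisk (n : ℕ) {f : (ℕ → ℝ × ℝ) → ℝ} (hf : Measurable f) :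
    Measurable fun z : ℕ → ℝ × ℝ => atRisk n (fun i => (z i).1) (fun i => (z i).2) (f z) := by
  unfold atRisk
  refine Finset.measurable_sum _ fun j _ => Measurable.ite ?_ measurable_const measurable_const
  exact (measurableSet_le (by fun_prop) hf).inter (measurableSet_le hf (by fun_prop))

theorem measurable_jumpWeight (n i : ℕ) :
    Measurable fun z : ℕ → ℝ × ℝ => jumpWeight n (fun i => (z i).1) (fun i => (z i).2) i := by
  unfold jumpWeight survivalBelow
  have hN : ∀ j, Measurable fun z : ℕ → ℝ × ℝ =>
      atRisk n (fun i => (z i).1) (fun i => (z i).2) (z j).1 :=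
    fun j => measurable_atRisk n (by fun_prop)
  refine Measurable.div ?_ (hN i)
  simp only [Finset.prod_filter]
  refine Finset.measurable_prod _ fun j _ => Measurable.ite ?_ ?_ measurable_const
  · exact measurableSet_lt (by fun_prop) (by fun_prop)
  · exact measurable_const.sub (measurable_const.div (hN j))

theorem exists_brackets {ε : ℝ} {𝓕 : Set (ℝ → ℝ)} {p : ℝ≥0∞} {μ : Measure ℝ}
    (h : bracketingNumber ε 𝓕 p μ < ⊤) : ∃ (k : ℕ) (l u : Fin k → ℝ → ℝ),
      (∀ j, MemLp (l j) p μ ∧ MemLp (u j) p μ ∧ eLpNorm (u j - l j) p μ < ENNReal.ofReal ε) ∧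
      ∀ φ ∈ 𝓕, ∃ j, ∀ x, l j x ≤ φ x ∧ φ x ≤ u j x := by
  unfold bracketingNumber at h
  simp only [iInf_lt_iff] at h
  obtain ⟨k, ⟨l, u, h1, h2⟩, -⟩ := h
  exact ⟨k, l, u, h1, h2⟩

section Uniform

variable {μF μG : Measure ℝ} [IsProbabilityMeasure μF] [IsProbabilityMeasure μG]

/-- The observed lifetime law is absolutely continuous with respect to F, so changing a bracket end
on an F-null set is invisible in the sample. -/
theorem ae_obs_of_ae (hα : truncProb μF μG ≠ 0) {p : ℝ → Prop}
    (hp : ∀ᵐ x ∂μF, p x) :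
    ∀ᵐ z ∂(Measure.infinitePi fun _ : ℕ => truncLaw μF μG), ∀ i, p (z i).1 := by
  have := isProbabilityMeasure_truncLaw μF μG hα
  have h1 : ∀ᵐ x ∂(obsLaw μF μG), p x := (obsLaw_absolutelyContinuous μF μG).ae_le hp
  exact ae_forall_infinitePi (ae_of_ae_map measurable_fst.aemeasurable h1)

/-- Measurable majorants of the uniform deviation. -/
theorem exists_majorant_supDev (hF : Continuous (cdf μF)) (hG : Continuous (cdf μG))
    (hne : (obsRange μF μG).Nonempty) {𝓕 : Set (ℝ → ℝ)} (h𝓕 : ∀ φ ∈ 𝓕, Integrable φ μF)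
    (hbr : ∀ ε : ℝ, 0 < ε → bracketingNumber ε 𝓕 1 μF < ⊤) {ε : ℝ} (hε : 0 < ε) :
    ∃ V : ℕ → (ℕ → ℝ × ℝ) → ℝ≥0∞, (∀ n, Measurable (V n)) ∧
      (∀ n, ∀ᵐ z ∂(Measure.infinitePi fun _ : ℕ => truncLaw μF μG),
        supDev 𝓕 (lyndenBellMeasure n (fun i => (z i).1) (fun i => (z i).2)) (identLaw μF μG)
          ≤ V n z) ∧
      ∀ᵐ z ∂(Measure.infinitePi fun _ : ℕ => truncLaw μF μG), ∀ᶠ n in atTop,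
        V n z ≤ ENNReal.ofReal ε := by
  have hα := truncProb_ne_zero μF μG hF hne
  obtain ⟨x₀, hx₀⟩ := hne
  have hp := measureReal_cdf_pos hx₀
  set p₀ := μF.real {x | 0 < cdf μG x} with hp₀
  set μ₀ := identLaw μF μG with hμ₀
  set Q := Measure.infinitePi fun _ : ℕ => truncLaw μF μG
  -- The identifiable law is F restricted and divided by p₀, so brackets of F-size p₀ε/2 have width
  -- at most ε/2 under it.
  obtain ⟨k, l, u, hlu, hcov⟩ := exists_brackets (hbr (p₀ * ε / 2) (by positivity))
  have hli : ∀ j, Integrable (l j) μF := fun j => memLp_one_iff_integrable.mp (hlu j).1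
  have hui : ∀ j, Integrable (u j) μF := fun j => memLp_one_iff_integrable.mp (hlu j).2.1
  -- Bracket ends are only almost everywhere measurable; measurable versions are needed for a
  -- measurable majorant.
  set l' : Fin k → ℝ → ℝ := fun j => (hli j).aestronglyMeasurable.mk (l j) with hl'
  set u' : Fin k → ℝ → ℝ := fun j => (hui j).aestronglyMeasurable.mk (u j) with hu'
  have hl'm : ∀ j, Measurable (l' j) := fun j =>
    (hli j).aestronglyMeasurable.stronglyMeasurable_mk.measurable
  have hu'm : ∀ j, Measurable (u' j) := fun j =>
    (hui j).aestronglyMeasurable.stronglyMeasurable_mk.measurable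
  have hl'e : ∀ j, l j =ᵐ[μF] l' j := fun j => (hli j).aestronglyMeasurable.ae_eq_mk
  have hu'e : ∀ j, u j =ᵐ[μF] u' j := fun j => (hui j).aestronglyMeasurable.ae_eq_mk
  set dev : ℕ → (ℝ → ℝ) → (ℕ → ℝ × ℝ) → ℝ := fun n g z =>
    |∑ i ∈ Finset.range n, jumpWeight n (fun i => (z i).1) (fun i => (z i).2) i * g (z i).1 -
      ∫ x, g x ∂μ₀| with hdev
  have hdevm : ∀ n g, Measurable g → Measurable (dev n g) := by
    intro n g hg
    have h1 : Measurable fun z : ℕ → ℝ × ℝ => ∑ i ∈ Finset.range n,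
        jumpWeight n (fun i => (z i).1) (fun i => (z i).2) i * g (z i).1 :=
      Finset.measurable_sum _ fun i _ => (measurable_jumpWeight n i).mul (hg.comp (by fun_prop))
    exact continuous_abs.measurable.comp (h1.sub measurable_const)
  have hgap : ∀ j, ∫ x, (u j x - l j x) ∂μ₀ ≤ ε / 2 := by
    intro j
    have h1 : ∫ x, |u j x - l j x| ∂μF ≤ p₀ * ε / 2 := by
      have h2 := (hlu j).2.2
      rw [eLpNorm_one_eq_lintegral_enorm] at h2
      have h3 := ((hui j).sub (hli j))
      have h4 : ∫ x, ‖(u j - l j) x‖ ∂μF = (∫⁻ x, ‖(u j - l j) x‖ₑ ∂μF).toReal :=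
        integral_norm_eq_lintegral_enorm h3.aestronglyMeasurable
      have h5 : (∫⁻ x, ‖(u j - l j) x‖ₑ ∂μF).toReal ≤ p₀ * ε / 2 :=
        ENNReal.toReal_le_of_le_ofReal (by positivity) h2.le
      rw [← h4] at h5
      exact h5
    rw [hμ₀, integral_identLaw hF]
    have h2 : ∫ x in {x | 0 < cdf μG x}, (u j x - l j x) ∂μF ≤ ∫ x, |u j x - l j x| ∂μF :=
      (integral_mono ((hui j).sub (hli j)).integrableOn ((hui j).sub (hli j)).abs.integrableOn
        fun x => le_abs_self _).trans
        (setIntegral_le_integral ((hui j).sub (hli j)).abs (ae_of_all _ fun x => abs_nonneg _))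
    calc _ ≤ p₀⁻¹ * (p₀ * ε / 2) :=
          mul_le_mul_of_nonneg_left (h2.trans h1) (inv_nonneg.mpr hp.le)
      _ = ε / 2 := by field_simp
  refine ⟨fun n z => ENNReal.ofReal (∑ j, (dev n (l' j) z + dev n (u' j) z) + ε / 2), ?_, ?_, ?_⟩
  · intro n
    refine Measurable.ennreal_ofReal (Measurable.add_const ?_ _)
    exact Finset.measurable_sum _ fun j _ => (hdevm n _ (hl'm j)).add (hdevm n _ (hu'm j))
  · intro n
    have hle : ∀ᵐ z ∂Q, ∀ j i, l j (z i).1 = l' j (z i).1 :=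
      ae_all_iff.mpr fun j => ae_obs_of_ae hα (hl'e j)
    have hue : ∀ᵐ z ∂Q, ∀ j i, u j (z i).1 = u' j (z i).1 :=
      ae_all_iff.mpr fun j => ae_obs_of_ae hα (hu'e j)
    filter_upwards [ae_isTruncSample μF μG hF hα, hle, hue] with z hz hzl hzu
    -- Nonnegative weights preserve the bracket inequalities, so the deviation of `φ` is at most
    -- that of a bracket end plus the width of the bracket.
    refine iSup₂_le fun φ hφ => ENNReal.ofReal_le_ofReal ?_
    obtain ⟨j, hj⟩ := hcov φ hφ
    have hw := fun i => jumpWeight_nonneg hz.le n i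
    rw [integral_lyndenBellMeasure hz]
    have hint := fun {f : ℝ → ℝ} (hf : Integrable f μF) => integrable_identLaw (μG := μG) hp hF hf
    have hφi := hint (h𝓕 φ hφ)
    have e1 : ∑ i ∈ Finset.range n, jumpWeight n (fun i => (z i).1) (fun i => (z i).2) i *
        φ (z i).1 ≤ ∑ i ∈ Finset.range n, jumpWeight n (fun i => (z i).1) (fun i => (z i).2) i *
        u' j (z i).1 :=
      Finset.sum_le_sum fun i _ => mul_le_mul_of_nonneg_left (by rw [← hzu]; exact (hj _).2) (hw i)
    have e2 : ∑ i ∈ Finset.range n, jumpWeight n (fun i => (z i).1) (fun i => (z i).2) i *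
        l' j (z i).1 ≤ ∑ i ∈ Finset.range n, jumpWeight n (fun i => (z i).1) (fun i => (z i).2) i *
        φ (z i).1 :=
      Finset.sum_le_sum fun i _ => mul_le_mul_of_nonneg_left (by rw [← hzl]; exact (hj _).1) (hw i)
    have e3 : ∫ x, u' j x ∂μ₀ = ∫ x, u j x ∂μ₀ :=
      integral_congr_ae (identLaw_absolutelyContinuous.ae_le (hu'e j).symm)
    have e4 : ∫ x, l' j x ∂μ₀ = ∫ x, l j x ∂μ₀ :=
      integral_congr_ae (identLaw_absolutelyContinuous.ae_le (hl'e j).symm)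
    have e5 : ∫ x, φ x ∂μ₀ ≤ ∫ x, u j x ∂μ₀ := integral_mono hφi (hint (hui j)) fun x => (hj x).2
    have e6 : ∫ x, l j x ∂μ₀ ≤ ∫ x, φ x ∂μ₀ := integral_mono (hint (hli j)) hφi fun x => (hj x).1
    have e7 := hgap j
    rw [integral_sub (hint (hui j)) (hint (hli j))] at e7
    have e8 : dev n (l' j) z + dev n (u' j) z ≤ ∑ j, (dev n (l' j) z + dev n (u' j) z) :=
      Finset.single_le_sum (f := fun j => dev n (l' j) z + dev n (u' j) z)
        (fun j _ => add_nonneg (abs_nonneg _) (abs_nonneg _)) (Finset.mem_univ j)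
    have e9 : 0 ≤ dev n (l' j) z := abs_nonneg _
    have e10 : 0 ≤ dev n (u' j) z := abs_nonneg _
    have e11 := (abs_le.mp (le_refl (dev n (l' j) z))).1
    have e12 := (abs_le.mp (le_refl (dev n (u' j) z))).2
    rw [abs_le]
    constructor <;> linarith
  · have hl0 : ∀ᵐ z ∂Q, ∀ j, Tendsto (fun n => dev n (l' j) z) atTop (𝓝 0) := by
      refine ae_all_iff.mpr fun j => ?_
      filter_upwards [ae_tendsto_sum_jumpWeight hF hG ⟨x₀, hx₀⟩ (hl'm j)
        ((hli j).congr (hl'e j))] with z hz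
      exact tendsto_iff_norm_sub_tendsto_zero.mp hz
    have hu0 : ∀ᵐ z ∂Q, ∀ j, Tendsto (fun n => dev n (u' j) z) atTop (𝓝 0) := by
      refine ae_all_iff.mpr fun j => ?_
      filter_upwards [ae_tendsto_sum_jumpWeight hF hG ⟨x₀, hx₀⟩ (hu'm j)
        ((hui j).congr (hu'e j))] with z hz
      exact tendsto_iff_norm_sub_tendsto_zero.mp hz
    filter_upwards [hl0, hu0] with z h1 h2
    have h3 : Tendsto (fun n => ∑ j, (dev n (l' j) z + dev n (u' j) z)) atTop (𝓝 0) := by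
      have := tendsto_finsetSum (Finset.univ : Finset (Fin k)) fun j _ => (h1 j).add (h2 j)
      simpa using this
    filter_upwards [h3.eventually (gt_mem_nhds (half_pos hε))] with n hn
    exact ENNReal.ofReal_le_ofReal (by linarith)

end Uniform

end

/-! ### Transfer from the sequence space to the given probability space -/

theorem theorem1 {Ω : Type*} [MeasurableSpace Ω] (P : Measure Ω) [IsProbabilityMeasure P]
    (μF μG : Measure ℝ) [IsProbabilityMeasure μF] [IsProbabilityMeasure μG]
    (hF : Continuous (cdf μF)) (hG : Continuous (cdf μG))
    (hab : lowerBdry μG < upperBdry μF)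
    (Y T : ℕ → Ω → ℝ)
    (hlaw : ∀ i, HasLaw (fun ω => (Y i ω, T i ω)) (truncLaw μF μG) P)
    (hindep : iIndepFun (fun (i : ℕ) (ω : Ω) => (Y i ω, T i ω)) P)
    (𝓕 : Set (ℝ → ℝ))
    (h𝓕 : ∀ φ ∈ 𝓕, Measurable φ ∧ Integrable φ μF)
    (hbr : ∀ ε : ℝ, 0 < ε → bracketingNumber ε 𝓕 1 μF < ⊤) :
    TendstoZeroOuterAS P (fun n ω =>
        supDev 𝓕 (lyndenBellMeasure n (fun i => Y i ω) (fun i => T i ω)) (identLaw μF μG)) ∧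
      (lowerBdry μG ≤ lowerBdry μF →
        TendstoZeroOuterAS P (fun n ω =>
          supDev 𝓕 (lyndenBellMeasure n (fun i => Y i ω) (fun i => T i ω)) μF)) := by
  have hne := obsRange_nonempty hab
  have hα := truncProb_ne_zero μF μG hF hne
  have := isProbabilityMeasure_truncLaw μF μG hα
  have hseq : AEMeasurable (fun ω i => (Y i ω, T i ω)) P :=
    aemeasurable_pi_iff.mpr fun i => (hlaw i).aemeasurable
  have hQ := hindep.hasLaw_infinitePi hlaw hseq
  have main : TendstoZeroOuterAS P (fun n ω =>
      supDev 𝓕 (lyndenBellMeasure n (fun i => Y i ω) (fun i => T i ω)) (identLaw μF μG)) := by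
    refine tendstoZeroOuterAS_of_majorants P fun ε hε => ?_
    obtain ⟨V, hV1, hV2, hV3⟩ :=
      exists_majorant_supDev hF hG hne (fun φ hφ => (h𝓕 φ hφ).2) hbr hε
    rw [← hQ.map_eq] at hV2 hV3
    -- The data are only almost everywhere measurable in ω, so the majorants are composed with a
    -- measurable version of the sample sequence.
    refine ⟨fun n ω => V n (hseq.mk _ ω), fun n => (hV1 n).comp hseq.measurable_mk, fun n => ?_, ?_⟩
    · filter_upwards [ae_of_ae_map hseq (hV2 n), hseq.ae_eq_mk] with ω h1 h2
      rw [← h2]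
      exact h1
    · filter_upwards [ae_of_ae_map hseq hV3, hseq.ae_eq_mk] with ω h1 h2
      rw [← h2]
      exact h1
  refine ⟨main, fun h => ?_⟩
  rw [identLaw_eq_self hF h] at main
  exact main
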